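/- **Theorem (Cauchy's integral formula for $M$-solutions).** Let $n\ge 1$, let $\mathcal{C}\ell_{0,n}$ be the real Clifford algebra with unit $e_0=1$ and generators $e_1,\dots,e_n$, $e_ie_j+e_je_i=-2\delta_{ij}$, and let $\varepsilon\in\{1,-1\}$. For $y=(y_0,\dots,y_n)\in\mathbb{R}^{n+1}$ identify $y$ with $y_0+\varepsilon\sum_{j=1}^n y_je_j$, and let $\bar{\ }$ be Clifford conjugation, so that $\bar y=y_0-\varepsilon\sum_{j=1}^n y_je_j$. Put $$D=\frac{\partial}{\partial y_0}+\varepsilon\sum_{j=1}^n e_j\frac{\partial}{\partial y_j},\qquad E(y)=\frac{\Gamma(\frac{n+1}{2})}{2\pi^{(n+1)/2}}\,\frac{\bar y}{|y|^{n+1}},$$ $$d\sigma=dx_1\wedge\dots\wedge dx_n+\varepsilon\sum_{j=1}^n(-1)^je_j\,dx_0\wedge\dots\wedge[dx_j]\wedge\dots\wedge dx_n .$$ Let $\Omega\subset\mathbb{R}^{n+1}$ be a bounded open set with $C^1$ boundary, with $\partial\Omega$ oriented by the outward normal. Integrals of $n$-forms over $\partial\Omega$ are computed by pull-back along positively oriented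 $C^1$ parametrizations and a subordinate continuous partition of unity; such parametrizations and partitions of unity exist, and the formulas below hold for every choice of them. All functions below are continuous on $\bar\Omega$ and continuously differentiable in $\Omega$. 1. Let $V$ be a real Banach space that is a left $\mathcal{C}\ell_{0,n}$-module (compatibly with the real scalars) on which every Clifford number acts continuously, and let $M$ be a bounded real-linear operator on $C(\bar\Omega,V)$ that commutes with multiplication by the scalar $y_0$ and with $D$ (if $u\in C(\bar\Omega,V)\cap C^1(\Omega,V)$ and $Du$ extends to $w\in C(\bar\Omega,V)$, then $Mu\in C^1(\Omega,V)$ and $D(Mu)=Mw$ in $\Omega$). Write $e^{tM}=\sum_k t^kM^k/k!$. If $Df=Mf$ in $\Omega$, then $$\int_{\partial\Omega}E(y-x)\,d\sigma_y\,(e^{-y_0M}f)(y)$$ is, for $x\in\Omega$, the restriction to $\Omega$ of some $F\in C(\bar\Omega,V)$ with $(e^{x_0M}F)(x)=f(x)$ for all $x\in\Omega$, and it equals $0$ for all $x\notin\bar\Omega$. 2. Let $V$ be as in 1 and let $M:V\to V$ be a bounded real-linear operator commuting with the action of $e_1,\dots,e_n$. If $f:\bar\Omega\to V$ satisfies $Df=Mf$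 in $\Omega$, then $$e^{x_0M}\int_{\partial\Omega}E(y-x)\,d\sigma_y\,e^{-y_0M}f(y)=\begin{cases}f(x),&x\in\Omega,\\0,&x\notin\bar\Omega.\end{cases}$$ 3. Let $\lambda\in\mathcal{C}\ell_{0,n}$. If $f:\bar\Omega\to\mathcal{C}\ell_{0,n}$ satisfies $Df=f\lambda$ in $\Omega$, then $$\int_{\partial\Omega}E(y-x)\,d\sigma_y\,f(y)e^{(x_0-y_0)\lambda}=\begin{cases}f(x),&x\in\Omega,\\0,&x\notin\bar\Omega.\end{cases}$$ 4. Let $\lambda\in\mathbb{R}$. If $f:\bar\Omega\to\mathcal{C}\ell_{0,n}$ satisfies $Df=\lambda f$ in $\Omega$, then $$\int_{\partial\Omega}E(y-x)e^{(x_0-y_0)\lambda}\,d\sigma_y\,f(y)=\begin{cases}f(x),&x\in\Omega,\\0,&x\notin\bar\Omega.\end{cases}$$ -/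

import Mathlib

noncomputable section

namespace CliffordCauchy

/-- The Euclidean space `ℝ^{n+1}` with coordinates `y_0, …, y_n`. -/
abbrev Space (n : ℕ) := EuclideanSpace ℝ (Fin (n + 1))

/-- The negative definite form `v ↦ -∑ v_j ^ 2` on `ℝ^n`. -/
abbrev negForm (n : ℕ) : QuadraticForm ℝ (Fin n → ℝ) :=
  QuadraticMap.weightedSumSquares ℝ (fun _ : Fin n => (-1 : ℝ))

/-- The real Clifford algebra `Cl(0,n)`. -/
abbrev Cl (n : ℕ) := CliffordAlgebra (negForm n)

/-- The generator `e_j` of `Cl(0,n)`. -/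
def e {n : ℕ} (j : Fin n) : Cl n := CliffordAlgebra.ι (negForm n) (Pi.single j 1)

/-- The anticommutation relations `e_i e_j + e_j e_i = -2 δ_{ij}`. -/
theorem e_anticomm {n : ℕ} (i j : Fin n) :
    (e i * e j + e j * e i : Cl n) = algebraMap ℝ (Cl n) (if i = j then -2 else 0) := by
  unfold e
  rw [CliffordAlgebra.ι_mul_ι_add_swap]
  congr 1
  simp only [QuadraticMap.polar, QuadraticMap.weightedSumSquares_apply, Pi.add_apply,
    smul_eq_mul, ← Finset.sum_sub_distrib]
  have h : ∀ k : Fin n,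
      (-1 * (((Pi.single i (1 : ℝ) : Fin n → ℝ) k + (Pi.single j (1 : ℝ) : Fin n → ℝ) k) *
        ((Pi.single i (1 : ℝ) : Fin n → ℝ) k + (Pi.single j (1 : ℝ) : Fin n → ℝ) k)) -
        -1 * ((Pi.single i (1 : ℝ) : Fin n → ℝ) k * (Pi.single i (1 : ℝ) : Fin n → ℝ) k) -
        -1 * ((Pi.single j (1 : ℝ) : Fin n → ℝ) k * (Pi.single j (1 : ℝ) : Fin n → ℝ) k)) =
      if k = i then (if i = j then (-2 : ℝ) else 0) else 0 := by
    intro k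
    rcases eq_or_ne k i with rfl | hki
    · rcases eq_or_ne k j with rfl | hkj
      · simp
        norm_num
      · simp [hkj]
    · simp [hki]
  rw [Finset.sum_congr rfl (fun k _ => h k)]
  simp

/-- A linear basis of `Cl(0,n)`, indexed by the subsets of `{1, …, n}`. -/
def clBasis (n : ℕ) : Module.Basis (Finset (Fin n)) ℝ (Cl n) :=
  (Pi.basisFun ℝ (Fin n)).ExteriorAlgebra.map
    (CliffordAlgebra.equivExterior (negForm n)).symm

section Norm

attribute [local instance] Matrix.linftyOpNormedRing Matrix.linftyOpNormedAlgebra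

/-- `Cl(0,n)` is finite dimensional, so all its vector space norms are equivalent and the choice
of a norm is irrelevant for continuity, derivatives, integrals and exponentials. This one is the
operator norm of left multiplication for an `ℓ^∞` norm on coordinates. -/
instance instNormedRingCl (n : ℕ) : NormedRing (Cl n) :=
  NormedRing.induced (Cl n) (Matrix (Finset (Fin n)) (Finset (Fin n)) ℝ)
    (Algebra.leftMulMatrix (clBasis n)) (Algebra.leftMulMatrix_injective (clBasis n))

instance instNormedAlgebraCl (n : ℕ) : NormedAlgebra ℝ (Cl n) :=
  NormedAlgebra.induced ℝ (Cl n) (Matrix (Finset (Fin n)) (Finset (Fin n)) ℝ)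
    (Algebra.leftMulMatrix (clBasis n))

end Norm

instance instFiniteDimensionalCl (n : ℕ) : FiniteDimensional ℝ (Cl n) :=
  (clBasis n).finiteDimensional_of_finite

/-- The units attached to the coordinates `y_0, …, y_n`: the unit `e_0 = 1`, followed by
`ε e_1, …, ε e_n`. Only the signs `ε = 1` and `ε = -1` are used; both systems satisfy the
anticommutation relations. -/
def unit {n : ℕ} (ε : ℝ) : Fin (n + 1) → Cl n := Fin.cons 1 (fun j => ε • e j)

/-- The paravector `y_0 + ε ∑_j y_j e_j`. -/
def paravector {n : ℕ} (ε : ℝ) (y : Space n) : Cl n := ∑ j, y j • unit ε j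

/-- The Cauchy kernel `E(y) = Γ((n+1)/2) / (2 π^{(n+1)/2}) · conj(y) / |y|^{n+1}`; on the Clifford
algebra of Mathlib, `star` is the Clifford conjugation. -/
def cauchyKernel {n : ℕ} (ε : ℝ) (y : Space n) : Cl n :=
  (Real.Gamma (((n : ℝ) + 1) / 2) / (2 * Real.pi ^ (((n : ℝ) + 1) / 2)) / ‖y‖ ^ (n + 1)) •
    star (paravector ε y)

/-- The `Cl(0,n)`-valued `n`-form
`dσ = ∑_j (-1)^j e_j dx_0 ∧ … ∧ [dx_j] ∧ … ∧ dx_n` evaluated at tangent vectors `v_1, …, v_n`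
(with `ε e_j` in place of `e_j` for `j ≥ 1`). -/
def surfaceForm {n : ℕ} (ε : ℝ) (v : Fin n → Space n) : Cl n :=
  ∑ j : Fin (n + 1),
    ((-1 : ℝ) ^ (j : ℕ) * Matrix.det (Matrix.of fun i k : Fin n => v k (j.succAbove i))) •
      unit ε j

/-- The operator `D = ∂/∂y_0 + ε ∑_j e_j ∂/∂y_j` on functions with values in a left module over
the Clifford algebra. -/
def dirac {n : ℕ} {V : Type*} [NormedAddCommGroup V] [NormedSpace ℝ V] [Module (Cl n) V]
    (ε : ℝ) (f : Space n → V) (y : Space n) : V :=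
  ∑ j : Fin (n + 1), unit ε j • fderiv ℝ f y (EuclideanSpace.single j 1)

/-- `f` is continuous on the closure of `Ω`, continuously differentiable in `Ω`, and `D f = w` at
every point of `Ω`. -/
structure SolvesDirac {n : ℕ} {V : Type*} [NormedAddCommGroup V] [NormedSpace ℝ V]
    [Module (Cl n) V] (ε : ℝ) (Ω : Set (Space n)) (f w : Space n → V) : Prop where
  continuousOn : ContinuousOn f (closure Ω)
  contDiffOn : ContDiffOn ℝ 1 f Ω
  eq : ∀ y ∈ Ω, dirac ε f y = w y

/-- Bounded open sets with `C^1` boundary, by local defining functions. -/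
structure IsC1Domain {n : ℕ} (Ω : Set (Space n)) : Prop where
  isOpen : IsOpen Ω
  isBounded : Bornology.IsBounded Ω
  boundary : ∀ p ∈ frontier Ω, ∃ ρ : Space n → ℝ,
    ContDiffAt ℝ 1 ρ p ∧ fderiv ℝ ρ p ≠ 0 ∧ ∀ᶠ y in nhds p, (y ∈ Ω ↔ ρ y < 0)

/-- The coordinate tangent vectors `∂φ/∂u_1, …, ∂φ/∂u_n`. -/
def tangent {n : ℕ} (φ : EuclideanSpace ℝ (Fin n) → Space n) (u : EuclideanSpace ℝ (Fin n)) :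
    Fin n → Space n :=
  fun k => fderiv ℝ φ u (EuclideanSpace.single k 1)

/-- A positively oriented `C^1` parametrization of a relatively open piece of the boundary of `Ω`
(outward vector first: an outward transversal vector followed by the coordinate tangent vectors
is a positively oriented basis of `ℝ^{n+1}`). -/
structure BoundaryPatch {n : ℕ} (Ω : Set (Space n)) where
  dom : Set (EuclideanSpace ℝ (Fin n))
  isOpen_dom : IsOpen dom
  φ : EuclideanSpace ℝ (Fin n) → Space n
  contDiffOn : ContDiffOn ℝ 1 φ dom
  injOn : Set.InjOn φ dom
  /-- `φ` is a homeomorphism of `dom` onto a relatively open subset of the boundary. -/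
  image_open : ∀ O ⊆ dom, IsOpen O → ∃ W, IsOpen W ∧ φ '' O = W ∩ frontier Ω
  oriented : ∀ u ∈ dom, ∃ w : Space n,
    (∀ᶠ t : ℝ in nhdsWithin 0 (Set.Ioi 0), φ u + t • w ∉ closure Ω ∧ φ u - t • w ∈ Ω) ∧
      0 < Matrix.det (Matrix.of fun i k : Fin (n + 1) =>
        (Fin.cons w (tangent φ u) : Fin (n + 1) → Space n) k i)

/-- A finite family of positively oriented parametrizations of pieces of the boundary of `Ω`,
with a continuous partition of unity on the boundary that is subordinate to it. -/
structure BoundaryAtlas {n : ℕ} (Ω : Set (Space n)) where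
  card : ℕ
  patch : Fin card → BoundaryPatch Ω
  χ : Fin card → Space n → ℝ
  continuous_χ : ∀ i, Continuous (χ i)
  support_χ : ∀ i, tsupport (χ i) ∩ frontier Ω ⊆ (patch i).φ '' (patch i).dom
  sum_χ : ∀ y ∈ frontier Ω, ∑ i, χ i y = 1

/-- The integral `∫_{∂Ω} K(y) dσ_y g(y)` of a differential form over the oriented boundary: the sum
over the patches of the integrals of the pull-backs, localized by the partition of unity. -/
def BoundaryAtlas.integral {n : ℕ} {Ω : Set (Space n)} {V : Type*} [NormedAddCommGroup V]
    [NormedSpace ℝ V] [Module (Cl n) V] (A : BoundaryAtlas Ω) (ε : ℝ)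
    (K : Space n → Cl n) (g : Space n → V) : V :=
  ∑ i, ∫ u in (A.patch i).dom,
    A.χ i ((A.patch i).φ u) •
      (K ((A.patch i).φ u) • (surfaceForm ε (tangent (A.patch i).φ u) • g ((A.patch i).φ u)))

/-- The function on the whole space that extends a function on the closure of `Ω` by zero (only
its values on the closure of `Ω` matter). -/
def extendZero {n : ℕ} {Ω : Set (Space n)} {V : Type*} [NormedAddCommGroup V]
    (u : BoundedContinuousFunction (closure Ω) V) : Space n → V :=
  Function.extend Subtype.val u 0

/-- The conditions on a bounded operator `M` on the Banach space of (bounded) continuous `V`-valued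
functions on the closure of `Ω`: it commutes with the operator `D` on its natural domain and with
multiplication by the scalar variable `y_0`. -/
structure IsAdmissible {n : ℕ} {Ω : Set (Space n)} {V : Type*} [NormedAddCommGroup V]
    [NormedSpace ℝ V] [Module (Cl n) V] (ε : ℝ)
    (M : BoundedContinuousFunction (closure Ω) V →L[ℝ] BoundedContinuousFunction (closure Ω) V) :
    Prop where
  comm_dirac : ∀ u w : BoundedContinuousFunction (closure Ω) V,
    SolvesDirac ε Ω (extendZero u) (extendZero w) →
      SolvesDirac ε Ω (extendZero (M u)) (extendZero (M w))
  comm_time : ∀ u w : BoundedContinuousFunction (closure Ω) V,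
    (∀ y, w y = (y : Space n) 0 • u y) → ∀ y, M w y = (y : Space n) 0 • M u y

end CliffordCauchy

end

open CliffordCauchy

open CliffordCauchy

/-! The factor `e^{-y_0 M}` turns `Df = Mf` into `Dg = 0`. Only `∂/∂y_0` acts on the factor, and the
unit in front of it is `1`, so if the factor commutes with the units, the product rule gives
`D(e^{-y_0 M} f) = e^{-y_0 M}(Df - Mf) = 0` (`SolvesDirac.twist`). Cauchy's formula for `g` is then
untwisted at `x`. This settles operators on the values, right multiplications and real scalars.

If `M` acts on functions, the twisted function is not known to be differentiable. The partial sums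
`u_N` of the exponential series are, and telescoping gives `D u_N = (-y_0)^{N-1}/(N-1)! · M^N f`,
which tends to `0` uniformly (`IsAdmissible.exists_approximation`). Cauchy's formula is therefore
proved for uniform limits of such approximate solutions
(`BoundaryAtlas.cauchy_integral_of_tendsto`). Commutation with `y_0` makes the twist the exponential
of one bounded operator, hence continuous in `x` and invertible (`IsAdmissible.exists_twisted`).

For Cauchy's formula no ball around `x` is removed. The kernel is replaced by `E_δ(y) = c (|y|² +
δ²)^{-(n+1)/2} ȳ`. Applying `D` to it from the right gives a nonnegative scalar function of mass one
that concentrates at `0` as `δ → 0` (`diracRight_regKernel`, `integral_peak`, `peak_smul`). The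
divergence theorem for the fields `E_δ e_j g` equates the boundary integral with the integral of
`(E_δ D) g` over `Ω`, up to a term with `Dg`, and `δ → 0` yields `g(x)` or `0`.

The divergence theorem (`BoundaryAtlas.setIntegral_divergence`) comes from translations. For `e`
pointing outwards near a boundary point, the difference quotient of `f` along `e`, integrated over
`Ω`, equals `δ⁻¹` times the integral of `f` over the collar that leaves `Ω` under translation by
`δe`. The map `(t, u) ↦ φ(u) - δ t e` parametrizes the collar with Jacobian `δ det(e, ∂φ)`, so the
limit is the flux. The collar does not depend on the parametrization, so the same limit also
compares overlapping patches.

Atlases exist because the inverse function theorem flattens the boundary and the boundary is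
compact. -/

namespace CliffordCauchy

section

open MeasureTheory Filter Topology Set

/-! ### Determinants of frames and boundary parametrizations. -/

section

variable {n : ℕ}

/-- The coefficients of the `n`-form `v ↦ det (e, v_1, …, v_n)` in the vector `e`. -/
def normalCoeff (v : Fin n → Space n) (j : Fin (n + 1)) : ℝ :=
  (-1 : ℝ) ^ (j : ℕ) * Matrix.det (Matrix.of fun i k : Fin n => v k (j.succAbove i))

/-- The determinant `det (e, v_1, …, v_n)`, expanded along `e`. -/
def normalForm (v : Fin n → Space n) (e : Space n) : ℝ := ∑ j, normalCoeff v j * e j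

theorem surfaceForm_eq (ε : ℝ) (v : Fin n → Space n) :
    surfaceForm ε v = ∑ j, normalCoeff v j • unit ε j := rfl

theorem normalForm_eq_det (v : Fin n → Space n) (e : Space n) :
    normalForm v e =
      Matrix.det (Matrix.of fun i k : Fin (n + 1) => (Fin.cons e v : Fin (n + 1) → Space n) k i) := by
  rw [Matrix.det_succ_column_zero]
  refine Finset.sum_congr rfl fun j _ => ?_
  simp only [normalCoeff, Matrix.of_apply, Fin.cons_zero]
  have : (Matrix.of fun i k : Fin (n + 1) => (Fin.cons e v : Fin (n + 1) → Space n) k i).submatrix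
      j.succAbove Fin.succ = Matrix.of fun i k : Fin n => v k (j.succAbove i) := by
    ext i k
    simp
  rw [this]
  ring

theorem normalForm_add (v : Fin n → Space n) (a b : Space n) :
    normalForm v (a + b) = normalForm v a + normalForm v b := by
  simp [normalForm, mul_add, Finset.sum_add_distrib]

theorem normalForm_smul (v : Fin n → Space n) (c : ℝ) (a : Space n) :
    normalForm v (c • a) = c * normalForm v a := by
  simp [normalForm, Finset.mul_sum, mul_left_comm]

theorem normalForm_single (v : Fin n → Space n) (j : Fin (n + 1)) :
    normalForm v (EuclideanSpace.single j 1) = normalCoeff v j := by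
  simp [normalForm]

theorem normalForm_self (v : Fin n → Space n) (k : Fin n) : normalForm v (v k) = 0 := by
  rw [normalForm_eq_det]
  exact Matrix.det_zero_of_column_eq (Fin.succ_ne_zero k).symm (fun i => by simp)

theorem normalForm_sum (v : Fin n → Space n) (b : Fin n → ℝ) :
    normalForm v (∑ k, b k • v k) = 0 := by
  have : ∀ s : Finset (Fin n), normalForm v (∑ k ∈ s, b k • v k) = 0 := by
    intro s
    induction s using Finset.cons_induction with
    | empty => simp [normalForm]
    | cons a s ha ih => rw [Finset.sum_cons, normalForm_add, ih, normalForm_smul, normalForm_self]; simp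
  exact this _

/-- A vector is a combination of a basis, given as a transversal vector and tangent vectors. -/
theorem exists_decomposition {v : Fin n → Space n} {w : Space n} (h : normalForm v w ≠ 0)
    (e : Space n) : ∃ (a : ℝ) (b : Fin n → ℝ), e = a • w + ∑ k, b k • v k := by
  rw [normalForm_eq_det] at h
  set A : Matrix (Fin (n + 1)) (Fin (n + 1)) ℝ :=
    Matrix.of fun i k : Fin (n + 1) => (Fin.cons w v : Fin (n + 1) → Space n) k i with hA
  have hc : A.mulVec (A⁻¹.mulVec (fun i => e i)) = fun i => e i := by
    rw [Matrix.mulVec_mulVec, Matrix.mul_nonsing_inv _ (isUnit_iff_ne_zero.mpr h), Matrix.one_mulVec]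
  refine ⟨A⁻¹.mulVec (fun i => e i) 0, fun k => A⁻¹.mulVec (fun i => e i) k.succ, ?_⟩
  ext i
  have := congrFun hc i
  rw [Matrix.mulVec, dotProduct, Fin.sum_univ_succ] at this
  rw [← this]
  simp [hA, mul_comm]

/-- Modulo the tangent vectors `e` is a multiple `a w`, and both `l` and `normalForm v` see only
`a`. The weak inequality for `l w`, which is all that a one-sided difference quotient provides,
suffices because `l e > 0` already excludes `a ≤ 0`. -/
theorem normalForm_pos_of_functional {v : Fin n → Space n} {w e : Space n}
    (l : Space n →L[ℝ] ℝ) (hl : ∀ k, l (v k) = 0) (hw : 0 ≤ l w) (hpos : 0 < normalForm v w)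
    (he : 0 < l e) : 0 < normalForm v e := by
  obtain ⟨a, b, rfl⟩ := exists_decomposition hpos.ne' e
  have h1 : l (a • w + ∑ k, b k • v k) = a * l w := by simp [map_sum, hl]
  rw [h1] at he
  rw [normalForm_add, normalForm_smul, normalForm_sum, add_zero]
  have ha : 0 < a := by
    by_contra hcon
    nlinarith [mul_nonneg (neg_nonneg.mpr (not_lt.mp hcon)) hw]
  positivity

/-- Projection to the last `n` coordinates. -/
def tail (z : Space n) : EuclideanSpace ℝ (Fin n) := WithLp.toLp 2 fun i => z i.succ

@[simp] theorem tail_apply (z : Space n) (i : Fin n) : tail z i = z i.succ := rfl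

/-- The projection to the last coordinates as a continuous linear map. -/
noncomputable def tailL (n : ℕ) : Space n →L[ℝ] EuclideanSpace ℝ (Fin n) :=
  LinearMap.toContinuousLinearMap
    { toFun := tail
      map_add' := fun x y => by ext i; simp
      map_smul' := fun c x => by ext i; simp }

@[simp] theorem tailL_apply (z : Space n) : tailL n z = tail z := rfl

theorem continuous_tail : Continuous (tail : Space n → EuclideanSpace ℝ (Fin n)) :=
  (tailL n).continuous

theorem measurable_tail : Measurable (tail : Space n → EuclideanSpace ℝ (Fin n)) :=
  continuous_tail.measurable

/-- The slab of points with first coordinate in `(0, 1]`. -/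
def slab (n : ℕ) : Set (Space n) := {z | z 0 ∈ Ioc (0 : ℝ) 1}

theorem measurableSet_slab : MeasurableSet (slab n) := by
  unfold slab
  have : Measurable fun z : Space n => z 0 := by fun_prop
  exact this measurableSet_Ioc

/-- The slab has thickness one, so forgetting `z_0` integrates out a probability measure. Integrals
over the parameter domain in `ℝ^n` thereby become integrals over `ℝ^{n+1}`, where the change of
variables formula can compare them with integrals over a collar. -/
theorem measurePreserving_tail :
    MeasurePreserving (tail : Space n → EuclideanSpace ℝ (Fin n)) (volume.restrict (slab n)) volume := by
  have h1 := PiLp.volume_preserving_ofLp (Fin (n + 1))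
  have h2 := volume_preserving_piFinSuccAbove (fun _ : Fin (n + 1) => ℝ) 0
  have h3 := PiLp.volume_preserving_toLp (Fin n)
  have h4 : MeasurePreserving (Prod.snd : ℝ × (Fin n → ℝ) → (Fin n → ℝ))
      ((volume : Measure (ℝ × (Fin n → ℝ))).restrict (Ioc (0 : ℝ) 1 ×ˢ univ)) volume := by
    rw [Measure.volume_eq_prod, ← Measure.prod_restrict, Measure.restrict_univ]
    have : IsProbabilityMeasure ((volume : Measure ℝ).restrict (Ioc (0 : ℝ) 1)) :=
      ⟨by simp⟩
    exact measurePreserving_snd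
  have h12 := h2.comp h1
  have h5 := h12.restrict_preimage (s := Ioc (0 : ℝ) 1 ×ˢ univ) (measurableSet_Ioc.prod MeasurableSet.univ)
  have h6 := h3.comp (h4.comp h5)
  have hs : ((MeasurableEquiv.piFinSuccAbove (fun _ : Fin (n + 1) => ℝ) 0) ∘ WithLp.ofLp) ⁻¹'
      (Ioc (0 : ℝ) 1 ×ˢ univ) = slab n := by
    ext z
    simp [slab, MeasurableEquiv.piFinSuccAbove]
  rw [hs] at h6
  exact h6

namespace BoundaryPatch

variable {Ω : Set (Space n)} (P : BoundaryPatch Ω)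

theorem image_dom_subset : P.φ '' P.dom ⊆ frontier Ω := by
  obtain ⟨W, -, hW⟩ := P.image_open P.dom subset_rfl P.isOpen_dom
  rw [hW]
  exact inter_subset_right

theorem mem_frontier {u : EuclideanSpace ℝ (Fin n)} (hu : u ∈ P.dom) : P.φ u ∈ frontier Ω :=
  P.image_dom_subset (mem_image_of_mem _ hu)

theorem continuousOn_φ : ContinuousOn P.φ P.dom := P.contDiffOn.continuousOn

theorem hasFDerivAt {u : EuclideanSpace ℝ (Fin n)} (hu : u ∈ P.dom) :
    HasFDerivAt P.φ (fderiv ℝ P.φ u) u :=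
  ((P.contDiffOn.differentiableOn one_ne_zero).differentiableAt
    (P.isOpen_dom.mem_nhds hu)).hasFDerivAt

theorem continuousOn_tangent (k : Fin n) : ContinuousOn (fun u => tangent P.φ u k) P.dom := by
  have := P.contDiffOn.continuousOn_fderiv_of_isOpen P.isOpen_dom le_rfl
  exact this.clm_apply continuousOn_const

theorem continuousOn_normalCoeff (j : Fin (n + 1)) :
    ContinuousOn (fun u => normalCoeff (tangent P.φ u) j) P.dom := by
  unfold normalCoeff
  refine continuousOn_const.mul ?_
  rw [continuousOn_iff_continuous_domRestrict]
  refine Continuous.matrix_det ?_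
  refine continuous_matrix fun i k => ?_
  have h := continuousOn_iff_continuous_domRestrict.mp (P.continuousOn_tangent k)
  have h2 : Continuous fun x : Space n => x (j.succAbove i) := by fun_prop
  exact h2.comp h

theorem continuousOn_normalForm (e : Space n) :
    ContinuousOn (fun u => normalForm (tangent P.φ u) e) P.dom := by
  unfold normalForm
  exact continuousOn_finsetSum _ fun j _ => (P.continuousOn_normalCoeff j).mul continuousOn_const

/-- Since `φ` maps open sets to relatively open ones, its inverse is continuous on `Z`. All
integrability on patches rests on this: `dom` may be unbounded and the derivative of `φ` may blow up
towards its edge. -/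
theorem isCompact_preimage {Z : Set (Space n)} (hZ : IsCompact Z) (hsub : Z ⊆ P.φ '' P.dom) :
    IsCompact (P.dom ∩ P.φ ⁻¹' Z) := by
  set g := Function.invFunOn P.φ P.dom
  have hg : ∀ u ∈ P.dom, g (P.φ u) = u := fun u hu => P.injOn.leftInvOn_invFunOn hu
  have hc : ContinuousOn g Z := by
    intro y hy
    obtain ⟨u, hu, rfl⟩ := hsub hy
    rw [ContinuousWithinAt, hg u hu]
    rw [tendsto_nhds]
    intro O hO huO
    obtain ⟨W, hW, hWO⟩ := P.image_open (O ∩ P.dom) inter_subset_right (hO.inter P.isOpen_dom)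
    have hyW : P.φ u ∈ W := by
      have : P.φ u ∈ W ∩ frontier Ω := hWO ▸ mem_image_of_mem _ ⟨huO, hu⟩
      exact this.1
    filter_upwards [mem_nhdsWithin_of_mem_nhds (hW.mem_nhds hyW), self_mem_nhdsWithin] with y hyW hyZ
    have : y ∈ P.φ '' (O ∩ P.dom) := by
      rw [hWO]
      exact ⟨hyW, P.image_dom_subset (hsub hyZ)⟩
    obtain ⟨u', hu', rfl⟩ := this
    change g (P.φ u') ∈ O
    rw [hg u' hu'.2]
    exact hu'.1
  have : P.dom ∩ P.φ ⁻¹' Z = g '' Z := by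
    ext u
    constructor
    · rintro ⟨hu, huZ⟩
      exact ⟨P.φ u, huZ, hg u hu⟩
    · rintro ⟨y, hy, rfl⟩
      obtain ⟨u, hu, rfl⟩ := hsub hy
      rw [hg u hu]
      exact ⟨hu, hy⟩
  rw [this]
  exact hZ.image_of_continuousOn hc

end BoundaryPatch

end

/-! ### Defining functions that increase in a fixed outward direction. -/

section

variable {n : ℕ}

/-- `ρ` is a defining function of `Ω` on the convex open set `N`, strictly increasing in the
direction `e`. -/
structure IsOutward (Ω N : Set (Space n)) (ρ : Space n → ℝ) (e : Space n) : Prop where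
  isOpen_domain : IsOpen Ω
  isOpen : IsOpen N
  convex : Convex ℝ N
  differentiableAt : ∀ y ∈ N, DifferentiableAt ℝ ρ y
  mem_iff : ∀ y ∈ N, (y ∈ Ω ↔ ρ y < 0)
  pos : ∀ y ∈ N, 0 < fderiv ℝ ρ y e

namespace IsOutward

variable {Ω N : Set (Space n)} {ρ : Space n → ℝ} {e : Space n} (h : IsOutward Ω N ρ e)
include h

theorem lt_add {y : Space n} {t : ℝ} (hy : y ∈ N) (ht : 0 < t) (hyt : y + t • e ∈ N) :
    ρ y < ρ (y + t • e) := by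
  have hmem : ∀ s ∈ Icc 0 t, y + s • e ∈ N := by
    intro s hs
    have : y + s • e = (1 - s / t) • y + (s / t) • (y + t • e) := by
      rw [smul_add, smul_smul, div_mul_cancel₀ _ ht.ne', sub_smul, one_smul]
      abel
    rw [this]
    exact h.convex hy hyt (by rw [sub_nonneg, div_le_one ht]; exact hs.2)
      (div_nonneg hs.1 ht.le) (by ring)
  have hder : ∀ s ∈ Icc 0 t, HasDerivAt (fun s : ℝ => ρ (y + s • e)) (fderiv ℝ ρ (y + s • e) e) s := by
    intro s hs
    have h1 : HasDerivAt (fun s : ℝ => y + s • e) e s := by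
      simpa using ((hasDerivAt_id s).smul_const e).const_add y
    exact (h.differentiableAt _ (hmem s hs)).hasFDerivAt.comp_hasDerivAt s h1
  have hmono : StrictMonoOn (fun s : ℝ => ρ (y + s • e)) (Icc 0 t) := by
    refine strictMonoOn_of_deriv_pos (convex_Icc 0 t)
      (fun s hs => (hder s hs).continuousAt.continuousWithinAt) fun s hs => ?_
    have hs' := interior_subset hs
    rw [(hder s hs').deriv]
    exact h.pos _ (hmem s hs')
  simpa using hmono (left_mem_Icc.mpr ht.le) (right_mem_Icc.mpr ht.le) ht

theorem nonpos_of_mem_closure {y : Space n} (hy : y ∈ N) (hc : y ∈ closure Ω) : ρ y ≤ 0 := by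
  by_contra hcon
  push Not at hcon
  have h1 : ∀ᶠ z in 𝓝 y, 0 < ρ z := (h.differentiableAt y hy).continuousAt.eventually_const_lt hcon
  obtain ⟨z, hz, hz2, hz3⟩ :=
    ((mem_closure_iff_frequently.mp hc).and_eventually (h1.and (h.isOpen.mem_nhds hy))).exists
  exact absurd ((h.mem_iff z hz3).mp hz) (not_lt.mpr hz2.le)

theorem nonneg_of_notMem {y : Space n} (hy : y ∈ N) (hc : y ∉ Ω) : 0 ≤ ρ y := by
  by_contra hcon
  exact hc ((h.mem_iff y hy).mpr (not_le.mp hcon))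

theorem eq_zero_of_mem_frontier {y : Space n} (hy : y ∈ N) (hf : y ∈ frontier Ω) : ρ y = 0 := by
  rw [h.isOpen_domain.frontier_eq] at hf
  exact le_antisymm (h.nonpos_of_mem_closure hy hf.1) (h.nonneg_of_notMem hy hf.2)

theorem sub_mem {y : Space n} {t : ℝ} (hy : y ∈ N) (hc : y ∈ closure Ω) (ht : 0 < t)
    (hyt : y - t • e ∈ N) : y - t • e ∈ Ω := by
  rw [h.mem_iff _ hyt]
  have := h.lt_add hyt ht (by simpa using hy)
  rw [sub_add_cancel] at this
  exact this.trans_le (h.nonpos_of_mem_closure hy hc)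

/-- Consequently a line in direction `e` meets the boundary at most once inside `N`, which makes the
collar coordinates injective. -/
theorem add_notMem {y : Space n} {t : ℝ} (hy : y ∈ N) (hc : y ∉ Ω) (ht : 0 < t)
    (hyt : y + t • e ∈ N) : y + t • e ∉ closure Ω := fun hcl =>
  absurd (h.nonpos_of_mem_closure hyt hcl)
    (not_le.mpr ((h.nonneg_of_notMem hy hc).trans_lt (h.lt_add hy ht hyt)))

/-- The derivative of `ρ` kills the tangent vectors because `ρ ∘ φ = 0`, and it is nonnegative on
the vector `w` of the orientation condition because `ρ ≥ 0` outside `Ω`. Thus positivity passes from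
`w`, which depends on `u`, to the fixed direction `e`. -/
theorem normalForm_pos (P : BoundaryPatch Ω) {u : EuclideanSpace ℝ (Fin n)} (hu : u ∈ P.dom)
    (huN : P.φ u ∈ N) : 0 < normalForm (tangent P.φ u) e := by
  obtain ⟨w, hw, hdet⟩ := P.oriented u hu
  rw [← normalForm_eq_det] at hdet
  have hρ : HasFDerivAt ρ (fderiv ℝ ρ (P.φ u)) (P.φ u) := (h.differentiableAt _ huN).hasFDerivAt
  refine normalForm_pos_of_functional (fderiv ℝ ρ (P.φ u)) (fun k => ?_) ?_ hdet (h.pos _ huN)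
  · have h1 := hρ.comp u (P.hasFDerivAt hu)
    have h2 : ρ ∘ P.φ =ᶠ[𝓝 u] fun _ => 0 := by
      filter_upwards [P.isOpen_dom.mem_nhds hu,
        (P.continuousOn_φ.continuousAt (P.isOpen_dom.mem_nhds hu)).eventually_mem
          (h.isOpen.mem_nhds huN)] with v hv hvN
      exact h.eq_zero_of_mem_frontier hvN (P.mem_frontier hv)
    have h3 := h1.unique ((hasFDerivAt_const (0 : ℝ) u).congr_of_eventuallyEq h2)
    exact congrArg (fun l => l (EuclideanSpace.single k 1)) h3
  · have h1 : HasDerivAt (fun t : ℝ => P.φ u + t • w) w 0 := by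
      simpa using ((hasDerivAt_id (0 : ℝ)).smul_const w).const_add (P.φ u)
    have h2 : HasDerivAt (fun t : ℝ => ρ (P.φ u + t • w)) (fderiv ℝ ρ (P.φ u) w) 0 := by
      refine HasFDerivAt.comp_hasDerivAt 0 ?_ h1
      simpa using hρ
    have h3 := h2.tendsto_slope_zero_right
    refine ge_of_tendsto h3 ?_
    have h4 : Tendsto (fun t : ℝ => P.φ u + t • w) (𝓝[>] 0) (𝓝 (P.φ u)) := by
      have := h1.continuousAt.tendsto
      simp only [zero_smul, add_zero] at this
      exact this.mono_left nhdsWithin_le_nhds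
    filter_upwards [hw, h4.eventually_mem (h.isOpen.mem_nhds huN), self_mem_nhdsWithin] with t ht htN ht0
    have h5 := h.nonneg_of_notMem htN (fun hcon => ht.1 (subset_closure hcon))
    have h6 := h.eq_zero_of_mem_frontier huN (P.mem_frontier hu)
    simp only [zero_add, zero_smul, add_zero, h6, sub_zero, smul_eq_mul]
    exact mul_nonneg (inv_nonneg.mpr (le_of_lt ht0)) h5

/-- A line segment in the direction `e` that leaves `Ω` crosses the boundary. -/
theorem exists_crossing {y : Space n} {δ : ℝ} (hy : y ∈ Ω) (hδ : 0 < δ) (hyδ : y + δ • e ∉ Ω) :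
    ∃ t ∈ Ioc 0 δ, y + t • e ∈ frontier Ω := by
  have hcont : Continuous fun t : ℝ => y + t • e := by fun_prop
  have hpre : IsPreconnected ((fun t : ℝ => y + t • e) '' Icc 0 δ) :=
    isPreconnected_Icc.image _ hcont.continuousOn
  obtain ⟨t, ht, hz⟩ : ∃ t ∈ Icc 0 δ, y + t • e ∈ frontier Ω := by
    by_contra! hcon
    have hmem : ∀ t ∈ Icc 0 δ, y + t • e ∉ Ω → y + t • e ∈ (closure Ω)ᶜ := fun t ht htΩ hcl =>
      hcon t ht (by rw [h.isOpen_domain.frontier_eq]; exact ⟨hcl, htΩ⟩)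
    obtain ⟨z, -, hz1, hz2⟩ := hpre Ω (closure Ω)ᶜ h.isOpen_domain isClosed_closure.isOpen_compl
      (by
        rintro _ ⟨t, ht, rfl⟩
        by_cases htΩ : y + t • e ∈ Ω
        · exact Or.inl htΩ
        · exact Or.inr (hmem t ht htΩ))
      ⟨y, ⟨0, left_mem_Icc.mpr hδ.le, by simp⟩, hy⟩
      ⟨y + δ • e, ⟨δ, right_mem_Icc.mpr hδ.le, rfl⟩, hmem δ (right_mem_Icc.mpr hδ.le) hyδ⟩
    exact hz2 (subset_closure hz1)
  refine ⟨t, ⟨ht.1.lt_of_ne ?_, ht.2⟩, hz⟩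
  rintro rfl
  rw [h.isOpen_domain.frontier_eq] at hz
  simp only [zero_smul, add_zero] at hz
  exact hz.2 hy

end IsOutward

theorem eventually_isOutward {Ω : Set (Space n)} (hΩ : IsOpen Ω) {p : Space n} {ρ : Space n → ℝ}
    (hρ : ContDiffAt ℝ 1 ρ p) (hiff : ∀ᶠ y in 𝓝 p, (y ∈ Ω ↔ ρ y < 0)) {e : Space n}
    (he : 0 < fderiv ℝ ρ p e) : ∀ᶠ r in 𝓝[>] (0 : ℝ), IsOutward Ω (Metric.ball p r) ρ e := by
  have h1 : ∀ᶠ y in 𝓝 p, ContDiffAt ℝ 1 ρ y := hρ.eventually (by simp)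
  have h2 : ∀ᶠ y in 𝓝 p, 0 < fderiv ℝ ρ y e := by
    have : ContinuousAt (fderiv ℝ ρ) p := hρ.continuousAt_fderiv one_ne_zero
    exact (this.clm_apply continuousAt_const).eventually_const_lt he
  obtain ⟨R, hR, hball⟩ := Metric.eventually_nhds_iff_ball.mp (h1.and (h2.and hiff))
  filter_upwards [Ioo_mem_nhdsGT hR] with r hr
  have hsub : ∀ y ∈ Metric.ball p r, y ∈ Metric.ball p R := fun y hy =>
    Metric.ball_subset_ball hr.2.le hy
  exact ⟨hΩ, Metric.isOpen_ball, convex_ball p r,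
    fun y hy => (hball y (hsub y hy)).1.differentiableAt one_ne_zero,
    fun y hy => (hball y (hsub y hy)).2.2, fun y hy => (hball y (hsub y hy)).2.1⟩

end

/-! ### The collar swept out by a small translation. -/

section

variable {n : ℕ}

/-- The linear map `z ↦ L (z_1, …, z_n) - c z_0 e`. -/
noncomputable def shearMap (L : EuclideanSpace ℝ (Fin n) →L[ℝ] Space n) (c : ℝ) (e : Space n) :
    Space n →L[ℝ] Space n :=
  L.comp (tailL n) - (c • EuclideanSpace.proj (𝕜 := ℝ) (0 : Fin (n + 1))).smulRight e

/-- The columns of the matrix are `-c e` and the vectors `L e_k`. -/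
theorem det_shearMap (L : EuclideanSpace ℝ (Fin n) →L[ℝ] Space n) (c : ℝ) (e : Space n) :
    (shearMap L c e).det = -c * normalForm (fun k => L (EuclideanSpace.single k 1)) e := by
  rw [← normalForm_smul, normalForm_eq_det, ContinuousLinearMap.det,
    ← LinearMap.det_toMatrix (EuclideanSpace.basisFun (Fin (n + 1)) ℝ).toBasis]
  congr 1
  ext i k
  rw [LinearMap.toMatrix_apply]
  refine Fin.cases ?_ (fun k => ?_) k
  · have : tail (EuclideanSpace.single (0 : Fin (n + 1)) (1 : ℝ)) = 0 := by
      ext j; simp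
    simp [shearMap, this]
  · have : tail (EuclideanSpace.single k.succ (1 : ℝ)) = EuclideanSpace.single k 1 := by
      ext j; simp
    simp [shearMap, this]

/-- The part of `Ω` that leaves `Ω` under the translation by `δ e`. -/
def collar (Ω : Set (Space n)) (e : Space n) (δ : ℝ) : Set (Space n) := {y | y ∈ Ω ∧ y + δ • e ∉ Ω}

theorem measurableSet_collar {Ω : Set (Space n)} (hΩ : IsOpen Ω) (e : Space n) (δ : ℝ) :
    MeasurableSet (collar Ω e δ) := by
  have h : Continuous fun y : Space n => y + δ • e := by fun_prop
  exact hΩ.measurableSet.inter (hΩ.preimage h).measurableSet.compl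

theorem setIntegral_slab_tail {V : Type*} [NormedAddCommGroup V] [NormedSpace ℝ V]
    {S : Set (EuclideanSpace ℝ (Fin n))} (hS : MeasurableSet S) {g : EuclideanSpace ℝ (Fin n) → V}
    (hg : AEStronglyMeasurable g (volume.restrict S)) :
    ∫ z in slab n ∩ tail ⁻¹' S, g (tail z) = ∫ u in S, g u := by
  have h := (measurePreserving_tail (n := n)).restrict_preimage hS
  rw [Measure.restrict_restrict (measurable_tail hS), inter_comm] at h
  conv_rhs => rw [← h.map_eq]
  rw [integral_map h.measurable.aemeasurable (by rwa [h.map_eq])]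

theorem integrableOn_slab_tail {V : Type*} [NormedAddCommGroup V]
    {S : Set (EuclideanSpace ℝ (Fin n))} (hS : MeasurableSet S) {g : EuclideanSpace ℝ (Fin n) → V}
    (hg : IntegrableOn g S) : IntegrableOn (fun z => g (tail z)) (slab n ∩ tail ⁻¹' S) := by
  have h := (measurePreserving_tail (n := n)).restrict_preimage hS
  rw [Measure.restrict_restrict (measurable_tail hS), inter_comm] at h
  exact h.integrable_comp_of_integrable hg

theorem exists_bound_of_continuousOn {Ω : Set (Space n)} (hb : Bornology.IsBounded Ω) {V : Type*}
    [NormedAddCommGroup V] {f : Space n → V} (hf : ContinuousOn f (closure Ω)) :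
    ∃ C, ∀ y ∈ closure Ω, ‖f y‖ ≤ C :=
  hb.isCompact_closure.exists_bound_of_continuousOn hf

variable {Ω : Set (Space n)} {p e : Space n} {r : ℝ} {ρ : Space n → ℝ}

namespace BoundaryPatch

theorem integrableOn_normalForm (P : BoundaryPatch Ω) {s : ℝ} (hs : s < r)
    (hsub : Metric.ball p r ∩ frontier Ω ⊆ P.φ '' P.dom) (e : Space n) :
    IntegrableOn (fun u => normalForm (tangent P.φ u) e) (P.dom ∩ P.φ ⁻¹' Metric.closedBall p s) := by
  have hc : IsCompact (P.dom ∩ P.φ ⁻¹' (Metric.closedBall p s ∩ frontier Ω)) :=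
    P.isCompact_preimage ((isCompact_closedBall p s).inter_right isClosed_frontier)
      ((inter_subset_inter_left _ (Metric.closedBall_subset_ball hs)).trans hsub)
  have heq : P.dom ∩ P.φ ⁻¹' Metric.closedBall p s =
      P.dom ∩ P.φ ⁻¹' (Metric.closedBall p s ∩ frontier Ω) := by
    ext u
    exact ⟨fun hu => ⟨hu.1, hu.2, P.mem_frontier hu.1⟩, fun hu => ⟨hu.1, hu.2.1⟩⟩
  rw [heq]
  exact ((P.continuousOn_normalForm e).mono inter_subset_left).integrableOn_compact hc

/-- Change of variables along `z ↦ φ(z_1, …, z_n) - δ z_0 e`: a collar point near the support of `f`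
crosses the boundary exactly once, at a distance `δ z_0 ≤ δ` in direction `e`. The radii leave room
for this. The support lies within `r/2`, a translation moves points by less than `r/4`, so the
crossing lies within `3r/4`, and points moved from there stay in the ball of radius `r`. -/
theorem setIntegral_collar (P : BoundaryPatch Ω) (h : IsOutward Ω (Metric.ball p r) ρ e)
    (hsub : Metric.ball p r ∩ frontier Ω ⊆ P.φ '' P.dom) {V : Type*} [NormedAddCommGroup V]
    [NormedSpace ℝ V] {f : Space n → V} (hK : ∀ y ∉ Metric.closedBall p (r / 2), f y = 0)
    {δ : ℝ} (hδ : 0 < δ) (hδr : δ * ‖e‖ < r / 4) :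
    ∫ y in collar Ω e δ, f y =
      ∫ z in slab n ∩ tail ⁻¹' (P.dom ∩ P.φ ⁻¹' Metric.ball p (3 * r / 4)),
        (δ * normalForm (tangent P.φ (tail z)) e) • f (P.φ (tail z) - (δ * z 0) • e) := by
  set S := P.dom ∩ P.φ ⁻¹' Metric.ball p (3 * r / 4) with hS
  have hr : 0 < r := by
    have := mul_nonneg hδ.le (norm_nonneg e)
    linarith
  have hSo : IsOpen S := P.continuousOn_φ.isOpen_inter_preimage P.isOpen_dom Metric.isOpen_ball
  set R := slab n ∩ tail ⁻¹' S with hR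
  have hRm : MeasurableSet R :=
    measurableSet_slab.inter (hSo.preimage continuous_tail).measurableSet
  set Ψ : Space n → Space n := fun z => P.φ (tail z) - (δ * z 0) • e with hΨ
  have hder : ∀ z ∈ R, HasFDerivWithinAt Ψ (shearMap (fderiv ℝ P.φ (tail z)) δ e) R z := by
    intro z hz
    have h1 : HasFDerivAt (fun z : Space n => P.φ (tail z))
        ((fderiv ℝ P.φ (tail z)).comp (tailL n)) z :=
      HasFDerivAt.comp z (P.hasFDerivAt hz.2.1) (tailL n).hasFDerivAt
    have h2 : HasFDerivAt (fun z : Space n => (δ * z 0) • e)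
        ((δ • EuclideanSpace.proj (𝕜 := ℝ) (0 : Fin (n + 1))).smulRight e) z :=
      ((δ • EuclideanSpace.proj (𝕜 := ℝ) (0 : Fin (n + 1))).smulRight e).hasFDerivAt
    exact (h1.sub h2).hasFDerivWithinAt
  have hball : ∀ u ∈ S, P.φ u ∈ Metric.ball p r := fun u hu =>
    Metric.ball_subset_ball (by linarith) hu.2
  have hnorm : ∀ t ∈ Ioc 0 δ, ‖t • e‖ < r / 4 := by
    intro t ht
    rw [norm_smul, Real.norm_of_nonneg ht.1.le]
    exact (mul_le_mul_of_nonneg_right ht.2 (norm_nonneg e)).trans_lt hδr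
  have hts : ∀ z ∈ R, δ * z 0 ∈ Ioc 0 δ := by
    intro z hz
    exact ⟨mul_pos hδ hz.1.1, mul_le_of_le_one_right hδ.le hz.1.2⟩
  have hΩ : ∀ z ∈ R, Ψ z ∈ Ω := by
    intro z hz
    refine h.sub_mem (hball _ hz.2) (frontier_subset_closure (P.mem_frontier hz.2.1)) (hts z hz).1 ?_
    have h1 := hnorm _ (hts z hz)
    have h2 : dist (P.φ (tail z)) p < 3 * r / 4 := hz.2.2
    rw [Metric.mem_ball]
    calc dist (P.φ (tail z) - (δ * z 0) • e) p
        ≤ dist (P.φ (tail z) - (δ * z 0) • e) (P.φ (tail z)) + dist (P.φ (tail z)) p :=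
          dist_triangle _ _ _
      _ < r := by
        rw [dist_self_sub_left]
        linarith
  have hinj : InjOn Ψ R := by
    -- If the heights differed, the two boundary points would lie on one line in direction `e`,
    -- against `add_notMem`.
    have key : ∀ z ∈ R, ∀ z' ∈ R, Ψ z = Ψ z' → ¬ z 0 < z' 0 := by
      intro z hz z' hz' heq hlt
      have h1 : P.φ (tail z') = P.φ (tail z) + (δ * (z' 0 - z 0)) • e := by
        have : P.φ (tail z) - (δ * z 0) • e = P.φ (tail z') - (δ * z' 0) • e := heq
        rw [sub_eq_sub_iff_add_eq_add] at this
        rw [mul_sub, sub_smul, ← add_sub_assoc, this, add_sub_cancel_right]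
      have hz2 := P.mem_frontier hz.2.1
      rw [h.isOpen_domain.frontier_eq] at hz2
      refine h.add_notMem (hball _ hz.2) hz2.2 (mul_pos hδ (sub_pos.mpr hlt)) ?_ ?_
      · rw [← h1]
        exact hball _ hz'.2
      · rw [← h1]
        exact frontier_subset_closure (P.mem_frontier hz'.2.1)
    intro z hz z' hz' heq
    have h0 : z 0 = z' 0 :=
      le_antisymm (not_lt.mp (key z' hz' z hz heq.symm)) (not_lt.mp (key z hz z' hz' heq))
    have h1 : tail z = tail z' := by
      refine P.injOn hz.2.1 hz'.2.1 ?_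
      have : P.φ (tail z) - (δ * z 0) • e = P.φ (tail z') - (δ * z' 0) • e := heq
      rwa [h0, sub_left_inj] at this
    ext i
    refine Fin.cases h0 (fun i => ?_) i
    exact congrArg (fun u : EuclideanSpace ℝ (Fin n) => u i) h1
  have himage : MeasurableSet (Ψ '' R) := measurable_image_of_fderivWithin hRm hder hinj
  have hsets : ∫ y in collar Ω e δ, f y = ∫ y in Ψ '' R, f y := by
    rw [← integral_indicator (measurableSet_collar h.isOpen_domain e δ), ← integral_indicator himage]
    congr 1
    ext y
    by_cases hy : y ∈ Metric.closedBall p (r / 2)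
    swap
    · rw [indicator_apply_eq_zero.mpr fun _ => hK y hy, indicator_apply_eq_zero.mpr fun _ => hK y hy]
    have hyr : ∀ t ∈ Ioc 0 δ, y + t • e ∈ Metric.ball p (3 * r / 4) := by
      intro t ht
      have h1 := hnorm t ht
      have h2 : dist y p ≤ r / 2 := hy
      rw [Metric.mem_ball]
      calc dist (y + t • e) p ≤ dist (y + t • e) y + dist y p := dist_triangle _ _ _
        _ < 3 * r / 4 := by
          rw [dist_self_add_left]
          linarith
    have : y ∈ collar Ω e δ ↔ y ∈ Ψ '' R := by
      constructor
      · rintro ⟨hyΩ, hyδ⟩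
        obtain ⟨t, ht, htf⟩ := h.exists_crossing hyΩ hδ hyδ
        obtain ⟨u, hu, hut⟩ := hsub ⟨Metric.ball_subset_ball (by linarith) (hyr t ht), htf⟩
        refine ⟨WithLp.toLp 2 (Fin.cons (t / δ) u), ⟨?_, ?_⟩, ?_⟩
        · change (Fin.cons (t / δ) (u : Fin n → ℝ) : Fin (n + 1) → ℝ) 0 ∈ Ioc 0 1
          rw [Fin.cons_zero]
          exact ⟨div_pos ht.1 hδ, (div_le_one hδ).mpr ht.2⟩
        · have : tail (WithLp.toLp 2 (Fin.cons (t / δ) u) : Space n) = u := by ext i; simp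
          rw [mem_preimage, this]
          refine ⟨hu, ?_⟩
          rw [mem_preimage, hut]
          exact hyr t ht
        · have : tail (WithLp.toLp 2 (Fin.cons (t / δ) u) : Space n) = u := by ext i; simp
          simp only [hΨ]
          rw [this, hut]
          simp [mul_div_cancel₀ _ hδ.ne']
      · rintro ⟨z, hz, rfl⟩
        refine ⟨hΩ z hz, ?_⟩
        have h1 : Ψ z + δ • e = P.φ (tail z) + (δ * (1 - z 0)) • e := by
          simp only [hΨ]
          rw [mul_sub, sub_smul, mul_one]
          abel
        have hz2 := P.mem_frontier hz.2.1
        rw [h.isOpen_domain.frontier_eq] at hz2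
        -- At height `z_0 = 1` the translated point is on the boundary itself, hence not in the open
        -- set `Ω`. This is why the slab contains its upper face.
        rcases hz.1.2.eq_or_lt with h0 | h0
        · rw [h1, h0]
          simpa using hz2.2
        · have h2 : Ψ z + δ • e ∈ Metric.ball p r :=
            Metric.ball_subset_ball (by linarith) (hyr δ ⟨hδ, le_rfl⟩)
          rw [h1] at h2 ⊢
          exact fun hcon => h.add_notMem (hball _ hz.2) hz2.2 (mul_pos hδ (sub_pos.mpr h0)) h2
            (subset_closure hcon)
    by_cases hc : y ∈ collar Ω e δ
    · rw [indicator_of_mem hc, indicator_of_mem (this.mp hc)]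
    · rw [indicator_of_notMem hc, indicator_of_notMem (fun hcon => hc (this.mpr hcon))]
  rw [hsets, integral_image_eq_integral_abs_det_fderiv_smul volume hRm hder hinj]
  refine setIntegral_congr_fun hRm fun z hz => ?_
  simp only []
  rw [det_shearMap, neg_mul, abs_neg, abs_of_pos]
  · rfl
  · exact mul_pos hδ (h.normalForm_pos P hz.2.1 (hball _ hz.2))

/-- In collar coordinates the factor `δ` of the Jacobian cancels `δ⁻¹`, and `f` is evaluated at
points of `Ω` that converge to the boundary. Dominated convergence applies because `f` is bounded
and `normalForm` is integrable over the relevant part of the patch. -/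
theorem tendsto_collar (P : BoundaryPatch Ω) (h : IsOutward Ω (Metric.ball p r) ρ e)
    (hr : 0 < r) (hb : Bornology.IsBounded Ω)
    (hsub : Metric.ball p r ∩ frontier Ω ⊆ P.φ '' P.dom) {V : Type*} [NormedAddCommGroup V]
    [NormedSpace ℝ V] {f : Space n → V} (hf : ContinuousOn f (closure Ω))
    (hK : ∀ y ∉ Metric.closedBall p (r / 2), f y = 0) :
    Tendsto (fun δ : ℝ => δ⁻¹ • ∫ y in collar Ω e δ, f y) (𝓝[>] 0)
      (𝓝 (∫ u in P.dom, normalForm (tangent P.φ u) e • f (P.φ u))) := by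
  set S := P.dom ∩ P.φ ⁻¹' Metric.ball p (3 * r / 4) with hS
  have hSo : IsOpen S := P.continuousOn_φ.isOpen_inter_preimage P.isOpen_dom Metric.isOpen_ball
  set R := slab n ∩ tail ⁻¹' S with hR
  have hRm : MeasurableSet R :=
    measurableSet_slab.inter (hSo.preimage continuous_tail).measurableSet
  have hball : ∀ u ∈ S, P.φ u ∈ Metric.ball p r := fun u hu =>
    Metric.ball_subset_ball (by linarith) hu.2
  have hcl : ∀ u ∈ P.dom, P.φ u ∈ closure Ω := fun u hu => frontier_subset_closure (P.mem_frontier hu)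
  have hφS : ContinuousOn (fun u => f (P.φ u)) P.dom := hf.comp P.continuousOn_φ hcl
  have hmeas : AEStronglyMeasurable (fun u => normalForm (tangent P.φ u) e • f (P.φ u))
      (volume.restrict S) :=
    (((P.continuousOn_normalForm e).smul hφS).mono inter_subset_left).aestronglyMeasurable
      hSo.measurableSet
  have hlim : ∫ u in P.dom, normalForm (tangent P.φ u) e • f (P.φ u) =
      ∫ z in R, normalForm (tangent P.φ (tail z)) e • f (P.φ (tail z)) := by
    rw [setIntegral_slab_tail (g := fun u => normalForm (tangent P.φ u) e • f (P.φ u))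
      hSo.measurableSet hmeas]
    refine (setIntegral_eq_of_subset_of_forall_sdiff_eq_zero P.isOpen_dom.measurableSet
      inter_subset_left fun u hu => ?_)
    rw [hK, smul_zero]
    intro hcon
    exact hu.2 ⟨hu.1, Metric.closedBall_subset_ball (by linarith) hcon⟩
  rw [hlim]
  have hsmall : ∀ᶠ δ in 𝓝[>] (0 : ℝ), 0 < δ ∧ δ * ‖e‖ < r / 4 := by
    have h1 : Tendsto (fun δ : ℝ => δ * ‖e‖) (𝓝[>] 0) (𝓝 0) := by
      have : Continuous fun δ : ℝ => δ * ‖e‖ := by fun_prop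
      simpa using (this.tendsto 0).mono_left nhdsWithin_le_nhds
    filter_upwards [h1.eventually_lt_const (show 0 < r / 4 by linarith), self_mem_nhdsWithin]
      with δ h1 h2 using ⟨h2, h1⟩
  have heq : ∀ᶠ δ in 𝓝[>] (0 : ℝ), ∫ z in R, normalForm (tangent P.φ (tail z)) e •
      f (P.φ (tail z) - (δ * z 0) • e) = δ⁻¹ • ∫ y in collar Ω e δ, f y := by
    filter_upwards [hsmall] with δ hδ
    rw [P.setIntegral_collar h hsub hK hδ.1 hδ.2, ← integral_smul]
    refine setIntegral_congr_fun hRm fun z _ => ?_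
    simp only []
    rw [smul_smul, ← mul_assoc, inv_mul_cancel₀ hδ.1.ne', one_mul]
  refine Tendsto.congr' heq ?_
  obtain ⟨C, hC⟩ := exists_bound_of_continuousOn hb hf
  have hΩ : ∀ δ : ℝ, 0 < δ → δ * ‖e‖ < r / 4 → ∀ z ∈ R, P.φ (tail z) - (δ * z 0) • e ∈ Ω := by
    intro δ hδ hδr z hz
    refine h.sub_mem (hball _ hz.2) (hcl _ hz.2.1) (mul_pos hδ hz.1.1) ?_
    have h2 : dist (P.φ (tail z)) p < 3 * r / 4 := hz.2.2
    have h3 : ‖(δ * z 0) • e‖ < r / 4 := by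
      rw [norm_smul, Real.norm_of_nonneg (mul_pos hδ hz.1.1).le]
      refine lt_of_le_of_lt ?_ hδr
      exact mul_le_mul_of_nonneg_right (mul_le_of_le_one_right hδ.le hz.1.2) (norm_nonneg e)
    rw [Metric.mem_ball]
    calc dist (P.φ (tail z) - (δ * z 0) • e) p
        ≤ dist (P.φ (tail z) - (δ * z 0) • e) (P.φ (tail z)) + dist (P.φ (tail z)) p :=
          dist_triangle _ _ _
      _ < r := by
        rw [dist_self_sub_left]
        linarith
  have htailR : ContinuousOn (fun z => tail z) R := continuous_tail.continuousOn
  refine tendsto_integral_filter_of_dominated_convergence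
    (fun z => ‖normalForm (tangent P.φ (tail z)) e‖ * C) ?_ ?_ ?_ ?_
  · filter_upwards [hsmall] with δ hδ
    refine ContinuousOn.aestronglyMeasurable ?_ hRm
    refine ((P.continuousOn_normalForm e).comp htailR fun z hz => hz.2.1).smul ?_
    refine hf.comp ?_ fun z hz => subset_closure (hΩ δ hδ.1 hδ.2 z hz)
    refine (P.continuousOn_φ.comp htailR fun z hz => hz.2.1).sub ?_
    have : Continuous fun z : Space n => (δ * z 0) • e := by fun_prop
    exact this.continuousOn
  · filter_upwards [hsmall] with δ hδ
    filter_upwards [ae_restrict_mem hRm] with z hz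
    rw [norm_smul]
    exact mul_le_mul_of_nonneg_left (hC _ (subset_closure (hΩ δ hδ.1 hδ.2 z hz))) (norm_nonneg _)
  · have h1 : IntegrableOn (fun u => ‖normalForm (tangent P.φ u) e‖ * C) S := by
      refine Integrable.mul_const (Integrable.norm ?_) C
      exact (P.integrableOn_normalForm (show 3 * r / 4 < r by linarith) hsub e).mono_set
        (inter_subset_inter_right _ (preimage_mono Metric.ball_subset_closedBall))
    exact integrableOn_slab_tail hSo.measurableSet h1
  · filter_upwards [ae_restrict_mem hRm] with z hz
    refine Tendsto.const_smul ?_ _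
    have h1 : ContinuousWithinAt f (closure Ω) (P.φ (tail z)) := hf _ (hcl _ hz.2.1)
    refine h1.tendsto.comp (tendsto_nhdsWithin_iff.mpr ⟨?_, ?_⟩)
    · have : Continuous fun δ : ℝ => P.φ (tail z) - (δ * z 0) • e := by fun_prop
      simpa using (this.tendsto 0).mono_left nhdsWithin_le_nhds
    · filter_upwards [hsmall] with δ hδ using subset_closure (hΩ δ hδ.1 hδ.2 z hz)

end BoundaryPatch

end

/-! ### Flux through the boundary and its derivation from translations. -/

section

variable {n : ℕ} {Ω : Set (Space n)} {p e : Space n} {r : ℝ} {ρ : Space n → ℝ}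
variable {V : Type*} [NormedAddCommGroup V] [NormedSpace ℝ V]

theorem BoundaryPatch.integrableOn_normalForm_smul (P : BoundaryPatch Ω) (hr : 0 < r)
    (hsub : Metric.ball p r ∩ frontier Ω ⊆ P.φ '' P.dom) (e : Space n) {f : Space n → V}
    (hf : ContinuousOn f (frontier Ω)) (hK : ∀ y ∉ Metric.closedBall p (r / 2), f y = 0) :
    IntegrableOn (fun u => normalForm (tangent P.φ u) e • f (P.φ u)) P.dom := by
  have hc : IsCompact (P.dom ∩ P.φ ⁻¹' (Metric.closedBall p (r / 2) ∩ frontier Ω)) :=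
    P.isCompact_preimage ((isCompact_closedBall p _).inter_right isClosed_frontier)
      ((inter_subset_inter_left _ (Metric.closedBall_subset_ball (by linarith))).trans hsub)
  have h1 := (((P.continuousOn_normalForm e).smul (hf.comp P.continuousOn_φ
    fun u hu => P.mem_frontier hu)).mono inter_subset_left).integrableOn_compact hc (μ := volume)
  refine h1.of_forall_sdiff_eq_zero P.isOpen_dom.measurableSet fun u hu => ?_
  have : f (P.φ u) = 0 := hK _ fun hcon => hu.2 ⟨hu.1, hcon, P.mem_frontier hu.1⟩
  simp [this]

namespace BoundaryAtlas

variable (A : BoundaryAtlas Ω)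

/-- The flux of the vector field `f e` through the boundary. -/
noncomputable def flux (e : Space n) (f : Space n → V) : V :=
  ∑ i, ∫ u in (A.patch i).dom,
    A.χ i ((A.patch i).φ u) • normalForm (tangent (A.patch i).φ u) e • f ((A.patch i).φ u)

/-- The closed support of `χ i` meets the boundary in a compact subset of the patch, so the
integrand lives on a compact set of parameters. -/
theorem integrableOn_smul (hb : Bornology.IsBounded Ω) (i : Fin A.card)
    {g : EuclideanSpace ℝ (Fin n) → V} (hg : ContinuousOn g (A.patch i).dom) :
    IntegrableOn (fun u => A.χ i ((A.patch i).φ u) • g u) (A.patch i).dom := by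
  have hZ : IsCompact (tsupport (A.χ i) ∩ frontier Ω) :=
    (hb.isCompact_closure.of_isClosed_subset isClosed_frontier frontier_subset_closure).inter_left
      (isClosed_tsupport _)
  have hc := (A.patch i).isCompact_preimage hZ (A.support_χ i)
  have h1 := ((((A.continuous_χ i).comp_continuousOn (A.patch i).continuousOn_φ).smul hg).mono
    inter_subset_left).integrableOn_compact hc (μ := volume)
  refine h1.of_forall_sdiff_eq_zero (A.patch i).isOpen_dom.measurableSet fun u hu => ?_
  have : A.χ i ((A.patch i).φ u) = 0 := image_eq_zero_of_notMem_tsupport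
    fun hcon => hu.2 ⟨hu.1, hcon, (A.patch i).mem_frontier hu.1⟩
  simp [this]

theorem integrableOn_flux (hb : Bornology.IsBounded Ω) (i : Fin A.card) (e : Space n)
    {f : Space n → V} (hf : ContinuousOn f (frontier Ω)) :
    IntegrableOn (fun u => A.χ i ((A.patch i).φ u) •
      normalForm (tangent (A.patch i).φ u) e • f ((A.patch i).φ u)) (A.patch i).dom :=
  A.integrableOn_smul hb i (((A.patch i).continuousOn_normalForm e).smul
    (hf.comp (A.patch i).continuousOn_φ fun _ hu => (A.patch i).mem_frontier hu))

theorem flux_add_left (hb : Bornology.IsBounded Ω) (a b : Space n) {f : Space n → V}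
    (hf : ContinuousOn f (frontier Ω)) : A.flux (a + b) f = A.flux a f + A.flux b f := by
  simp only [flux, ← Finset.sum_add_distrib]
  refine Finset.sum_congr rfl fun i _ => ?_
  rw [← integral_add (A.integrableOn_flux hb i a hf) (A.integrableOn_flux hb i b hf)]
  simp only [normalForm_add, add_smul, smul_add]

theorem flux_smul_left (c : ℝ) (a : Space n) (f : Space n → V) :
    A.flux (c • a) f = c • A.flux a f := by
  simp only [flux, Finset.smul_sum]
  refine Finset.sum_congr rfl fun i _ => ?_
  rw [← integral_smul]
  simp only [normalForm_smul, mul_smul, smul_comm c]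

theorem flux_sum_right (hb : Bornology.IsBounded Ω) (e : Space n) {ι : Type*} (s : Finset ι)
    {f : ι → Space n → V} (hf : ∀ j ∈ s, ContinuousOn (f j) (frontier Ω)) :
    A.flux e (fun y => ∑ j ∈ s, f j y) = ∑ j ∈ s, A.flux e (f j) := by
  simp only [flux]
  rw [Finset.sum_comm]
  refine Finset.sum_congr rfl fun i _ => ?_
  rw [← integral_finsetSum _ fun j hj => A.integrableOn_flux hb i e (hf j hj)]
  simp only [Finset.smul_sum]

theorem flux_congr (e : Space n) {f g : Space n → V} (h : EqOn f g (frontier Ω)) :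
    A.flux e f = A.flux e g := by
  refine Finset.sum_congr rfl fun i _ => ?_
  refine setIntegral_congr_fun (A.patch i).isOpen_dom.measurableSet fun u hu => ?_
  simp only [h ((A.patch i).mem_frontier hu)]

theorem tendsto_flux (hb : Bornology.IsBounded Ω) (e : Space n) {ι : Type*} {l : Filter ι}
    [l.IsCountablyGenerated] {F : ι → Space n → V} {f : Space n → V}
    (hF : ∀ᶠ a in l, ContinuousOn (F a) (frontier Ω)) (C : ℝ)
    (hC : ∀ᶠ a in l, ∀ y ∈ frontier Ω, ‖F a y‖ ≤ C)
    (hlim : ∀ y ∈ frontier Ω, Tendsto (fun a => F a y) l (𝓝 (f y))) :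
    Tendsto (fun a => A.flux e (F a)) l (𝓝 (A.flux e f)) := by
  refine tendsto_finsetSum _ fun i _ => ?_
  refine tendsto_integral_filter_of_dominated_convergence
    (fun u => ‖A.χ i ((A.patch i).φ u) • normalForm (tangent (A.patch i).φ u) e‖ * C) ?_ ?_ ?_ ?_
  · filter_upwards [hF] with a ha using (A.integrableOn_flux hb i e ha).aestronglyMeasurable
  · filter_upwards [hC] with a ha
    filter_upwards [ae_restrict_mem (A.patch i).isOpen_dom.measurableSet] with u hu
    rw [← smul_assoc, norm_smul]
    exact mul_le_mul_of_nonneg_left (ha _ ((A.patch i).mem_frontier hu)) (norm_nonneg _)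
  · exact (A.integrableOn_smul hb i ((A.patch i).continuousOn_normalForm e)).norm.mul_const C
  · filter_upwards [ae_restrict_mem (A.patch i).isOpen_dom.measurableSet] with u hu
    exact ((hlim _ ((A.patch i).mem_frontier hu)).const_smul _).const_smul _

/-- A ball on which every function of the partition of unity either vanishes or lives on a patch
containing the boundary piece in the ball. -/
structure IsSmallBall (p : Space n) (r : ℝ) : Prop where
  pos : 0 < r
  patch_or : ∀ i, Metric.ball p r ∩ frontier Ω ⊆ (A.patch i).φ '' (A.patch i).dom ∨
    ∀ y ∈ Metric.ball p r, A.χ i y = 0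
  exists_patch : ∃ i, Metric.ball p r ∩ frontier Ω ⊆ (A.patch i).φ '' (A.patch i).dom

/-- For each of the finitely many indices, either `p` lies in the closed support of `χ i`, and the
patch contains the boundary near `p`, or `χ i` vanishes near `p`. The sum being one at `p` excludes
the second alternative for some index. -/
theorem eventually_isSmallBall (hp : p ∈ frontier Ω) : ∀ᶠ r in 𝓝[>] (0 : ℝ), A.IsSmallBall p r := by
  have hsub : ∀ i, p ∈ tsupport (A.χ i) → ∀ᶠ y in 𝓝 p, y ∈ frontier Ω →
      y ∈ (A.patch i).φ '' (A.patch i).dom := by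
    intro i hi
    obtain ⟨W, hW, hWi⟩ := (A.patch i).image_open _ subset_rfl (A.patch i).isOpen_dom
    have hpW : p ∈ W := by
      have := A.support_χ i ⟨hi, hp⟩
      rw [hWi] at this
      exact this.1
    filter_upwards [hW.mem_nhds hpW] with y hy hyf
    rw [hWi]
    exact ⟨hy, hyf⟩
  have hall : ∀ᶠ y in 𝓝 p, ∀ i, (p ∈ tsupport (A.χ i) → y ∈ frontier Ω →
      y ∈ (A.patch i).φ '' (A.patch i).dom) ∧ (p ∉ tsupport (A.χ i) → A.χ i y = 0) := by
    rw [eventually_all]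
    intro i
    by_cases hi : p ∈ tsupport (A.χ i)
    · filter_upwards [hsub i hi] with y hy using ⟨fun _ => hy, fun h => absurd hi h⟩
    · filter_upwards [(isClosed_tsupport (A.χ i)).isOpen_compl.mem_nhds hi] with y hy
        using ⟨fun h => absurd h hi, fun _ => image_eq_zero_of_notMem_tsupport hy⟩
  obtain ⟨i0, hi0⟩ : ∃ i, p ∈ tsupport (A.χ i) := by
    by_contra! hcon
    have := A.sum_χ p hp
    rw [Finset.sum_eq_zero fun i _ => image_eq_zero_of_notMem_tsupport (hcon i)] at this
    exact zero_ne_one this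
  obtain ⟨R, hR, hball⟩ := Metric.eventually_nhds_iff_ball.mp hall
  filter_upwards [Ioo_mem_nhdsGT hR] with r hr
  have hs : ∀ y ∈ Metric.ball p r, y ∈ Metric.ball p R := fun y hy =>
    Metric.ball_subset_ball hr.2.le hy
  refine ⟨hr.1, fun i => ?_, i0, fun y hy => (hball y (hs y hy.1) i0).1 hi0 hy.2⟩
  by_cases hi : p ∈ tsupport (A.χ i)
  · exact Or.inl fun y hy => (hball y (hs y hy.1) i).1 hi hy.2
  · exact Or.inr fun y hy => (hball y (hs y hy) i).2 hi

/-- The collar integrals do not mention a patch. By uniqueness of limits, the integral of `χ i • f`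
over patch `i` equals the one over a fixed patch that covers the ball, which replaces a computation
with transition maps. On that patch the functions `χ i` sum to one. -/
theorem tendsto_collar (hs : A.IsSmallBall p r) (h : IsOutward Ω (Metric.ball p r) ρ e)
    (hb : Bornology.IsBounded Ω) {f : Space n → V} (hf : ContinuousOn f (closure Ω))
    (hK : ∀ y ∉ Metric.closedBall p (r / 2), f y = 0) :
    Tendsto (fun δ : ℝ => δ⁻¹ • ∫ y in collar Ω e δ, f y) (𝓝[>] 0) (𝓝 (A.flux e f)) := by
  obtain ⟨i0, hi0⟩ := hs.exists_patch
  set P := A.patch i0 with hP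
  have hcont : ∀ i, ContinuousOn (fun y => A.χ i y • f y) (closure Ω) := fun i =>
    (A.continuous_χ i).continuousOn.smul hf
  have hzero : ∀ i, ∀ y ∉ Metric.closedBall p (r / 2), A.χ i y • f y = 0 := fun i y hy => by
    rw [hK y hy, smul_zero]
  have hball : Metric.closedBall p (r / 2) ⊆ Metric.ball p r :=
    Metric.closedBall_subset_ball (by linarith [hs.pos])
  have hi : ∀ i, ∫ u in (A.patch i).dom, A.χ i ((A.patch i).φ u) •
      normalForm (tangent (A.patch i).φ u) e • f ((A.patch i).φ u) =
      ∫ u in P.dom, normalForm (tangent P.φ u) e • (A.χ i (P.φ u) • f (P.φ u)) := by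
    intro i
    simp only [smul_comm (A.χ i _) (normalForm _ _)]
    rcases hs.patch_or i with h1 | h1
    · exact tendsto_nhds_unique
        ((A.patch i).tendsto_collar h hs.pos hb h1 (hcont i) (hzero i))
        (P.tendsto_collar h hs.pos hb hi0 (hcont i) (hzero i))
    · have : ∀ y, A.χ i y • f y = 0 := by
        intro y
        by_cases hy : y ∈ Metric.closedBall p (r / 2)
        · rw [h1 y (hball hy), zero_smul]
        · exact hzero i y hy
      simp only [this, smul_zero, integral_zero]
  have hflux : A.flux e f = ∫ u in P.dom, normalForm (tangent P.φ u) e • f (P.φ u) := by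
    rw [flux, Finset.sum_congr rfl fun i _ => hi i, ← integral_finsetSum]
    · refine setIntegral_congr_fun P.isOpen_dom.measurableSet fun u hu => ?_
      rw [← Finset.smul_sum, ← Finset.sum_smul, A.sum_χ _ (P.mem_frontier hu), one_smul]
    · exact fun i _ => P.integrableOn_normalForm_smul hs.pos hi0 e
        ((hcont i).mono frontier_subset_closure) (hzero i)
  rw [hflux]
  exact P.tendsto_collar h hs.pos hb hi0 hf hK

/-- Integrating `f(y) - f(y - δe)` over `Ω` gives the integral of `f` over `Ω` minus that over `Ω -
δe`, which is the integral over the collar. Dividing by `δ`, one side tends to the integral of the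
directional derivative and the other to the flux. -/
theorem setIntegral_fderiv_of_isOutward (hs : A.IsSmallBall p r)
    (h : IsOutward Ω (Metric.ball p r) ρ e) (hb : Bornology.IsBounded Ω) {f : Space n → V}
    (hf : ContDiff ℝ 1 f) (hK : ∀ y ∉ Metric.closedBall p (r / 2), f y = 0) :
    ∫ y in Ω, fderiv ℝ f y e = A.flux e f := by
  have hsupp : HasCompactSupport f := HasCompactSupport.intro (isCompact_closedBall p (r / 2)) hK
  have hΩm := h.isOpen_domain.measurableSet
  have hfi : Integrable f := hf.continuous.integrable_of_hasCompactSupport hsupp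
  have hsmall : ∀ᶠ δ in 𝓝[>] (0 : ℝ), 0 < δ ∧ δ * ‖e‖ < r / 2 := by
    have h1 : Tendsto (fun δ : ℝ => δ * ‖e‖) (𝓝[>] 0) (𝓝 0) := by
      have : Continuous fun δ : ℝ => δ * ‖e‖ := by fun_prop
      simpa using (this.tendsto 0).mono_left nhdsWithin_le_nhds
    filter_upwards [h1.eventually_lt_const (half_pos hs.pos), self_mem_nhdsWithin]
      with δ h1 h2 using ⟨h2, h1⟩
  refine tendsto_nhds_unique ?_ (A.tendsto_collar hs h hb hf.continuous.continuousOn hK)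
  have heq : ∀ᶠ δ in 𝓝[>] (0 : ℝ), ∫ y in Ω, δ⁻¹ • (f y - f (y - δ • e)) =
      δ⁻¹ • ∫ y in collar Ω e δ, f y := by
    filter_upwards [hsmall] with δ hδ
    have hfi2 : Integrable fun y => f (y - δ • e) := hfi.comp_sub_right (δ • e)
    have hpre : MeasurableSet ((fun y : Space n => y + δ • e) ⁻¹' Ω) :=
      (h.isOpen_domain.preimage (by fun_prop)).measurableSet
    have hshift : ∫ y in Ω, f (y - δ • e) = ∫ y in (fun y : Space n => y + δ • e) ⁻¹' Ω, f y := by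
      rw [← integral_indicator hΩm, ← integral_indicator hpre,
        ← integral_sub_right_eq_self (indicator _ f) (δ • e)]
      congr 1
      ext y
      have hiff : y - δ • e ∈ (fun y : Space n => y + δ • e) ⁻¹' Ω ↔ y ∈ Ω := by simp
      by_cases hy : y ∈ Ω
      · rw [indicator_of_mem hy, indicator_of_mem (hiff.mpr hy)]
      · rw [indicator_of_notMem hy, indicator_of_notMem (mt hiff.mp hy)]
    rw [integral_smul, integral_sub hfi.integrableOn hfi2.integrableOn, hshift]
    congr 1
    rw [← integral_indicator hΩm, ← integral_indicator hpre,
      ← integral_indicator (measurableSet_collar h.isOpen_domain e δ),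
      ← integral_sub (hfi.indicator hΩm) (hfi.indicator hpre)]
    congr 1
    ext y
    by_cases hy : y ∈ Metric.closedBall p (r / 2)
    swap
    · have hz : ∀ s : Set (Space n), s.indicator f y = 0 := fun s =>
        indicator_apply_eq_zero.mpr fun _ => hK y hy
      rw [hz, hz, hz, sub_zero]
    by_cases h1 : y ∈ Ω <;> by_cases h2 : y + δ • e ∈ Ω
    · simp [collar, h1, h2]
    · simp [collar, h1, h2]
    -- Near the support of `f`, no point enters `Ω` under the translation, so the collar is the
    -- whole difference of the two sets.
    · refine absurd (subset_closure h2) (h.add_notMem ?_ h1 hδ.1 ?_)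
      · exact Metric.closedBall_subset_ball (by linarith [hs.pos]) hy
      · rw [Metric.mem_ball]
        calc dist (y + δ • e) p ≤ dist (y + δ • e) y + dist y p := dist_triangle _ _ _
          _ < r := by
            rw [dist_self_add_left, norm_smul, Real.norm_of_nonneg hδ.1.le]
            have : dist y p ≤ r / 2 := hy
            linarith [hδ.2]
    · simp [collar, h1, h2]
  refine Tendsto.congr' heq ?_
  -- The Lipschitz constant bounds all difference quotients at once.
  obtain ⟨C, hC⟩ := hf.lipschitzWith_of_hasCompactSupport hsupp one_ne_zero
  have hfin : volume Ω ≠ ⊤ := hb.measure_lt_top.ne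
  refine tendsto_integral_filter_of_dominated_convergence (fun _ => C * ‖e‖) ?_ ?_ ?_ ?_
  · refine Eventually.of_forall fun δ => Continuous.aestronglyMeasurable ?_
    have := hf.continuous
    fun_prop
  · filter_upwards [hsmall] with δ hδ
    refine Eventually.of_forall fun y => ?_
    have h1 := hC.dist_le_mul y (y - δ • e)
    rw [dist_self_sub_right, dist_eq_norm, norm_smul, Real.norm_of_nonneg hδ.1.le] at h1
    rw [norm_smul, norm_inv, Real.norm_of_nonneg hδ.1.le, inv_mul_le_iff₀ hδ.1]
    linarith
  · exact integrableOn_const hfin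
  · refine Eventually.of_forall fun y => ?_
    have h1 : HasDerivAt (fun t : ℝ => y - t • e) (-e) 0 := by
      simpa using ((hasDerivAt_id (0 : ℝ)).smul_const e).const_sub y
    have h2 : HasFDerivAt f (fderiv ℝ f y) (y - (0 : ℝ) • e) := by
      rw [zero_smul, sub_zero]
      exact (hf.differentiable one_ne_zero y).hasFDerivAt
    have h3 := (h2.comp_hasDerivAt 0 h1).neg.tendsto_slope_zero_right
    rw [map_neg, neg_neg] at h3
    refine h3.congr fun t => ?_
    simp [sub_eq_add_neg, add_comm]

end BoundaryAtlas

end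

/-! ### The divergence theorem. -/

section

variable {n : ℕ} {Ω : Set (Space n)} {p : Space n} {r : ℝ}
variable {V : Type*} [NormedAddCommGroup V] [NormedSpace ℝ V]

/-- The divergence of a vector field with vector-valued coefficients. -/
noncomputable def divergence (X : Fin (n + 1) → Space n → V) (y : Space n) : V :=
  ∑ j, fderiv ℝ (X j) y (EuclideanSpace.single j 1)

/-- Vector fields that are continuous on the closure, continuously differentiable in the interior,
and have bounded divergence. -/
structure IsFluxField (Ω : Set (Space n)) (X : Fin (n + 1) → Space n → V) : Prop where
  continuousOn : ∀ j, ContinuousOn (X j) (closure Ω)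
  contDiffOn : ∀ j, ContDiffOn ℝ 1 (X j) Ω
  bounded : ∃ C, ∀ y ∈ Ω, ‖divergence X y‖ ≤ C

theorem continuousOn_divergence (hΩ : IsOpen Ω) {X : Fin (n + 1) → Space n → V}
    (hX : ∀ j, ContDiffOn ℝ 1 (X j) Ω) : ContinuousOn (divergence X) Ω :=
  continuousOn_finsetSum _ fun j _ =>
    ((hX j).continuousOn_fderiv_of_isOpen hΩ le_rfl).clm_apply continuousOn_const

theorem IsFluxField.integrableOn {X : Fin (n + 1) → Space n → V} (hX : IsFluxField Ω X)
    (hΩ : IsOpen Ω) (hb : Bornology.IsBounded Ω) : IntegrableOn (divergence X) Ω := by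
  obtain ⟨C, hC⟩ := hX.bounded
  exact IntegrableOn.of_bound hb.measure_lt_top
    ((continuousOn_divergence hΩ hX.contDiffOn).aestronglyMeasurable hΩ.measurableSet) C
    ((ae_restrict_iff' hΩ.measurableSet).mpr (Eventually.of_forall hC))

theorem contDiff_of_eventually_zero {E : Type*} [NormedAddCommGroup E] [NormedSpace ℝ E]
    {U : Set E} (hU : IsOpen U) {f : E → V} (hf : ContDiffOn ℝ 1 f U)
    (h0 : ∀ y ∉ U, ∀ᶠ z in 𝓝 y, f z = 0) : ContDiff ℝ 1 f := by
  rw [contDiff_iff_contDiffAt]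
  intro y
  by_cases hy : y ∈ U
  · exact hf.contDiffAt (hU.mem_nhds hy)
  · exact (contDiffAt_const (c := (0 : V))).congr_of_eventuallyEq (h0 y hy)

theorem integral_fderiv_eq_zero [CompleteSpace V] {f : Space n → V} (hf : ContDiff ℝ 1 f)
    (hs : HasCompactSupport f) (v : Space n) : ∫ y, fderiv ℝ f y v = 0 := by
  have h1 : Integrable fun y => fderiv ℝ f y v := by
    refine Continuous.integrable_of_hasCompactSupport ?_ (hs.fderiv_apply ℝ v)
    exact (hf.continuous_fderiv one_ne_zero).clm_apply continuous_const
  have h := integral_smul_fderiv_eq_neg_fderiv_smul_of_integrable (μ := volume)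
    (f := fun _ : Space n => (1 : ℝ)) (g := f) (v := v) (by simp) (by simpa using h1)
    (by simpa using hf.continuous.integrable_of_hasCompactSupport hs) (by simp)
    (fun x _ => hf.differentiable one_ne_zero x)
  simpa using h

namespace BoundaryAtlas

variable (A : BoundaryAtlas Ω)

/-- Coordinate directions need not be transversal to the boundary. Pointing outwards is an open
condition, however, so `w` and `w + s e_j` both point outwards for small `s > 0`. Subtracting their
two formulas leaves `s` times the formula for `e_j`. -/
theorem exists_good_ball (hΩ : IsC1Domain Ω) (hp : p ∈ frontier Ω) :
    ∃ (r : ℝ) (ρ : Space n → ℝ) (w : Space n), A.IsSmallBall p r ∧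
      IsOutward Ω (Metric.ball p r) ρ w ∧
      ∀ f : Space n → V, ContDiff ℝ 1 f → (∀ y ∉ Metric.closedBall p (r / 2), f y = 0) → ∀ j,
        ∫ y in Ω, fderiv ℝ f y (EuclideanSpace.single j 1) =
          A.flux (EuclideanSpace.single j 1) f := by
  obtain ⟨ρ, hρ, hne, hiff⟩ := hΩ.boundary p hp
  obtain ⟨w, hw⟩ : ∃ w, 0 < fderiv ℝ ρ p w := by
    obtain ⟨w, hw⟩ : ∃ w, fderiv ℝ ρ p w ≠ 0 := by
      by_contra! hcon
      exact hne (ContinuousLinearMap.ext hcon)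
    rcases hw.lt_or_gt with h | h
    · exact ⟨-w, by rw [map_neg]; linarith⟩
    · exact ⟨w, h⟩
  obtain ⟨s, hs, hs0⟩ : ∃ s : ℝ, (∀ j : Fin (n + 1),
      0 < fderiv ℝ ρ p (w + s • EuclideanSpace.single j (1 : ℝ))) ∧ 0 < s := by
    have h1 : ∀ᶠ s in 𝓝[>] (0 : ℝ), ∀ j : Fin (n + 1),
        0 < fderiv ℝ ρ p (w + s • EuclideanSpace.single j (1 : ℝ)) := by
      rw [eventually_all]
      intro j
      have h2 : Continuous fun s : ℝ => fderiv ℝ ρ p (w + s • EuclideanSpace.single j (1 : ℝ)) := by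
        fun_prop
      have h3 := (h2.tendsto 0).mono_left (nhdsWithin_le_nhds (s := Ioi 0))
      exact h3.eventually_const_lt (by simpa using hw)
    exact (h1.and self_mem_nhdsWithin).exists
  have hev := ((A.eventually_isSmallBall hp).and
    (eventually_isOutward hΩ.isOpen hρ hiff hw)).and
    (eventually_all.mpr fun j => eventually_isOutward hΩ.isOpen hρ hiff (hs j))
  obtain ⟨r, ⟨hr1, hr2⟩, hr3⟩ := hev.exists
  refine ⟨r, ρ, w, hr1, hr2, fun f hf hK j => ?_⟩
  have h1 := A.setIntegral_fderiv_of_isOutward hr1 hr2 hΩ.isBounded hf hK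
  have h2 := A.setIntegral_fderiv_of_isOutward hr1 (hr3 j) hΩ.isBounded hf hK
  have hint : ∀ v : Space n, IntegrableOn (fun y => fderiv ℝ f y v) Ω := by
    intro v
    have hc : HasCompactSupport f := HasCompactSupport.intro (isCompact_closedBall p (r / 2)) hK
    refine (Continuous.integrable_of_hasCompactSupport ?_ (hc.fderiv_apply ℝ v)).integrableOn
    exact (hf.continuous_fderiv one_ne_zero).clm_apply continuous_const
  rw [A.flux_add_left hΩ.isBounded _ _ hf.continuous.continuousOn, flux_smul_left, ← h1] at h2
  simp only [map_add] at h2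
  rw [integral_add (hint _) (hint _), add_right_inj] at h2
  simp only [map_smul] at h2
  rw [integral_smul] at h2
  exact smul_right_injective V hs0.ne' h2

/-- The field is only continuous up to the boundary, so it is first replaced by `Y(· - s w)`. Moving
back along the outward vector `w` sends the closure of `Ω` into `Ω` or away from the support of `Y`,
so the translate is continuously differentiable near the closure. Then `s → 0`. -/
theorem divergence_of_boundary_ball [CompleteSpace V] (hΩ : IsC1Domain Ω) {ρ : Space n → ℝ}
    {w : Space n} (hs : A.IsSmallBall p r) (hw : IsOutward Ω (Metric.ball p r) ρ w)
    (hball : ∀ f : Space n → V, ContDiff ℝ 1 f →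
      (∀ y ∉ Metric.closedBall p (r / 2), f y = 0) → ∀ j,
        ∫ y in Ω, fderiv ℝ f y (EuclideanSpace.single j 1) = A.flux (EuclideanSpace.single j 1) f)
    {Y : Fin (n + 1) → Space n → V} (hY : IsFluxField Ω Y)
    (hK : ∀ j, ∀ y ∉ Metric.closedBall p (r / 4), Y j y = 0) :
    ∫ y in Ω, divergence Y y = ∑ j, A.flux (EuclideanSpace.single j 1) (Y j) := by
  have hr := hs.pos
  have hΩm := hΩ.isOpen.measurableSet
  have hsmall : ∀ᶠ s in 𝓝[>] (0 : ℝ), 0 < s ∧ s * ‖w‖ < r / 4 := by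
    have h1 : Tendsto (fun s : ℝ => s * ‖w‖) (𝓝[>] 0) (𝓝 0) := by
      have : Continuous fun s : ℝ => s * ‖w‖ := by fun_prop
      simpa using (this.tendsto 0).mono_left nhdsWithin_le_nhds
    filter_upwards [h1.eventually_lt_const (show 0 < r / 4 by linarith), self_mem_nhdsWithin]
      with s h1 h2 using ⟨h2, h1⟩
  have hshift : ∀ s : ℝ, 0 < s → s * ‖w‖ < r / 4 → ∀ y z : Space n,
      (y = z - s • w ∨ z = y - s • w) → y ∈ Metric.closedBall p (r / 4) →
      z ∈ Metric.closedBall p (r / 2) := by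
    intro s hs0 hsr y z hyz hy
    have h1 : dist z y = ‖s • w‖ := by
      rcases hyz with rfl | rfl
      · rw [dist_self_sub_right]
      · rw [dist_self_sub_left]
    rw [norm_smul, Real.norm_of_nonneg hs0.le] at h1
    have h2 : dist y p ≤ r / 4 := hy
    have h3 := dist_triangle z y p
    rw [Metric.mem_closedBall]
    linarith
  have hsub : ∀ s : ℝ, 0 < s → s * ‖w‖ < r / 4 → ∀ y ∈ closure Ω,
      y - s • w ∈ Ω ∨ y - s • w ∉ Metric.closedBall p (r / 4) := by
    intro s hs0 hsr y hy
    by_cases hys : y - s • w ∈ Metric.closedBall p (r / 4)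
    · refine Or.inl (hw.sub_mem ?_ hy hs0 ?_)
      · exact Metric.closedBall_subset_ball (by linarith) (hshift s hs0 hsr _ y (Or.inl rfl) hys)
      · exact Metric.closedBall_subset_ball (by linarith) hys
    · exact Or.inr hys
  have hex : ∀ s : ℝ, ∃ F : Fin (n + 1) → Space n → V, 0 < s → s * ‖w‖ < r / 4 →
      (∀ j, ContDiff ℝ 1 (F j)) ∧ (∀ j, ∀ y ∉ Metric.closedBall p (r / 2), F j y = 0) ∧
      ∀ j, ∀ y ∈ closure Ω, F j =ᶠ[𝓝 y] fun y => Y j (y - s • w) := by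
    intro s
    by_cases hss : 0 < s ∧ s * ‖w‖ < r / 4
    swap
    · exact ⟨0, fun h1 h2 => absurd ⟨h1, h2⟩ hss⟩
    obtain ⟨hs0, hsr⟩ := hss
    -- On `U` the translate is continuously differentiable. A cutoff `κ`, equal to one near the
    -- closure of `Ω` and to zero near the complement of `U`, extends it to the whole space.
    set U : Set (Space n) := (fun y => y - s • w) ⁻¹' (Ω ∪ (Metric.closedBall p (r / 4))ᶜ) with hU
    have hUo : IsOpen U :=
      (hΩ.isOpen.union Metric.isClosed_closedBall.isOpen_compl).preimage (by fun_prop)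
    have hYU : ∀ j, ContDiffOn ℝ 1 (Y j) (Ω ∪ (Metric.closedBall p (r / 4))ᶜ) := by
      intro j y hy
      rcases hy with hy | hy
      · exact ((hY.contDiffOn j).contDiffAt (hΩ.isOpen.mem_nhds hy)).contDiffWithinAt
      · refine ContDiffAt.contDiffWithinAt
          ((contDiffAt_const (c := (0 : V))).congr_of_eventuallyEq ?_)
        filter_upwards [Metric.isClosed_closedBall.isOpen_compl.mem_nhds hy] with z hz
          using hK j z hz
    obtain ⟨κ, h0, h1, -⟩ := exists_contMDiffMap_zero_one_nhds_of_isClosed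
      (modelWithCornersSelf ℝ (Space n)) (n := 1) hUo.isClosed_compl (isClosed_closure (s := Ω))
      (by
        rw [disjoint_compl_left_iff_subset]
        exact fun y hy => hsub s hs0 hsr y hy)
    have hκ : ContDiff ℝ 1 κ := κ.contMDiff.contDiff
    refine ⟨fun j y => κ y • Y j (y - s • w), fun _ _ => ⟨fun j => ?_, fun j y hy => ?_,
      fun j y hy => ?_⟩⟩
    · refine contDiff_of_eventually_zero hUo (hκ.contDiffOn.smul ?_) fun y hy => ?_
      · exact (hYU j).comp (contDiff_id.sub contDiff_const).contDiffOn fun y hy => hy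
      · filter_upwards [eventually_nhdsSet_iff_forall.mp h0 y hy] with z hz
        rw [hz, zero_smul]
    · simp only []
      rw [hK, smul_zero]
      exact fun hcon => hy (hshift s hs0 hsr _ y (Or.inl rfl) hcon)
    · filter_upwards [eventually_nhdsSet_iff_forall.mp h1 y hy] with z hz
      rw [hz, one_smul]
  choose F hF using hex
  obtain ⟨C, hC⟩ := hY.bounded
  have hC0 : ∀ y, y ∈ Ω ∨ y ∉ Metric.closedBall p (r / 4) → ‖divergence Y y‖ ≤ max C 0 := by
    rintro y (hy | hy)
    · exact (hC y hy).trans (le_max_left _ _)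
    · have : divergence Y y = 0 := by
        refine Finset.sum_eq_zero fun j _ => ?_
        have h1 : Y j =ᶠ[𝓝 y] fun _ => 0 := by
          filter_upwards [Metric.isClosed_closedBall.isOpen_compl.mem_nhds hy] with z hz
            using hK j z hz
        rw [h1.fderiv_eq, fderiv_fun_const]
        rfl
      rw [this, norm_zero]
      exact le_max_right _ _
  have hdivF : ∀ s : ℝ, 0 < s → s * ‖w‖ < r / 4 → ∀ y ∈ Ω,
      divergence (F s) y = divergence Y (y - s • w) := by
    intro s hs0 hsr y hy
    refine Finset.sum_congr rfl fun j _ => ?_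
    rw [((hF s hs0 hsr).2.2 j y (subset_closure hy)).fderiv_eq, fderiv_comp_sub]
  have hF_eq : ∀ s : ℝ, 0 < s → s * ‖w‖ < r / 4 → ∀ j, ∀ y ∈ closure Ω,
      F s j y = Y j (y - s • w) := fun s hs0 hsr j y hy => ((hF s hs0 hsr).2.2 j y hy).eq_of_nhds
  have hto : ∀ y : Space n, Tendsto (fun s : ℝ => y - s • w) (𝓝[>] 0) (𝓝 y) := by
    intro y
    have : Continuous fun s : ℝ => y - s • w := by fun_prop
    simpa using (this.tendsto 0).mono_left nhdsWithin_le_nhds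
  have hlim1 : Tendsto (fun s => ∫ y in Ω, divergence (F s) y) (𝓝[>] 0)
      (𝓝 (∫ y in Ω, divergence Y y)) := by
    -- The bound on the divergence is the only control near the boundary; the single partial
    -- derivatives of `Y` may be unbounded there.
    refine tendsto_integral_filter_of_dominated_convergence (fun _ => max C 0) ?_ ?_ ?_ ?_
    · filter_upwards [hsmall] with s hs
      exact (continuousOn_divergence hΩ.isOpen fun j =>
        ((hF s hs.1 hs.2).1 j).contDiffOn).aestronglyMeasurable hΩm
    · filter_upwards [hsmall] with s hs
      filter_upwards [ae_restrict_mem hΩm] with y hy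
      rw [hdivF s hs.1 hs.2 y hy]
      exact hC0 _ (hsub s hs.1 hs.2 y (subset_closure hy))
    · exact integrableOn_const hΩ.isBounded.measure_lt_top.ne
    · filter_upwards [ae_restrict_mem hΩm] with y hy
      have h1 := ((continuousOn_divergence hΩ.isOpen hY.contDiffOn).continuousAt
        (hΩ.isOpen.mem_nhds hy)).tendsto.comp (hto y)
      refine h1.congr' ?_
      filter_upwards [hsmall] with s hs using (hdivF s hs.1 hs.2 y hy).symm
  have hlim2 : ∀ j, Tendsto (fun s => A.flux (EuclideanSpace.single j 1) (F s j)) (𝓝[>] 0)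
      (𝓝 (A.flux (EuclideanSpace.single j 1) (Y j))) := by
    intro j
    obtain ⟨B, hB⟩ := exists_bound_of_continuousOn hΩ.isBounded (hY.continuousOn j)
    refine A.tendsto_flux hΩ.isBounded _ ?_ (max B 0) ?_ ?_
    · filter_upwards [hsmall] with s hs using ((hF s hs.1 hs.2).1 j).continuous.continuousOn
    · filter_upwards [hsmall] with s hs y hy
      rw [hF_eq s hs.1 hs.2 j y (frontier_subset_closure hy)]
      rcases hsub s hs.1 hs.2 y (frontier_subset_closure hy) with h1 | h1
      · exact (hB _ (subset_closure h1)).trans (le_max_left _ _)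
      · rw [hK j _ h1, norm_zero]
        exact le_max_right _ _
    · intro y hy
      have hyc := frontier_subset_closure hy
      have heq : ∀ᶠ s in 𝓝[>] (0 : ℝ), Y j (y - s • w) = F s j y := by
        filter_upwards [hsmall] with s hs using (hF_eq s hs.1 hs.2 j y hyc).symm
      refine Tendsto.congr' heq ?_
      by_cases hyb : y ∈ Metric.ball p r
      · refine (hY.continuousOn j y hyc).tendsto.comp (tendsto_nhdsWithin_iff.mpr ⟨hto y, ?_⟩)
        filter_upwards [(hto y).eventually_mem (Metric.isOpen_ball.mem_nhds hyb), self_mem_nhdsWithin]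
          with s hs hs0 using subset_closure (hw.sub_mem hyb hyc hs0 hs)
      · have hyn : y ∉ Metric.closedBall p (r / 4) := fun hcon =>
          hyb (Metric.closedBall_subset_ball (by linarith) hcon)
        rw [hK j y hyn]
        refine tendsto_const_nhds.congr' ?_
        filter_upwards [(hto y).eventually_mem
          (Metric.isClosed_closedBall.isOpen_compl.mem_nhds hyn)] with s hs using (hK j _ hs).symm
  refine tendsto_nhds_unique hlim1 ((tendsto_finsetSum _ fun j _ => hlim2 j).congr' ?_)
  filter_upwards [hsmall] with s hs
  obtain ⟨hF1, hF2, -⟩ := hF s hs.1 hs.2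
  simp only [divergence]
  rw [integral_finsetSum]
  · exact Finset.sum_congr rfl fun j _ => (hball (F s j) (hF1 j) (hF2 j) j).symm
  · intro j _
    have hc : HasCompactSupport (F s j) :=
      HasCompactSupport.intro (isCompact_closedBall p (r / 2)) (hF2 j)
    refine (Continuous.integrable_of_hasCompactSupport ?_ (hc.fderiv_apply ℝ _)).integrableOn
    exact ((hF1 j).continuous_fderiv one_ne_zero).clm_apply continuous_const

/-- Both sides vanish: the fields are compactly supported inside `Ω`, so their derivatives integrate
to zero, and they are zero on the boundary. -/
theorem divergence_of_interior_ball [CompleteSpace V] (hΩ : IsOpen Ω)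
    (hsub : Metric.closedBall p r ⊆ Ω) {Y : Fin (n + 1) → Space n → V} (hY : IsFluxField Ω Y)
    (hK : ∀ j, ∀ y ∉ Metric.closedBall p r, Y j y = 0) :
    ∫ y in Ω, divergence Y y = ∑ j, A.flux (EuclideanSpace.single j 1) (Y j) := by
  have hzero : ∀ j, ∀ y ∉ Ω, ∀ᶠ z in 𝓝 y, Y j z = 0 := by
    intro j y hy
    filter_upwards [Metric.isClosed_closedBall.isOpen_compl.mem_nhds fun hcon => hy (hsub hcon)]
      with z hz using hK j z hz
  have hYc : ∀ j, ContDiff ℝ 1 (Y j) := fun j =>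
    contDiff_of_eventually_zero hΩ (hY.contDiffOn j) (hzero j)
  have hYs : ∀ j, HasCompactSupport (Y j) := fun j =>
    HasCompactSupport.intro (isCompact_closedBall p r) (hK j)
  have h1 : ∫ y in Ω, divergence Y y = ∫ y, divergence Y y := by
    refine setIntegral_eq_integral_of_forall_compl_eq_zero fun y hy => ?_
    refine Finset.sum_eq_zero fun j _ => ?_
    have h1 : Y j =ᶠ[𝓝 y] fun _ => 0 := hzero j y hy
    rw [h1.fderiv_eq, fderiv_fun_const]
    rfl
  rw [h1]
  simp only [divergence]
  rw [integral_finsetSum]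
  · rw [Finset.sum_eq_zero fun j _ => integral_fderiv_eq_zero (hYc j) (hYs j) _,
      Finset.sum_eq_zero fun j _ => ?_]
    rw [A.flux_congr (g := fun _ => 0)]
    · simp [flux]
    · intro y hy
      rw [hΩ.frontier_eq] at hy
      exact (hzero j y hy.2).self_of_nhds
  · intro j _
    refine Continuous.integrable_of_hasCompactSupport ?_ ((hYs j).fderiv_apply ℝ _)
    exact ((hYc j).continuous_fderiv one_ne_zero).clm_apply continuous_const

end BoundaryAtlas

/-- The product rule involves only the divergence and the values of `X`, not its single derivatives.
This lets a partition of unity localize the divergence theorem. -/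
theorem IsFluxField.smul {X : Fin (n + 1) → Space n → V} (hX : IsFluxField Ω X) (hΩ : IsOpen Ω)
    (hb : Bornology.IsBounded Ω) {θ : Space n → ℝ} (hθ : ContDiff ℝ 1 θ) :
    IsFluxField Ω fun j y => θ y • X j y := by
  refine ⟨fun j => hθ.continuous.continuousOn.smul (hX.continuousOn j),
    fun j => hθ.contDiffOn.smul (hX.contDiffOn j), ?_⟩
  obtain ⟨C, hC⟩ := hX.bounded
  obtain ⟨B, hB⟩ := exists_bound_of_continuousOn hb hθ.continuous.continuousOn
  have hc : ContinuousOn (fun y => ∑ j, fderiv ℝ θ y (EuclideanSpace.single j 1) • X j y)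
      (closure Ω) := by
    refine continuousOn_finsetSum _ fun j _ => ContinuousOn.smul ?_ (hX.continuousOn j)
    exact ((hθ.continuous_fderiv one_ne_zero).clm_apply continuous_const).continuousOn
  obtain ⟨D, hD⟩ := exists_bound_of_continuousOn hb hc
  refine ⟨B * C + D, fun y hy => ?_⟩
  have hdiv : divergence (fun j y => θ y • X j y) y =
      θ y • divergence X y + ∑ j, fderiv ℝ θ y (EuclideanSpace.single j 1) • X j y := by
    simp only [divergence, Finset.smul_sum, ← Finset.sum_add_distrib]
    refine Finset.sum_congr rfl fun j _ => ?_
    rw [fderiv_fun_smul (hθ.differentiable one_ne_zero y)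
      (((hX.contDiffOn j).differentiableOn one_ne_zero).differentiableAt (hΩ.mem_nhds hy))]
    simp
  rw [hdiv]
  refine (norm_add_le _ _).trans (add_le_add ?_ (hD y (subset_closure hy)))
  rw [norm_smul]
  exact mul_le_mul (hB y (subset_closure hy)) (hC y hy) (norm_nonneg _)
    ((norm_nonneg _).trans (hB y (subset_closure hy)))

/-- The divergence theorem on bounded open sets with `C^1` boundary. -/
theorem BoundaryAtlas.setIntegral_divergence [CompleteSpace V] (A : BoundaryAtlas Ω)
    (hΩ : IsC1Domain Ω) {X : Fin (n + 1) → Space n → V} (hX : IsFluxField Ω X) :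
    ∫ y in Ω, divergence X y = ∑ j, A.flux (EuclideanSpace.single j 1) (X j) := by
  have hlocal : ∀ p ∈ closure Ω, ∃ R > 0, ∀ Y : Fin (n + 1) → Space n → V, IsFluxField Ω Y →
      (∀ j, ∀ y ∉ Metric.closedBall p R, Y j y = 0) →
      ∫ y in Ω, divergence Y y = ∑ j, A.flux (EuclideanSpace.single j 1) (Y j) := by
    intro p hp
    by_cases hpΩ : p ∈ Ω
    · obtain ⟨R, hR, hsub⟩ := Metric.nhds_basis_closedBall.mem_iff.mp (hΩ.isOpen.mem_nhds hpΩ)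
      exact ⟨R, hR, fun Y hY hK => A.divergence_of_interior_ball hΩ.isOpen hsub hY hK⟩
    · have hpf : p ∈ frontier Ω := by
        rw [hΩ.isOpen.frontier_eq]
        exact ⟨hp, hpΩ⟩
      obtain ⟨r, ρ, w, h1, h2, h3⟩ := A.exists_good_ball (V := V) hΩ hpf
      exact ⟨r / 4, by linarith [h1.pos], fun Y hY hK =>
        A.divergence_of_boundary_ball hΩ h1 h2 h3 hY hK⟩
  choose! R hR hdiv using hlocal
  obtain ⟨t, htΩ, ht⟩ := hΩ.isBounded.isCompact_closure.elim_nhds_subcover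
    (fun p => Metric.ball p (R p)) fun p hp => Metric.ball_mem_nhds p (hR p hp)
  obtain ⟨θ, hθ⟩ := SmoothPartitionOfUnity.exists_isSubordinate
    (modelWithCornersSelf ℝ (Space n)) (isClosed_closure (s := Ω))
    (fun p : t => Metric.ball (p : Space n) (R p)) (fun _ => Metric.isOpen_ball)
    (by
      intro y hy
      obtain ⟨p, hp, hyp⟩ := mem_iUnion₂.mp (ht hy)
      exact mem_iUnion.mpr ⟨⟨p, hp⟩, hyp⟩)
  have hθc : ∀ p, ContDiff ℝ 1 (θ p) := fun p =>
    (θ p).contMDiff.contDiff.of_le (by exact_mod_cast le_top)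
  have hθ1 : ∀ y ∈ closure Ω, ∑ p, θ p y = 1 := by
    intro y hy
    rw [← θ.sum_eq_one hy, finsum_eq_sum_of_fintype]
  have hY : ∀ p, IsFluxField Ω fun j y => θ p y • X j y := fun p =>
    hX.smul hΩ.isOpen hΩ.isBounded (hθc p)
  have hYdiv : ∀ p, ∫ y in Ω, divergence (fun j y => θ p y • X j y) y =
      ∑ j, A.flux (EuclideanSpace.single j 1) fun y => θ p y • X j y := by
    intro p
    refine hdiv p (htΩ p p.2) _ (hY p) fun j y hy => ?_
    have : θ p y = 0 := image_eq_zero_of_notMem_tsupport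
      fun hcon => hy (Metric.ball_subset_closedBall (hθ p hcon))
    rw [this, zero_smul]
  have hleft : ∫ y in Ω, divergence X y =
      ∑ p, ∫ y in Ω, divergence (fun j y => θ p y • X j y) y := by
    rw [← integral_finsetSum _ fun p _ => (hY p).integrableOn hΩ.isOpen hΩ.isBounded]
    refine setIntegral_congr_fun hΩ.isOpen.measurableSet fun y hy => ?_
    simp only [divergence]
    rw [Finset.sum_comm]
    refine Finset.sum_congr rfl fun j _ => ?_
    rw [← _root_.sum_apply, ← fderiv_fun_sum fun p _ =>
      (((hY p).contDiffOn j).differentiableOn one_ne_zero).differentiableAt (hΩ.isOpen.mem_nhds hy)]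
    congr 1
    -- The functions `θ p` sum to one in a whole neighbourhood of `y`, so no derivative of the
    -- partition of unity remains.
    refine Filter.EventuallyEq.fderiv_eq ?_
    filter_upwards [hΩ.isOpen.mem_nhds hy] with z hz
    rw [← Finset.sum_smul, hθ1 z (subset_closure hz), one_smul]
  rw [hleft, Finset.sum_congr rfl fun p _ => hYdiv p, Finset.sum_comm]
  refine Finset.sum_congr rfl fun j _ => ?_
  rw [← A.flux_sum_right hΩ.isBounded _ _ fun p _ =>
    (((hY p).continuousOn j).mono frontier_subset_closure)]
  refine A.flux_congr _ fun y hy => ?_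
  rw [← Finset.sum_smul, hθ1 y (frontier_subset_closure hy), one_smul]

end

/-! ### The regularized Cauchy kernel and its point mass. -/

section

variable {n : ℕ}

/-- The normalizing constant of the Cauchy kernel. -/
noncomputable def cauchyConst (n : ℕ) : ℝ :=
  Real.Gamma (((n : ℝ) + 1) / 2) / (2 * Real.pi ^ (((n : ℝ) + 1) / 2))

theorem cauchyConst_pos (n : ℕ) : 0 < cauchyConst n := by
  have : (0 : ℝ) < ((n : ℝ) + 1) / 2 := by positivity
  have := Real.Gamma_pos_of_pos this
  unfold cauchyConst
  positivity

/-- The radial profile of the regularized point mass. -/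
noncomputable def peak (n : ℕ) (y : Space n) : ℝ :=
  cauchyConst n * (n + 1) * (‖y‖ ^ 2 + 1) ^ (-(((n : ℝ) + 1) / 2 + 1))

theorem peak_nonneg (y : Space n) : 0 ≤ peak n y := by
  have := cauchyConst_pos n
  unfold peak
  positivity

theorem pow_eq_rpow_sq {r : ℝ} (hr : 0 ≤ r) : r ^ (n + 1) = (r ^ 2) ^ (((n : ℝ) + 1) / 2) := by
  rw [← Real.rpow_natCast r 2, ← Real.rpow_mul hr, ← Real.rpow_natCast]
  congr 1
  push_cast
  ring

/-- For `r ≥ 0` the function is `(1 - 1/(r² + 1))^{(n+1)/2}`. -/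
theorem tendsto_radial (n : ℕ) :
    Tendsto (fun r : ℝ => r ^ (n + 1) * (r ^ 2 + 1) ^ (-(((n : ℝ) + 1) / 2))) atTop (𝓝 1) := by
  have h1 : Tendsto (fun r : ℝ => 1 - (r ^ 2 + 1)⁻¹) atTop (𝓝 1) := by
    have h2 : Tendsto (fun r : ℝ => r ^ 2 + 1) atTop atTop :=
      tendsto_atTop_add_const_right _ _ (tendsto_pow_atTop two_ne_zero)
    simpa using h2.inv_tendsto_atTop.const_sub 1
  have h3 := h1.rpow_const (p := ((n : ℝ) + 1) / 2) (Or.inl one_ne_zero)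
  rw [Real.one_rpow] at h3
  refine h3.congr' ?_
  filter_upwards [eventually_ge_atTop 0] with r hr
  have hpos : (0 : ℝ) < r ^ 2 + 1 := by positivity
  have h4 : 1 - (r ^ 2 + 1)⁻¹ = r ^ 2 / (r ^ 2 + 1) := by field_simp; ring
  rw [h4, Real.div_rpow (by positivity) hpos.le, Real.rpow_neg hpos.le,
    pow_eq_rpow_sq (n := n) hr]
  rfl

/-- The function of `tendsto_radial` is `n + 1` times an antiderivative, because in its derivative
the bracket `(r² + 1) - r²` is equal to `1`. -/
theorem integral_radial (n : ℕ) :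
    ∫ r in Ioi (0 : ℝ), r ^ n * (r ^ 2 + 1) ^ (-(((n : ℝ) + 1) / 2 + 1)) = ((n : ℝ) + 1)⁻¹ := by
  have hder : ∀ r ∈ Ici (0 : ℝ),
      HasDerivAt (fun r : ℝ => r ^ (n + 1) * (r ^ 2 + 1) ^ (-(((n : ℝ) + 1) / 2)))
        (((n : ℝ) + 1) * (r ^ n * (r ^ 2 + 1) ^ (-(((n : ℝ) + 1) / 2 + 1)))) r := by
    intro r _
    have hpos : (0 : ℝ) < r ^ 2 + 1 := by positivity
    have h1 : HasDerivAt (fun r : ℝ => r ^ 2 + 1) (2 * r) r := by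
      simpa using (hasDerivAt_pow 2 r).add_const 1
    have h2 := (hasDerivAt_pow (n + 1) r).mul
      (h1.rpow_const (p := -(((n : ℝ) + 1) / 2)) (Or.inl hpos.ne'))
    refine h2.congr_deriv ?_
    have h3 : (r ^ 2 + 1) ^ (-(((n : ℝ) + 1) / 2)) =
        (r ^ 2 + 1) * (r ^ 2 + 1) ^ (-(((n : ℝ) + 1) / 2 + 1)) := by
      rw [mul_comm, ← Real.rpow_add_one hpos.ne']
      congr 1
      ring
    have h4 : (r ^ 2 + 1) ^ (-(((n : ℝ) + 1) / 2) - 1) =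
        (r ^ 2 + 1) ^ (-(((n : ℝ) + 1) / 2 + 1)) := by
      congr 1
      ring
    rw [h3, h4]
    push_cast
    ring
  have h := integral_Ioi_of_hasDerivAt_of_nonneg' hder (fun r hr => by
    have : (0 : ℝ) < r := hr
    positivity) (tendsto_radial n)
  rw [integral_const_mul] at h
  simp only [ne_eq, Nat.add_eq_zero_iff, one_ne_zero, and_false, not_false_eq_true, zero_pow,
    zero_mul, sub_zero] at h
  exact eq_inv_of_mul_eq_one_right h

/-- In polar coordinates the mass is `cauchyConst n` times the area of the unit sphere, and
`cauchyConst n` is the reciprocal of that area. The area appears as `n + 1` times the volume of the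
unit ball. -/
theorem integral_peak (n : ℕ) : ∫ y, peak n y = 1 := by
  have h := integral_fun_norm_addHaar (volume : Measure (Space n))
    (fun r : ℝ => cauchyConst n * (n + 1) * (r ^ 2 + 1) ^ (-(((n : ℝ) + 1) / 2 + 1)))
  unfold peak
  rw [h]
  have hdim : Module.finrank ℝ (Space n) = n + 1 := by simp
  have hint : ∫ r in Ioi (0 : ℝ), r ^ (n + 1 - 1) •
      (cauchyConst n * (n + 1) * (r ^ 2 + 1) ^ (-(((n : ℝ) + 1) / 2 + 1))) = cauchyConst n := by
    have h1 : ∀ r : ℝ, r ^ (n + 1 - 1) •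
        (cauchyConst n * (n + 1) * (r ^ 2 + 1) ^ (-(((n : ℝ) + 1) / 2 + 1))) =
        (cauchyConst n * (n + 1)) * (r ^ n * (r ^ 2 + 1) ^ (-(((n : ℝ) + 1) / 2 + 1))) := by
      intro r
      rw [smul_eq_mul, Nat.add_sub_cancel]
      ring
    simp only [h1]
    rw [integral_const_mul, integral_radial]
    field_simp
  rw [hdim, hint, Measure.real, EuclideanSpace.volume_ball]
  have hq : (0 : ℝ) < ((n : ℝ) + 1) / 2 := by positivity
  have hΓ := Real.Gamma_pos_of_pos hq
  have hΓ1 : (0 : ℝ) < Real.Gamma (((n : ℝ) + 1) / 2 + 1) := Real.Gamma_pos_of_pos (by positivity)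
  have hsqrt : √Real.pi ^ (n + 1) = Real.pi ^ (((n : ℝ) + 1) / 2) := by
    rw [pow_eq_rpow_sq (Real.sqrt_nonneg _), Real.sq_sqrt Real.pi_pos.le]
  simp only [Fintype.card_fin, ENNReal.ofReal_one, one_pow, one_mul, Nat.cast_add, Nat.cast_one]
  rw [ENNReal.toReal_ofReal (by positivity), hsqrt, Real.Gamma_add_one hq.ne', cauchyConst]
  have hπ : (0 : ℝ) < Real.pi ^ (((n : ℝ) + 1) / 2) := by positivity
  simp only [smul_eq_mul, nsmul_eq_mul]
  push_cast
  field_simp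

theorem tendsto_peak (n : ℕ) :
    Tendsto (fun y : Space n => ‖y‖ ^ Module.finrank ℝ (Space n) * peak n y)
      (Bornology.cobounded (Space n)) (𝓝 0) := by
  have hdim : Module.finrank ℝ (Space n) = n + 1 := by simp
  have h1 : Tendsto (fun r : ℝ => cauchyConst n * (n + 1) *
      ((r ^ (n + 1) * (r ^ 2 + 1) ^ (-(((n : ℝ) + 1) / 2))) * (r ^ 2 + 1)⁻¹)) atTop (𝓝 0) := by
    have h2 : Tendsto (fun r : ℝ => r ^ 2 + 1) atTop atTop :=
      tendsto_atTop_add_const_right _ _ (tendsto_pow_atTop two_ne_zero)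
    simpa using ((tendsto_radial n).mul h2.inv_tendsto_atTop).const_mul (cauchyConst n * (n + 1))
  refine (h1.comp tendsto_norm_cobounded_atTop).congr fun y => ?_
  have hpos : (0 : ℝ) < ‖y‖ ^ 2 + 1 := by positivity
  simp only [Function.comp, peak, hdim]
  rw [neg_add, Real.rpow_add hpos, Real.rpow_neg_one]
  ring

theorem paravector_eq (ε : ℝ) (y : Space n) :
    paravector ε y = algebraMap ℝ (Cl n) (y 0) +
      ε • CliffordAlgebra.ι (negForm n) (fun j => y j.succ) := by
  have h : (fun j : Fin n => y j.succ) = ∑ j, y j.succ • (Pi.single j 1 : Fin n → ℝ) := by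
    ext k
    simp [Finset.sum_apply, Pi.single_apply]
  rw [paravector, Fin.sum_univ_succ, h, map_sum, Finset.smul_sum]
  congr 1
  · simp [unit, Algebra.algebraMap_eq_smul_one]
  · refine Finset.sum_congr rfl fun j _ => ?_
    rw [map_smul, smul_comm]
    rfl

/-- The mixed terms cancel because scalars are central, and the vector part squares to minus its
squared length. The sign enters only through `ε² = 1`. -/
theorem star_paravector_mul {ε : ℝ} (hε : ε = 1 ∨ ε = -1) (y : Space n) :
    star (paravector ε y) * paravector ε y = algebraMap ℝ (Cl n) (‖y‖ ^ 2) := by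
  have hsq : ε * ε = 1 := by rcases hε with rfl | rfl <;> norm_num
  set v : Fin n → ℝ := fun j => y j.succ
  rw [paravector_eq, star_add, CliffordAlgebra.star_algebraMap, CliffordAlgebra.star_smul,
    CliffordAlgebra.star_ι]
  have h1 : ∀ (a : ℝ) (x : Cl n), (algebraMap ℝ (Cl n) a + ε • -x) * (algebraMap ℝ (Cl n) a + ε • x) =
      algebraMap ℝ (Cl n) (a * a) - (ε * ε) • (x * x) := by
    intro a x
    rw [map_mul, add_mul, mul_add, mul_add, (Algebra.commutes a (ε • x)), smul_neg, neg_mul, neg_mul,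
      smul_mul_smul_comm]
    simp only [smul_mul_assoc]
    abel
  rw [h1, hsq, one_smul, CliffordAlgebra.ι_sq_scalar, ← map_sub]
  congr 1
  rw [EuclideanSpace.real_norm_sq_eq, Fin.sum_univ_succ, QuadraticMap.weightedSumSquares_apply]
  simp [pow_two]

/-- The conjugate of the paravector, as a continuous linear map. -/
noncomputable def starParavector (ε : ℝ) : Space n →L[ℝ] Cl n :=
  LinearMap.toContinuousLinearMap
    { toFun := fun y => star (paravector ε y)
      map_add' := fun x y => by
        simp [paravector, add_smul, Finset.sum_add_distrib]
      map_smul' := fun c x => by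
        rw [RingHom.id_apply, ← CliffordAlgebra.star_smul]
        simp [paravector, Finset.smul_sum, mul_smul] }

@[simp] theorem starParavector_apply (ε : ℝ) (y : Space n) :
    starParavector ε y = star (paravector ε y) := rfl

theorem paravector_single (ε : ℝ) (j : Fin (n + 1)) :
    paravector ε (EuclideanSpace.single j 1 : Space n) = unit ε j := by
  rw [paravector, Finset.sum_eq_single j] <;> simp +contextual

theorem star_unit_mul {ε : ℝ} (hε : ε = 1 ∨ ε = -1) (j : Fin (n + 1)) :
    star (unit ε j) * (unit ε j : Cl n) = 1 := by
  rw [← paravector_single, star_paravector_mul hε]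
  simp

/-- The operator `D` acting from the right on functions with values in the Clifford algebra. -/
noncomputable def diracRight (ε : ℝ) (K : Space n → Cl n) (y : Space n) : Cl n :=
  ∑ j, fderiv ℝ K y (EuclideanSpace.single j 1) * unit ε j

/-- A smooth regularization of the Cauchy kernel. -/
noncomputable def regKernel (ε δ : ℝ) (y : Space n) : Cl n :=
  (cauchyConst n * (‖y‖ ^ 2 + δ ^ 2) ^ (-(((n : ℝ) + 1) / 2))) • starParavector ε y

theorem contDiff_regKernel (ε : ℝ) {δ : ℝ} (hδ : 0 < δ) :
    ContDiff ℝ 1 (regKernel ε δ : Space n → Cl n) := by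
  unfold regKernel
  have h1 : ContDiff ℝ 1 fun y : Space n => (‖y‖ ^ 2 + δ ^ 2) ^ (-(((n : ℝ) + 1) / 2)) :=
    ((contDiff_norm_sq ℝ).add contDiff_const).rpow_const_of_ne fun y => by positivity
  have h2 : ContDiff ℝ 1 fun y : Space n =>
      cauchyConst n * (‖y‖ ^ 2 + δ ^ 2) ^ (-(((n : ℝ) + 1) / 2)) := contDiff_const.mul h1
  exact h2.smul (starParavector ε).contDiff

/-- With the power `P` factored out, differentiating `ȳ` contributes `(n+1)(|y|² + δ²)`, since each
conjugate unit times its unit is `1`. Differentiating the radial factor contributes `-(n+1) ȳ y =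
-(n+1)|y|²`. Only `δ²` survives, and the result is a real scalar. -/
theorem diracRight_regKernel {ε : ℝ} (hε : ε = 1 ∨ ε = -1) {δ : ℝ} (hδ : 0 < δ) (y : Space n) :
    diracRight ε (regKernel ε δ) y = algebraMap ℝ (Cl n)
      (cauchyConst n * (n + 1) * δ ^ 2 * (‖y‖ ^ 2 + δ ^ 2) ^ (-(((n : ℝ) + 1) / 2 + 1))) := by
  set q : ℝ := ((n : ℝ) + 1) / 2 with hq
  have hpos : (0 : ℝ) < ‖y‖ ^ 2 + δ ^ 2 := by positivity
  set P := (‖y‖ ^ 2 + δ ^ 2) ^ (-(q + 1)) with hP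
  have hPq : (‖y‖ ^ 2 + δ ^ 2) ^ (-q) = (‖y‖ ^ 2 + δ ^ 2) * P := by
    rw [hP, mul_comm, ← Real.rpow_add_one hpos.ne']
    congr 1
    ring
  have h1 : HasFDerivAt (fun y : Space n => ‖y‖ ^ 2 + δ ^ 2) (2 • innerSL ℝ y) y :=
    (hasStrictFDerivAt_norm_sq y).hasFDerivAt.add_const _
  have h2 := ((h1.rpow_const (p := -q) (Or.inl hpos.ne')).const_mul (cauchyConst n)).smul
    (starParavector (n := n) ε).hasFDerivAt
  have h3 : ∀ j : Fin (n + 1), fderiv ℝ (regKernel ε δ) y (EuclideanSpace.single j 1) =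
      (cauchyConst n * ((‖y‖ ^ 2 + δ ^ 2) * P)) • star (unit ε j) -
        (cauchyConst n * (n + 1) * P * y j) • star (paravector ε y) := by
    intro j
    have h4 : (‖y‖ ^ 2 + δ ^ 2) ^ (-q - 1) = P := by
      rw [hP]
      congr 1
      ring
    have h5 : regKernel ε δ = (fun y : Space n =>
        cauchyConst n * (‖y‖ ^ 2 + δ ^ 2) ^ (-q)) • ⇑(starParavector (n := n) ε) := rfl
    rw [h5, h2.fderiv, h4, hPq]
    simp only [add_apply, smul_apply, ContinuousLinearMap.smulRight_apply, starParavector_apply,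
      paravector_single, innerSL_apply_apply, EuclideanSpace.inner_single_right, smul_eq_mul,
      nsmul_eq_mul]
    rw [sub_eq_add_neg, ← neg_smul]
    congr 2
    simp [hq]
    ring
  have h6 : ∑ j, (y j : ℝ) • (star (paravector ε y) * unit ε j) =
      star (paravector ε y) * paravector ε y := by
    conv_rhs => rw [paravector, Finset.mul_sum]
    exact Finset.sum_congr rfl fun j _ => (mul_smul_comm _ _ _).symm
  have h7 : ∑ j, (cauchyConst n * (n + 1) * P * y j) • (star (paravector ε y) * unit ε j) =
      (cauchyConst n * (n + 1) * P) • algebraMap ℝ (Cl n) (‖y‖ ^ 2) := by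
    rw [← star_paravector_mul hε, ← h6, Finset.smul_sum]
    exact Finset.sum_congr rfl fun j _ => mul_smul _ _ _
  simp only [diracRight, h3, sub_mul, smul_mul_assoc, star_unit_mul hε, Finset.sum_sub_distrib, h7,
    Finset.sum_const, Finset.card_univ, Fintype.card_fin]
  rw [← Nat.cast_smul_eq_nsmul ℝ, ← mul_smul, Algebra.algebraMap_eq_smul_one,
    Algebra.algebraMap_eq_smul_one, ← mul_smul, ← sub_smul]
  congr 1
  push_cast
  ring

end

/-! ### Clifford modules, the Borel–Pompeiu formula and Cauchy's formula. -/

section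

variable {n : ℕ} {Ω : Set (Space n)}
variable {V : Type*} [NormedAddCommGroup V] [NormedSpace ℝ V] [Module (Cl n) V]
  [IsScalarTower ℝ (Cl n) V] [ContinuousConstSMul (Cl n) V]

variable (n V) in
/-- The action of the Clifford algebra on a module as a bounded bilinear map. -/
noncomputable def actionL : Cl n →L[ℝ] V →L[ℝ] V :=
  LinearMap.toContinuousLinearMap
    { toFun := fun a =>
        { toFun := fun v => a • v
          map_add' := smul_add a
          map_smul' := fun c v => (smul_comm c a v).symm
          cont := continuous_const_smul a }
      map_add' := fun a b => by ext v; exact add_smul a b v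
      map_smul' := fun c a => by ext v; exact smul_assoc c a v }

@[simp] theorem actionL_apply (a : Cl n) (v : V) : actionL n V a v = a • v := rfl

theorem norm_clifford_smul_le {a : Cl n} {v : V} {C B : ℝ} (ha : ‖a‖ ≤ C) (hv : ‖v‖ ≤ B) :
    ‖a • v‖ ≤ ‖actionL n V‖ * C * B := by
  have h0 : 0 ≤ ‖actionL n V‖ := ContinuousLinearMap.opNorm_nonneg _
  refine ((actionL n V).le_opNorm₂ a v).trans (mul_le_mul (mul_le_mul_of_nonneg_left ha h0) hv
    (norm_nonneg _) (mul_nonneg h0 ((norm_nonneg _).trans ha)))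

theorem ContinuousOn.clifford_smul {X : Type*} [TopologicalSpace X] {s : Set X} {a : X → Cl n}
    {f : X → V} (ha : ContinuousOn a s) (hf : ContinuousOn f s) :
    ContinuousOn (fun x => a x • f x) s :=
  ((actionL n V).continuous.comp_continuousOn ha).clm_apply hf

theorem Tendsto.clifford_smul {X : Type*} {l : Filter X} {a : X → Cl n} {f : X → V} {a₀ : Cl n}
    {v : V} (ha : Tendsto a l (𝓝 a₀)) (hf : Tendsto f l (𝓝 v)) :
    Tendsto (fun x => a x • f x) l (𝓝 (a₀ • v)) :=
  ((isBoundedBilinearMap_apply (𝕜 := ℝ) (E := V) (F := V)).continuous.tendsto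
    (actionL n V a₀, v)).comp ((((actionL n V).continuous.tendsto a₀).comp ha).prodMk_nhds hf)

/-- The coefficient of the `j`-th unit in `dσ` is the determinant whose first column is the `j`-th
coordinate vector, that is, the `j`-th component of the normal. -/
theorem BoundaryAtlas.integral_eq_sum_flux (A : BoundaryAtlas Ω) (hb : Bornology.IsBounded Ω) (ε : ℝ)
    {K : Space n → Cl n} {g : Space n → V} (hK : ContinuousOn K (frontier Ω))
    (hg : ContinuousOn g (frontier Ω)) :
    A.integral ε K g =
      ∑ j, A.flux (EuclideanSpace.single j 1) fun y => (K y * unit ε j) • g y := by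
  simp only [BoundaryAtlas.integral, BoundaryAtlas.flux]
  rw [Finset.sum_comm]
  refine Finset.sum_congr rfl fun i _ => ?_
  have hKg : ∀ j, ContinuousOn (fun y => (K y * unit ε j) • g y) (frontier Ω) := fun j =>
    ContinuousOn.clifford_smul (hK.mul continuousOn_const) hg
  rw [← integral_finsetSum _ fun j _ => A.integrableOn_flux hb i (EuclideanSpace.single j 1) (hKg j)]
  congr 1
  ext u
  rw [← Finset.smul_sum, surfaceForm_eq, Finset.sum_smul, Finset.smul_sum]
  congr 1
  refine Finset.sum_congr rfl fun j _ => ?_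
  rw [normalForm_single, smul_assoc, smul_comm, mul_smul]

theorem BoundaryAtlas.tendsto_integral (A : BoundaryAtlas Ω) (hb : Bornology.IsBounded Ω) (ε : ℝ)
    {ι : Type*} {l : Filter ι} [l.IsCountablyGenerated] {K : ι → Space n → Cl n}
    {K₀ : Space n → Cl n} {g : ι → Space n → V} {g₀ : Space n → V}
    (hK : ∀ᶠ a in l, ContinuousOn (K a) (frontier Ω)) (hK₀ : ContinuousOn K₀ (frontier Ω))
    (hg : ∀ᶠ a in l, ContinuousOn (g a) (frontier Ω)) (hg₀ : ContinuousOn g₀ (frontier Ω))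
    {C B : ℝ} (hC : ∀ᶠ a in l, ∀ y ∈ frontier Ω, ‖K a y‖ ≤ C)
    (hB : ∀ᶠ a in l, ∀ y ∈ frontier Ω, ‖g a y‖ ≤ B)
    (hKlim : ∀ y ∈ frontier Ω, Tendsto (fun a => K a y) l (𝓝 (K₀ y)))
    (hglim : ∀ y ∈ frontier Ω, Tendsto (fun a => g a y) l (𝓝 (g₀ y))) :
    Tendsto (fun a => A.integral ε (K a) (g a)) l (𝓝 (A.integral ε K₀ g₀)) := by
  rw [A.integral_eq_sum_flux hb ε hK₀ hg₀]
  have hsum : Tendsto (fun a => ∑ j, A.flux (EuclideanSpace.single j 1)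
      fun y => (K a y * unit ε j) • g a y) l
      (𝓝 (∑ j, A.flux (EuclideanSpace.single j 1) fun y => (K₀ y * unit ε j) • g₀ y)) := by
    refine tendsto_finsetSum _ fun j _ => ?_
    refine A.tendsto_flux hb _ ?_ (‖actionL n V‖ * (C * ‖(unit ε j : Cl n)‖) * B) ?_ ?_
    · filter_upwards [hK, hg] with a h1 h2
      exact ContinuousOn.clifford_smul (h1.mul continuousOn_const) h2
    · filter_upwards [hC, hB] with a h1 h2 y hy
      exact norm_clifford_smul_le ((norm_mul_le _ _).trans
        (mul_le_mul_of_nonneg_right (h1 y hy) (norm_nonneg _))) (h2 y hy)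
    · exact fun y hy => Tendsto.clifford_smul ((hKlim y hy).mul_const _) (hglim y hy)
  refine hsum.congr' ?_
  filter_upwards [hK, hg] with a h1 h2 using (A.integral_eq_sum_flux hb ε h1 h2).symm

theorem continuous_diracRight (ε : ℝ) {K : Space n → Cl n} (hK : ContDiff ℝ 1 K) :
    Continuous (diracRight ε K) :=
  continuous_finsetSum _ fun _ _ =>
    ((hK.continuous_fderiv one_ne_zero).clm_apply continuous_const).mul continuous_const

theorem continuousOn_dirac (hΩ : IsOpen Ω) (ε : ℝ) {u : Space n → V} (hu : ContDiffOn ℝ 1 u Ω) :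
    ContinuousOn (dirac ε u) Ω :=
  continuousOn_finsetSum _ fun _ _ => ContinuousOn.clifford_smul continuousOn_const
    ((hu.continuousOn_fderiv_of_isOpen hΩ le_rfl).clm_apply continuousOn_const)

/-- The Borel–Pompeiu formula for a continuously differentiable kernel. -/
theorem BoundaryAtlas.integral_eq_setIntegral [CompleteSpace V] (A : BoundaryAtlas Ω)
    (hΩ : IsC1Domain Ω) (ε : ℝ) {K : Space n → Cl n} (hK : ContDiff ℝ 1 K) {u w : Space n → V}
    (hu : SolvesDirac ε Ω u w) {C : ℝ} (hC : ∀ y ∈ Ω, ‖w y‖ ≤ C) :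
    A.integral ε K u = ∫ y in Ω, (diracRight ε K y • u y + K y • w y) := by
  -- The unit stands between `K` and `u`, so the product rule makes `D` act on `K` from the right
  -- and on `u` from the left. The bound on `w` is what keeps the divergence bounded.
  set X : Fin (n + 1) → Space n → V := fun j y => (K y * unit ε j) • u y with hX
  have hKj : ∀ j, ContDiff ℝ 1 fun y => K y * unit ε j := fun j => hK.mul contDiff_const
  have hdiv : ∀ y ∈ Ω, divergence X y = diracRight ε K y • u y + K y • w y := by
    intro y hy
    rw [← hu.eq y hy, dirac, diracRight, Finset.sum_smul, Finset.smul_sum, ← Finset.sum_add_distrib]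
    refine Finset.sum_congr rfl fun j _ => ?_
    have h1 : HasFDerivAt K (fderiv ℝ K y) y := (hK.differentiable one_ne_zero y).hasFDerivAt
    have h2 : HasFDerivAt u (fderiv ℝ u y) y :=
      ((hu.contDiffOn.differentiableOn one_ne_zero).differentiableAt
        (hΩ.isOpen.mem_nhds hy)).hasFDerivAt
    have h3 := (actionL n V).hasFDerivAt_of_bilinear (h1.mul_const' (unit ε j)) h2
    have h4 : fderiv ℝ (X j) y = _ := h3.fderiv
    rw [h4]
    simp [mul_smul, add_comm]
  obtain ⟨B1, hB1⟩ := exists_bound_of_continuousOn hΩ.isBounded (ContinuousOn.clifford_smul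
    (continuous_diracRight ε hK).continuousOn hu.continuousOn)
  obtain ⟨B2, hB2⟩ := exists_bound_of_continuousOn hΩ.isBounded hK.continuous.continuousOn
  have hflux : IsFluxField Ω X := by
    refine ⟨fun j => ContinuousOn.clifford_smul (hKj j).continuous.continuousOn hu.continuousOn,
      fun j => ?_, B1 + ‖actionL n V‖ * B2 * C, fun y hy => ?_⟩
    · exact ((actionL n V).contDiff.comp_contDiffOn (hKj j).contDiffOn).clm_apply hu.contDiffOn
    · rw [hdiv y hy]
      refine (norm_add_le _ _).trans (add_le_add (hB1 y (subset_closure hy)) ?_)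
      exact norm_clifford_smul_le (hB2 y (subset_closure hy)) (hC y hy)
  rw [A.integral_eq_sum_flux hΩ.isBounded ε hK.continuous.continuousOn
    (hu.continuousOn.mono frontier_subset_closure), ← A.setIntegral_divergence hΩ hflux]
  exact setIntegral_congr_fun hΩ.isOpen.measurableSet hdiv

/-- The limit `F` is only continuous. The formula survives because neither side differentiates `F`,
and the term with `w k` disappears in the limit. -/
theorem BoundaryAtlas.integral_eq_setIntegral_of_tendsto [CompleteSpace V] (A : BoundaryAtlas Ω)
    (hΩ : IsC1Domain Ω) (ε : ℝ) {K : Space n → Cl n} (hK : ContDiff ℝ 1 K) {u w : ℕ → Space n → V}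
    {F : Space n → V} (hu : ∀ k, SolvesDirac ε Ω (u k) (w k))
    (huF : TendstoUniformlyOn u F atTop (closure Ω)) (hw : TendstoUniformlyOn w 0 atTop Ω) :
    A.integral ε K F = ∫ y in Ω, diracRight ε K y • F y := by
  have hF : ContinuousOn F (closure Ω) :=
    huF.continuousOn (Eventually.of_forall fun k => (hu k).continuousOn).frequently
  obtain ⟨B, hB⟩ := exists_bound_of_continuousOn hΩ.isBounded hF
  obtain ⟨C, hC⟩ := exists_bound_of_continuousOn hΩ.isBounded hK.continuous.continuousOn
  obtain ⟨D, hD⟩ := exists_bound_of_continuousOn hΩ.isBounded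
    (continuous_diracRight ε hK).continuousOn
  have huB : ∀ᶠ k in atTop, ∀ y ∈ closure Ω, ‖u k y‖ ≤ B + 1 := by
    filter_upwards [Metric.tendstoUniformlyOn_iff.mp huF 1 one_pos] with k hk y hy
    have h1 := hk y hy
    rw [dist_comm, dist_eq_norm] at h1
    calc ‖u k y‖ = ‖F y + (u k y - F y)‖ := by rw [add_sub_cancel]
      _ ≤ ‖F y‖ + ‖u k y - F y‖ := norm_add_le _ _
      _ ≤ B + 1 := add_le_add (hB y hy) h1.le
  have hwB : ∀ᶠ k in atTop, ∀ y ∈ Ω, ‖w k y‖ ≤ 1 := by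
    filter_upwards [Metric.tendstoUniformlyOn_iff.mp hw 1 one_pos] with k hk y hy
    have h1 := hk y hy
    rw [Pi.zero_apply, dist_zero_left] at h1
    exact h1.le
  have hsub := frontier_subset_closure (s := Ω)
  have hlim1 : Tendsto (fun k => A.integral ε K (u k)) atTop (𝓝 (A.integral ε K F)) := by
    refine A.tendsto_integral hΩ.isBounded ε (K := fun _ => K) (C := C) (B := B + 1)
      (Eventually.of_forall fun _ => hK.continuous.continuousOn) hK.continuous.continuousOn
      (Eventually.of_forall fun k => (hu k).continuousOn.mono hsub) (hF.mono hsub)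
      (Eventually.of_forall fun _ y hy => hC y (hsub hy)) ?_ (fun _ _ => tendsto_const_nhds)
      fun y hy => huF.tendsto_at (hsub hy)
    filter_upwards [huB] with k hk y hy using hk y (hsub hy)
  have hlim2 : Tendsto (fun k => ∫ y in Ω, (diracRight ε K y • u k y + K y • w k y)) atTop
      (𝓝 (∫ y in Ω, diracRight ε K y • F y)) := by
    refine tendsto_integral_filter_of_dominated_convergence
      (fun _ => ‖actionL n V‖ * D * (B + 1) + ‖actionL n V‖ * C * 1) ?_ ?_ ?_ ?_
    · refine Eventually.of_forall fun k => ContinuousOn.aestronglyMeasurable ?_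
        hΩ.isOpen.measurableSet
      refine (ContinuousOn.clifford_smul (continuous_diracRight ε hK).continuousOn
        ((hu k).continuousOn.mono subset_closure)).add
        (ContinuousOn.clifford_smul hK.continuous.continuousOn ?_)
      exact (continuousOn_dirac hΩ.isOpen ε (hu k).contDiffOn).congr fun y hy => ((hu k).eq y hy).symm
    · filter_upwards [huB, hwB] with k h1 h2
      filter_upwards [ae_restrict_mem hΩ.isOpen.measurableSet] with y hy
      have hyc := subset_closure hy
      exact (norm_add_le _ _).trans (add_le_add (norm_clifford_smul_le (hD y hyc) (h1 y hyc))
        (norm_clifford_smul_le (hC y hyc) (h2 y hy)))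
    · exact integrableOn_const hΩ.isBounded.measure_lt_top.ne
    · filter_upwards [ae_restrict_mem hΩ.isOpen.measurableSet] with y hy
      have h1 := Tendsto.clifford_smul (tendsto_const_nhds (x := diracRight ε K y))
        (huF.tendsto_at (subset_closure hy))
      have h2 := Tendsto.clifford_smul (tendsto_const_nhds (x := K y)) (hw.tendsto_at hy)
      simpa using h1.add h2
  refine tendsto_nhds_unique hlim1 (hlim2.congr' ?_)
  filter_upwards [hwB] with k hk using (A.integral_eq_setIntegral hΩ ε hK (hu k) hk).symm

theorem cauchyKernel_eq_regKernel (ε : ℝ) (z : Space n) : cauchyKernel ε z = regKernel ε 0 z := by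
  rw [cauchyKernel, regKernel, starParavector_apply, div_eq_mul_inv]
  congr 2
  rw [zero_pow two_ne_zero, add_zero, Real.rpow_neg (by positivity), pow_eq_rpow_sq (norm_nonneg z)]

theorem tendsto_regKernel (ε : ℝ) {z : Space n} (hz : z ≠ 0) :
    Tendsto (fun δ => regKernel ε δ z) (𝓝 0) (𝓝 (cauchyKernel ε z)) := by
  rw [cauchyKernel_eq_regKernel]
  have h1 : ContinuousAt (fun δ : ℝ => (‖z‖ ^ 2 + δ ^ 2) ^ (-(((n : ℝ) + 1) / 2))) 0 := by
    refine ContinuousAt.rpow_const (by fun_prop) (Or.inl ?_)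
    have := norm_pos_iff.mpr hz
    positivity
  exact ((continuousAt_const.mul h1).smul continuousAt_const).tendsto

/-- This majorant does not depend on `δ`; it dominates the boundary integrals as `δ → 0`. -/
theorem norm_regKernel_le (ε δ : ℝ) {z : Space n} (hz : z ≠ 0) :
    ‖regKernel ε δ z‖ ≤ ‖cauchyKernel ε z‖ := by
  have hz' := norm_pos_iff.mpr hz
  have hc := cauchyConst_pos n
  rw [cauchyKernel_eq_regKernel, regKernel, regKernel, norm_smul, norm_smul,
    Real.norm_of_nonneg (by positivity), Real.norm_of_nonneg (by positivity)]
  refine mul_le_mul_of_nonneg_right (mul_le_mul_of_nonneg_left ?_ hc.le) (norm_nonneg _)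
  refine Real.rpow_le_rpow_of_nonpos (by positivity) ?_ ?_
  · nlinarith [sq_nonneg δ]
  · have : (0 : ℝ) ≤ ((n : ℝ) + 1) / 2 := by positivity
    linarith

theorem continuousAt_cauchyKernel (ε : ℝ) {z : Space n} (hz : z ≠ 0) :
    ContinuousAt (cauchyKernel ε) z := by
  have h : (cauchyKernel ε : Space n → Cl n) = regKernel ε 0 := funext (cauchyKernel_eq_regKernel ε)
  rw [h]
  have h1 : ContinuousAt (fun z : Space n => (‖z‖ ^ 2 + 0 ^ 2) ^ (-(((n : ℝ) + 1) / 2))) z := by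
    refine ContinuousAt.rpow_const (by fun_prop) (Or.inl ?_)
    have := norm_pos_iff.mpr hz
    positivity
  exact (continuousAt_const.mul h1).smul (starParavector ε).continuous.continuousAt

theorem diracRight_comp_sub (ε : ℝ) (K : Space n → Cl n) (x y : Space n) :
    diracRight ε (fun y => K (y - x)) y = diracRight ε K (y - x) := by
  simp only [diracRight, fderiv_comp_sub]

/-- With `δ = 1/c`, the right side is the value of `diracRight_regKernel` at `y - x`, so the
regularized kernels produce a standard approximate identity as `c → ∞`. -/
theorem peak_smul {c : ℝ} (hc : 0 < c) (x y : Space n) :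
    c ^ Module.finrank ℝ (Space n) * peak n (c • (x - y)) =
      cauchyConst n * (n + 1) * c⁻¹ ^ 2 *
        (‖y - x‖ ^ 2 + c⁻¹ ^ 2) ^ (-(((n : ℝ) + 1) / 2 + 1)) := by
  have hdim : Module.finrank ℝ (Space n) = n + 1 := by simp
  have h1 : ‖c • (x - y)‖ ^ 2 + 1 = c ^ 2 * (‖y - x‖ ^ 2 + c⁻¹ ^ 2) := by
    rw [norm_smul, Real.norm_of_nonneg hc.le, norm_sub_rev]
    field_simp
  rw [peak, h1, hdim, Real.mul_rpow (by positivity) (by positivity)]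
  have h2 : (c ^ 2) ^ (-(((n : ℝ) + 1) / 2 + 1)) = (c ^ (n + 1))⁻¹ * c⁻¹ ^ 2 := by
    rw [neg_add, Real.rpow_add (by positivity), Real.rpow_neg (by positivity), pow_eq_rpow_sq (n := n) hc.le,
      Real.rpow_neg_one, inv_pow]
  rw [h2]
  field_simp

/-- Cauchy's integral formula for uniform limits of approximate solutions. -/
theorem BoundaryAtlas.cauchy_integral_of_tendsto [CompleteSpace V] (A : BoundaryAtlas Ω)
    (hΩ : IsC1Domain Ω) {ε : ℝ} (hε : ε = 1 ∨ ε = -1) {u w : ℕ → Space n → V} {F : Space n → V}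
    (hu : ∀ k, SolvesDirac ε Ω (u k) (w k)) (huF : TendstoUniformlyOn u F atTop (closure Ω))
    (hw : TendstoUniformlyOn w 0 atTop Ω) {x : Space n} (hx : x ∉ frontier Ω) :
    A.integral ε (fun y => cauchyKernel ε (y - x)) F = Ω.indicator F x := by
  have hF : ContinuousOn F (closure Ω) :=
    huF.continuousOn (Eventually.of_forall fun k => (hu k).continuousOn).frequently
  have hFf := hF.mono frontier_subset_closure
  have hne : ∀ y ∈ frontier Ω, y - x ≠ 0 := fun y hy h => hx (sub_eq_zero.mp h ▸ hy)
  have hE : ContinuousOn (fun y => cauchyKernel ε (y - x)) (frontier Ω) := fun y hy =>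
    (ContinuousAt.comp (f := fun y => y - x) (continuousAt_cauchyKernel ε (hne y hy))
      (by fun_prop)).continuousWithinAt
  have hcomp : IsCompact (frontier Ω) :=
    hΩ.isBounded.isCompact_closure.of_isClosed_subset isClosed_frontier frontier_subset_closure
  obtain ⟨C, hC⟩ := hcomp.exists_bound_of_continuousOn hE
  obtain ⟨B, hB⟩ := hcomp.exists_bound_of_continuousOn hFf
  have hinv : Tendsto (fun c : ℝ => c⁻¹) atTop (𝓝 0) := tendsto_inv_atTop_zero
  have hreg : ∀ δ : ℝ, 0 < δ → ContDiff ℝ 1 fun y : Space n => regKernel ε δ (y - x) := fun δ hδ =>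
    (contDiff_regKernel ε hδ).comp (contDiff_id.sub contDiff_const)
  have hlim1 : Tendsto (fun c : ℝ => A.integral ε (fun y => regKernel ε c⁻¹ (y - x)) F) atTop
      (𝓝 (A.integral ε (fun y => cauchyKernel ε (y - x)) F)) := by
    refine A.tendsto_integral hΩ.isBounded ε (g := fun _ => F) (C := C) (B := B) ?_ hE
      (Eventually.of_forall fun _ => hFf) hFf ?_ (Eventually.of_forall fun _ => hB) ?_
      fun _ _ => tendsto_const_nhds
    · filter_upwards [eventually_gt_atTop 0] with c hc
        using (hreg c⁻¹ (inv_pos.mpr hc)).continuous.continuousOn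
    · exact Eventually.of_forall fun c y hy =>
        (norm_regKernel_le ε c⁻¹ (hne y hy)).trans (hC y hy)
    · exact fun y hy => (tendsto_regKernel ε (hne y hy)).comp hinv
  have hint : Integrable (Ω.indicator F) := by
    rw [integrable_indicator_iff hΩ.isOpen.measurableSet]
    exact (hF.integrableOn_compact hΩ.isBounded.isCompact_closure).mono_set subset_closure
  -- The approximate identity needs continuity at `x` only. Off the boundary the indicator of `Ω` is
  -- locally constant, which treats interior and exterior points together.
  have hcont : ContinuousAt (Ω.indicator F) x := by
    by_cases hxΩ : x ∈ Ω
    · have h1 : ContinuousAt F x :=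
        (hF.mono subset_closure).continuousAt (hΩ.isOpen.mem_nhds hxΩ)
      refine h1.congr ?_
      filter_upwards [hΩ.isOpen.mem_nhds hxΩ] with y hy using (indicator_of_mem hy F).symm
    · have hxc : x ∈ (closure Ω)ᶜ := fun h => hx (by
        rw [hΩ.isOpen.frontier_eq]
        exact ⟨h, hxΩ⟩)
      refine (continuousAt_const (y := (0 : V))).congr ?_
      filter_upwards [isClosed_closure.isOpen_compl.mem_nhds hxc] with y hy
        using (indicator_of_notMem (fun h => hy (subset_closure h)) F).symm
  have hlim2 := tendsto_integral_comp_smul_smul_of_integrable' (μ := volume) peak_nonneg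
    (integral_peak n) (tendsto_peak n) hint hcont
  refine tendsto_nhds_unique hlim1 (hlim2.congr' ?_)
  filter_upwards [eventually_gt_atTop 0] with c hc
  rw [A.integral_eq_setIntegral_of_tendsto hΩ ε (hreg c⁻¹ (inv_pos.mpr hc)) hu huF hw,
    ← integral_indicator hΩ.isOpen.measurableSet]
  congr 1
  ext y
  by_cases hy : y ∈ Ω
  · rw [indicator_of_mem hy, indicator_of_mem hy, diracRight_comp_sub,
      diracRight_regKernel hε (inv_pos.mpr hc), algebraMap_smul, peak_smul hc]
  · rw [indicator_of_notMem hy, indicator_of_notMem hy, smul_zero]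

/-- Cauchy's integral formula for solutions of `D g = 0`. -/
theorem BoundaryAtlas.cauchy_integral [CompleteSpace V] (A : BoundaryAtlas Ω)
    (hΩ : IsC1Domain Ω) {ε : ℝ} (hε : ε = 1 ∨ ε = -1) {g : Space n → V}
    (hg : SolvesDirac ε Ω g fun _ => 0) {x : Space n} (hx : x ∉ frontier Ω) :
    A.integral ε (fun y => cauchyKernel ε (y - x)) g = Ω.indicator g x := by
  refine A.cauchy_integral_of_tendsto hΩ hε (u := fun _ => g) (w := fun _ _ => 0) (fun _ => hg)
    ?_ ?_ hx
  · exact fun s hs => Eventually.of_forall fun _ y _ => refl_mem_uniformity hs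
  · exact fun s hs => Eventually.of_forall fun _ y _ => refl_mem_uniformity hs

end

/-! ### Twisting solutions by exponentials. -/

section

open scoped BoundedContinuousFunction Nat

variable {n : ℕ} {Ω : Set (Space n)} {ε : ℝ}
variable {V : Type*} [NormedAddCommGroup V] [NormedSpace ℝ V] [Module (Cl n) V]

theorem SolvesDirac.add (hΩ : IsOpen Ω) {f g v w : Space n → V} (hf : SolvesDirac ε Ω f v)
    (hg : SolvesDirac ε Ω g w) : SolvesDirac ε Ω (fun y => f y + g y) fun y => v y + w y := by
  refine ⟨hf.continuousOn.add hg.continuousOn, hf.contDiffOn.add hg.contDiffOn, fun y hy => ?_⟩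
  have h1 := (hf.contDiffOn.differentiableOn one_ne_zero).differentiableAt (hΩ.mem_nhds hy)
  have h2 := (hg.contDiffOn.differentiableOn one_ne_zero).differentiableAt (hΩ.mem_nhds hy)
  rw [← hf.eq y hy, ← hg.eq y hy]
  simp only [dirac, fderiv_fun_add h1 h2, add_apply, smul_add, Finset.sum_add_distrib]

theorem SolvesDirac.congr {f g v w : Space n → V} (hΩ : IsOpen Ω) (hf : SolvesDirac ε Ω f v)
    (hfg : EqOn g f (closure Ω)) (hvw : EqOn w v Ω) : SolvesDirac ε Ω g w := by
  refine ⟨hf.continuousOn.congr hfg, hf.contDiffOn.congr fun y hy => hfg (subset_closure hy),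
    fun y hy => ?_⟩
  have h : g =ᶠ[𝓝 y] f := by
    filter_upwards [hΩ.mem_nhds hy] with z hz using hfg (subset_closure hz)
  rw [hvw hy, ← hf.eq y hy]
  simp only [dirac, h.fderiv_eq]

/-- The product rule for `D` and a family of operators that depends on the scalar variable and
commutes with the units. -/
theorem SolvesDirac.twist (hΩ : IsOpen Ω) {f w : Space n → V} (hf : SolvesDirac ε Ω f w)
    {T T' : ℝ → V →L[ℝ] V} (hT : ∀ t, HasDerivAt T (T' t) t) (hT' : Continuous T')
    (hcomm : ∀ t (j : Fin (n + 1)) (v : V), T t ((unit ε j : Cl n) • v) = (unit ε j : Cl n) • T t v) :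
    SolvesDirac ε Ω (fun y => T (y 0) (f y)) fun y => T' (y 0) (f y) + T (y 0) (w y) := by
  have hTc : ContDiff ℝ 1 T := by
    rw [contDiff_one_iff_deriv]
    refine ⟨fun t => (hT t).differentiableAt, ?_⟩
    have : deriv T = T' := funext fun t => (hT t).deriv
    rwa [this]
  have hproj : ContDiff ℝ 1 fun y : Space n => y 0 :=
    (EuclideanSpace.proj (𝕜 := ℝ) (0 : Fin (n + 1))).contDiff
  refine ⟨(hTc.comp hproj).continuous.continuousOn.clm_apply hf.continuousOn,
    (hTc.comp hproj).contDiffOn.clm_apply hf.contDiffOn, fun y hy => ?_⟩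
  have h1 := HasFDerivAt.comp (g := T) y (hT (y 0)).hasFDerivAt
    (EuclideanSpace.proj (𝕜 := ℝ) (0 : Fin (n + 1))).hasFDerivAt
  have h2 : HasFDerivAt f (fderiv ℝ f y) y :=
    ((hf.contDiffOn.differentiableOn one_ne_zero).differentiableAt (hΩ.mem_nhds hy)).hasFDerivAt
  have h3 : ∀ j : Fin (n + 1), fderiv ℝ (fun y : Space n => T (y 0) (f y)) y
      (EuclideanSpace.single j 1) = T (y 0) (fderiv ℝ f y (EuclideanSpace.single j 1)) +
        (EuclideanSpace.single j (1 : ℝ) : Space n) 0 • T' (y 0) (f y) := by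
    intro j
    have h4 : fderiv ℝ (fun y : Space n => T (y 0) (f y)) y = _ := (h1.clm_apply h2).fderiv
    rw [h4]
    by_cases hj : (0 : Fin (n + 1)) = j <;> simp [hj]
  rw [← hf.eq y hy]
  simp only [dirac, h3, smul_add, Finset.sum_add_distrib, ← hcomm, ← map_sum]
  -- The operator family depends on `y_0` alone, so `T'` enters only through the index `0`, whose
  -- unit is `1`.
  rw [add_comm, Finset.sum_eq_single 0]
  · simp [unit]
  · intro j _ hj
    simp [hj.symm]
  · simp

section Scalar

variable [IsScalarTower ℝ (Cl n) V]

theorem unit_comm {M : V →ₗ[ℝ] V} (hM : ∀ (j : Fin n) (v : V), M ((e j : Cl n) • v) = (e j : Cl n) • M v)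
    (j : Fin (n + 1)) (v : V) : M ((unit ε j : Cl n) • v) = (unit ε j : Cl n) • M v := by
  refine Fin.cases ?_ (fun j => ?_) j
  · simp [unit]
  · simp [unit, hM]

theorem SolvesDirac.smul (hΩ : IsOpen Ω) {f w : Space n → V} (hf : SolvesDirac ε Ω f w)
    {b b' : ℝ → ℝ} (hb : ∀ t, HasDerivAt b (b' t) t) (hb' : Continuous b') :
    SolvesDirac ε Ω (fun y => b (y 0) • f y) fun y => b' (y 0) • f y + b (y 0) • w y :=
  hf.twist hΩ (T := fun t => b t • ContinuousLinearMap.id ℝ V)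
    (T' := fun t => b' t • ContinuousLinearMap.id ℝ V) (fun t => (hb t).smul_const (ContinuousLinearMap.id ℝ V : V →L[ℝ] V))
    (hb'.smul continuous_const) fun _ _ _ => smul_comm _ _ _

end Scalar

theorem exp_smul_comm [CompleteSpace V] [IsScalarTower ℝ (Cl n) V] [ContinuousConstSMul (Cl n) V]
    {M : V →L[ℝ] V} (hM : ∀ (j : Fin n) (v : V), M ((e j : Cl n) • v) = (e j : Cl n) • M v) (t : ℝ)
    (j : Fin (n + 1)) (v : V) : NormedSpace.exp (t • M) ((unit ε j : Cl n) • v) =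
      (unit ε j : Cl n) • NormedSpace.exp (t • M) v := by
  have h1 : Commute (actionL n V (unit ε j)) (t • M) := by
    refine Commute.smul_right ?_ t
    ext v
    exact (unit_comm (M := (M : V →ₗ[ℝ] V)) hM j v).symm
  exact (congrArg (fun A => A v) h1.exp_right).symm

theorem exp_smul_mul_exp_neg_smul {𝔸 : Type*} [NormedRing 𝔸] [NormedAlgebra ℝ 𝔸] [CompleteSpace 𝔸]
    (t : ℝ) (M : 𝔸) : NormedSpace.exp (t • M) * NormedSpace.exp (-t • M) = 1 := by
  let : NormedAlgebra ℚ 𝔸 := NormedAlgebra.restrictScalars ℚ ℝ 𝔸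
  rw [← NormedSpace.exp_add_of_commute, ← add_smul, add_neg_cancel, zero_smul, NormedSpace.exp_zero]
  exact ((Commute.refl M).smul_left t).smul_right (-t)

/-- Twisting by the exponential of an operator on the values turns `D f = M f` into `D g = 0`. -/
theorem SolvesDirac.exp_operator [CompleteSpace V] [IsScalarTower ℝ (Cl n) V]
    [ContinuousConstSMul (Cl n) V] (hΩ : IsOpen Ω) {M : V →L[ℝ] V}
    (hM : ∀ (j : Fin n) (v : V), M ((e j : Cl n) • v) = (e j : Cl n) • M v) {f : Space n → V}
    (hf : SolvesDirac ε Ω f fun y => M (f y)) :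
    SolvesDirac ε Ω (fun y => NormedSpace.exp (-(y 0) • M) (f y)) fun _ => 0 := by
  have hT : ∀ t : ℝ, HasDerivAt (fun t : ℝ => NormedSpace.exp (-t • M))
      (-(NormedSpace.exp (-t • M) * M)) t := by
    intro t
    have h1 := (hasDerivAt_exp_smul_const M (-t)).scomp t (hasDerivAt_neg t)
    simpa [Function.comp_def] using h1
  have hcont : Continuous fun t : ℝ => NormedSpace.exp (-t • M) :=
    continuous_iff_continuousAt.mpr fun t => (hT t).continuousAt
  refine (hf.twist hΩ hT (hcont.mul continuous_const).neg
    fun t j v => exp_smul_comm hM (-t) j v).congr hΩ (fun y _ => rfl) fun y _ => ?_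
  simp

/-- Right multiplications commute with the left action of the units by associativity, so `lam` need
not be central. -/
theorem SolvesDirac.exp_mul {f : Space n → Cl n} {lam : Cl n} (hΩ : IsOpen Ω)
    (hf : SolvesDirac ε Ω f fun y => f y * lam) (s : ℝ) :
    SolvesDirac ε Ω (fun y => f y * NormedSpace.exp ((s - y 0) • lam)) fun _ => 0 := by
  have : CompleteSpace (Cl n) := FiniteDimensional.complete ℝ (Cl n)
  set R : Cl n →L[ℝ] Cl n →L[ℝ] Cl n := (ContinuousLinearMap.mul ℝ (Cl n)).flip with hR
  have hE : ∀ t : ℝ, HasDerivAt (fun t : ℝ => NormedSpace.exp ((s - t) • lam))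
      (-(lam * NormedSpace.exp ((s - t) • lam))) t := by
    intro t
    have h1 := (hasDerivAt_exp_smul_const' lam (s - t)).scomp t ((hasDerivAt_id t).const_sub s)
    simpa [Function.comp_def] using h1
  have hcont : Continuous fun t : ℝ => NormedSpace.exp ((s - t) • lam) :=
    continuous_iff_continuousAt.mpr fun t => (hE t).continuousAt
  refine (hf.twist hΩ (T := fun t => R (NormedSpace.exp ((s - t) • lam)))
    (T' := fun t => R (-(lam * NormedSpace.exp ((s - t) • lam))))
    (fun t => R.hasFDerivAt.comp_hasDerivAt t (hE t))
    (R.continuous.comp (continuous_const.mul hcont).neg)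
    fun t j v => mul_assoc _ _ _).congr hΩ (fun y _ => rfl) fun y _ => ?_
  simp [hR, mul_assoc]

theorem SolvesDirac.exp_real {f : Space n → Cl n} {lam : ℝ} (hΩ : IsOpen Ω)
    (hf : SolvesDirac ε Ω f fun y => lam • f y) (s : ℝ) :
    SolvesDirac ε Ω (fun y => Real.exp ((s - y 0) * lam) • f y) fun _ => 0 := by
  have hE : ∀ t : ℝ, HasDerivAt (fun t : ℝ => Real.exp ((s - t) * lam))
      (-(lam * Real.exp ((s - t) * lam))) t := by
    intro t
    have h1 := (((hasDerivAt_id t).const_sub s).mul_const lam).exp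
    refine h1.congr_deriv ?_
    simp [mul_comm]
  refine (hf.smul hΩ (b := fun t => Real.exp ((s - t) * lam)) hE (by fun_prop)).congr hΩ
    (fun y _ => rfl) fun y _ => ?_
  simp [mul_smul, smul_comm lam]

variable {E : Type*} [NormedAddCommGroup E]

theorem extendZero_apply (u : closure Ω →ᵇ E) (y : closure Ω) : extendZero u (y : Space n) = u y :=
  Subtype.val_injective.extend_apply _ _ _

theorem extendZero_of_mem (u : closure Ω →ᵇ E) {y : Space n} (hy : y ∈ closure Ω) :
    extendZero u y = u ⟨y, hy⟩ := extendZero_apply u ⟨y, hy⟩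

variable [NormedSpace ℝ E]

theorem pow_succ_apply {X : Type*} [NormedAddCommGroup X] [NormedSpace ℝ X] (M : X →L[ℝ] X) (k : ℕ)
    (x : X) : (M ^ (k + 1)) x = M ((M ^ k) x) := by
  rw [pow_succ']
  rfl

theorem hasSum_exp_apply {X : Type*} [TopologicalSpace X] [CompleteSpace E]
    (B : (X →ᵇ E) →L[ℝ] (X →ᵇ E)) (h : X →ᵇ E) (x : X) :
    HasSum (fun k => (k ! : ℝ)⁻¹ • (B ^ k) h x) (NormedSpace.exp B h x) := by
  have h1 := NormedSpace.exp_series_hasSum_exp' (𝕂 := ℝ) B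
  have h2 := (BoundedContinuousFunction.evalCLM ℝ x ∘L ContinuousLinearMap.apply ℝ (X →ᵇ E) h).hasSum h1
  simpa using h2

/-- Multiplication of bounded continuous functions by a bounded scalar function. -/
noncomputable def mulOperator {X : Type*} [TopologicalSpace X] (c : X →ᵇ ℝ) :
    (X →ᵇ E) →L[ℝ] (X →ᵇ E) :=
  LinearMap.mkContinuous
    { toFun := fun h => c • h
      map_add' := fun h g => smul_add c h g
      map_smul' := fun r h => by
        ext x
        exact smul_comm (c x) r (h x) } ‖c‖ fun h => norm_smul_le c h

theorem mulOperator_apply {X : Type*} [TopologicalSpace X] (c : X →ᵇ ℝ) (h : X →ᵇ E) (x : X) :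
    mulOperator c h x = c x • h x := rfl

/-- Commutation gives `(cM)^k = c^k M^k`, and the exponential series can be evaluated at `x` term by
term. Thus the exponentials with a parameter depending on `x` are the values of one exponential. -/
theorem exp_mulOperator_apply {X : Type*} [TopologicalSpace X] [CompleteSpace E] {c : X →ᵇ ℝ}
    {M : (X →ᵇ E) →L[ℝ] (X →ᵇ E)} (hM : Commute (mulOperator c) M) (s : ℝ) (h : X →ᵇ E) (x : X) :
    NormedSpace.exp (s • (mulOperator c * M) : (X →ᵇ E) →L[ℝ] (X →ᵇ E)) h x =
      NormedSpace.exp ((s * c x) • M) h x := by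
  refine (hasSum_exp_apply _ h x).unique ?_
  convert! hasSum_exp_apply ((s * c x) • M) h x using 2 with k
  have hpow : ∀ (k : ℕ) (g : X →ᵇ E), (mulOperator c ^ k) g x = c x ^ k • g x := by
    intro k
    induction k with
    | zero => intro g; simp
    | succ k ih =>
      intro g
      rw [pow_succ_apply, mulOperator_apply, ih, smul_smul, pow_succ']
  rw [smul_pow, smul_pow, hM.mul_pow]
  have h1 := hpow k ((M ^ k) h)
  simp only [smul_apply, mul_apply_eq_comp, BoundedContinuousFunction.coe_smul,
    mul_pow, mul_smul, h1]

/-- The partial sums of the exponential series of an admissible operator. -/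
theorem IsAdmissible.exists_approximation [CompleteSpace V] [IsScalarTower ℝ (Cl n) V]
    (hΩ : IsOpen Ω) (hb : Bornology.IsBounded Ω)
    {M : (closure Ω →ᵇ V) →L[ℝ] (closure Ω →ᵇ V)} (hM : IsAdmissible ε M) {f : closure Ω →ᵇ V}
    (hf : SolvesDirac ε Ω (extendZero f) (extendZero (M f))) :
    ∃ u w : ℕ → Space n → V, (∀ k, SolvesDirac ε Ω (u k) (w k)) ∧
      TendstoUniformlyOn u (fun y => extendZero (NormedSpace.exp (-(y 0) • M) f) y) atTop
        (closure Ω) ∧ TendstoUniformlyOn w 0 atTop Ω := by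
  have hv : ∀ i : ℕ, SolvesDirac ε Ω (extendZero ((M ^ i) f)) (extendZero ((M ^ (i + 1)) f)) := by
    intro i
    induction i with
    | zero => simpa using hf
    | succ i ih =>
      have h1 := hM.comm_dirac _ _ ih
      rwa [← pow_succ_apply, ← pow_succ_apply] at h1
  set b : ℕ → ℝ → ℝ := fun i t => (-t) ^ i / i ! with hbdef
  have hbcont : ∀ i, Continuous (b i) := fun i => by
    simp only [hbdef]
    fun_prop
  have hb0 : ∀ t, HasDerivAt (b 0) 0 t := fun t => by
    simpa [hbdef] using hasDerivAt_const t (1 : ℝ)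
  have hbs : ∀ i t, HasDerivAt (b (i + 1)) (-b i t) t := by
    intro i t
    have h1 := ((hasDerivAt_neg t).pow (i + 1)).div_const ((i + 1)! : ℝ)
    refine h1.congr_deriv ?_
    simp only [hbdef]
    rw [Nat.factorial_succ]
    push_cast
    have : (i ! : ℝ) ≠ 0 := by positivity
    have : (i : ℝ) + 1 ≠ 0 := by positivity
    field_simp
  set u : ℕ → Space n → V := fun N y => ∑ i ∈ Finset.range N, b i (y 0) • extendZero ((M ^ i) f) y
    with hu
  -- Since the derivative of `b (i + 1)` is `-b i`, the sum `D (u N)` telescopes to its last term.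
  -- The empty sum has to be listed separately.
  set w : ℕ → Space n → V := fun N y => match N with
    | 0 => 0
    | N + 1 => b N (y 0) • extendZero ((M ^ (N + 1)) f) y with hw
  have hsolve : ∀ N, SolvesDirac ε Ω (u N) (w N) := by
    intro N
    induction N with
    | zero =>
      refine ⟨by simpa [hu] using continuousOn_const, by simpa [hu] using contDiffOn_const,
        fun y _ => ?_⟩
      simp [hu, hw, dirac]
    | succ N ih =>
      cases N with
      | zero =>
        refine (ih.add hΩ ((hv 0).smul hΩ hb0 continuous_const)).congr hΩ (fun y _ => ?_)
          fun y _ => ?_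
        · simp [hu]
        · simp [hw]
      | succ N =>
        refine (ih.add hΩ ((hv (N + 1)).smul hΩ (hbs N) (hbcont N).neg)).congr hΩ (fun y _ => ?_)
          fun y _ => ?_
        · simp only [hu]
          rw [Finset.sum_range_succ]
        · simp [hw]
  obtain ⟨R, hR⟩ := exists_bound_of_continuousOn hb
    (f := fun y : Space n => y 0) (by fun_prop)
  have hRb : ∀ i, ∀ y ∈ closure Ω, ‖b i (y 0)‖ ≤ R ^ i / i ! := by
    intro i y hy
    simp only [hbdef]
    rw [norm_div, norm_pow, norm_neg, Real.norm_natCast]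
    gcongr
    exact hR y hy
  have hext : ∀ (g : closure Ω →ᵇ V), ∀ y ∈ closure Ω, ‖extendZero g y‖ ≤ ‖g‖ := by
    intro g y hy
    rw [extendZero_of_mem g hy]
    exact g.norm_coe_le_norm _
  have hMf : ∀ i, ‖(M ^ i) f‖ ≤ ‖M‖ ^ i * ‖f‖ := by
    intro i
    induction i with
    | zero => simp
    | succ i ih =>
      rw [pow_succ_apply, pow_succ', mul_assoc]
      exact (M.le_opNorm _).trans (mul_le_mul_of_nonneg_left ih (ContinuousLinearMap.opNorm_nonneg _))
  have hsummable : Summable fun i : ℕ => R ^ i / i ! * (‖M‖ ^ i * ‖f‖) := by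
    have h1 := (Real.summable_pow_div_factorial (R * ‖M‖)).mul_right ‖f‖
    refine h1.congr fun i => ?_
    rw [mul_pow]
    ring
  have hbound : ∀ i, ∀ y ∈ closure Ω,
      ‖b i (y 0) • extendZero ((M ^ i) f) y‖ ≤ R ^ i / i ! * (‖M‖ ^ i * ‖f‖) := by
    intro i y hy
    rw [norm_smul]
    exact mul_le_mul (hRb i y hy) ((hext _ y hy).trans (hMf i)) (norm_nonneg _)
      ((norm_nonneg _).trans (hRb i y hy))
  refine ⟨u, w, hsolve, ?_, ?_⟩
  · refine (tendstoUniformlyOn_tsum_nat hsummable hbound).congr_right fun y hy => ?_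
    refine HasSum.tsum_eq ?_
    simp only []
    rw [extendZero_of_mem _ hy]
    convert! hasSum_exp_apply (-(y 0) • M) f ⟨y, hy⟩ using 2 with i
    rw [extendZero_of_mem _ hy, smul_pow]
    simp [hbdef, smul_smul, div_eq_inv_mul]
  -- The remainder `w (k + 1)` is bounded by `‖M‖` times the `k`-th term of the summable majorant.
  · rw [Metric.tendstoUniformlyOn_iff]
    intro δ hδ
    have h1 : Tendsto (fun i : ℕ => R ^ i / i ! * (‖M‖ ^ i * ‖f‖) * ‖M‖) atTop (𝓝 0) := by
      simpa using hsummable.tendsto_atTop_zero.mul_const ‖M‖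
    rw [← tendsto_add_atTop_iff_nat 0] at h1
    have h2 := (tendsto_order.mp h1).2 δ hδ
    rw [eventually_atTop] at h2 ⊢
    obtain ⟨N, hN⟩ := h2
    refine ⟨N + 1, fun k hk y hy => ?_⟩
    obtain ⟨k, rfl⟩ : ∃ m, k = m + 1 := ⟨k - 1, by omega⟩
    have hyc := subset_closure hy
    rw [Pi.zero_apply, dist_zero_left]
    refine lt_of_le_of_lt ?_ (hN k (by omega))
    simp only [hw]
    rw [norm_smul]
    calc ‖b k (y 0)‖ * ‖extendZero ((M ^ (k + 1)) f) y‖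
        ≤ R ^ k / k ! * (‖M‖ ^ (k + 1) * ‖f‖) :=
          mul_le_mul (hRb k y hyc) ((hext _ y hyc).trans (hMf _)) (norm_nonneg _)
            ((norm_nonneg _).trans (hRb k y hyc))
      _ = R ^ k / k ! * (‖M‖ ^ k * ‖f‖) * ‖M‖ := by ring

end

/-! ### The integral formulas for the four kinds of operators. -/

section

open scoped BoundedContinuousFunction

variable {n : ℕ} {Ω : Set (Space n)} {ε : ℝ}

theorem IsC1Domain.notMem_frontier (hΩ : IsC1Domain Ω) {x : Space n} (hx : x ∈ Ω) :
    x ∉ frontier Ω := by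
  rw [hΩ.isOpen.frontier_eq]
  exact fun h => h.2 hx

theorem notMem_frontier_of_notMem_closure {x : Space n} (hx : x ∉ closure Ω) : x ∉ frontier Ω :=
  fun h => hx (frontier_subset_closure h)

section Operator

variable {V : Type*} [NormedAddCommGroup V] [NormedSpace ℝ V] [CompleteSpace V] [Module (Cl n) V]

/-- The twisted function `e^{-y_0 M} f` is the restriction of one continuous function `F`, and
`e^{x_0 M} F = f`. -/
theorem IsAdmissible.exists_twisted (hb : Bornology.IsBounded Ω)
    {M : (closure Ω →ᵇ V) →L[ℝ] (closure Ω →ᵇ V)} (hM : IsAdmissible ε M) (f : closure Ω →ᵇ V) :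
    ∃ F : closure Ω →ᵇ V,
      (∀ x : closure Ω, F x = NormedSpace.exp (-((x : Space n) 0) • M) f x) ∧
        ∀ x : closure Ω, NormedSpace.exp ((x : Space n) 0 • M) F x = f x := by
  have : CompactSpace (closure Ω) := isCompact_iff_compactSpace.mp hb.isCompact_closure
  set c : closure Ω →ᵇ ℝ := BoundedContinuousFunction.mkOfCompact
    ⟨fun y : closure Ω => (y : Space n) 0, by fun_prop⟩ with hc
  -- Commutation of `M` with multiplication by `y_0` is needed here; the approximation by partial
  -- sums uses only commutation with `D`.
  have hcomm : Commute (mulOperator c) M := by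
    ext u y
    exact (hM.comm_time u (mulOperator c u) (fun _ => rfl) y).symm
  set B : (closure Ω →ᵇ V) →L[ℝ] (closure Ω →ᵇ V) := mulOperator c * M with hB
  -- As the image of `f` under one bounded operator, `F` is continuous on the closure, and the
  -- inverse operator `e^B` recovers `f`.
  refine ⟨NormedSpace.exp (-(1 : ℝ) • B) f, fun x => ?_, fun x => ?_⟩
  · rw [exp_mulOperator_apply hcomm, neg_one_mul]
    rfl
  · have h1 := exp_mulOperator_apply hcomm 1 (NormedSpace.exp (-(1 : ℝ) • B) f) x
    rw [one_mul] at h1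
    refine h1.symm.trans ?_
    exact congrArg (fun A : (closure Ω →ᵇ V) →L[ℝ] (closure Ω →ᵇ V) => A f x)
      (exp_smul_mul_exp_neg_smul 1 B)

variable [IsScalarTower ℝ (Cl n) V] [ContinuousConstSMul (Cl n) V]

theorem BoundaryAtlas.integral_exp_function_operator (A : BoundaryAtlas Ω) (hΩ : IsC1Domain Ω)
    (hε : ε = 1 ∨ ε = -1) {M : (closure Ω →ᵇ V) →L[ℝ] (closure Ω →ᵇ V)} (hM : IsAdmissible ε M)
    {f : closure Ω →ᵇ V} (hf : SolvesDirac ε Ω (extendZero f) (extendZero (M f))) {x : Space n}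
    (hx : x ∉ frontier Ω) :
    A.integral ε (fun y => cauchyKernel ε (y - x))
      (fun y => extendZero (NormedSpace.exp (-(y 0) • M) f) y) =
        Ω.indicator (fun y => extendZero (NormedSpace.exp (-(y 0) • M) f) y) x := by
  obtain ⟨u, w, huw, hu, hw⟩ := hM.exists_approximation hΩ.isOpen hΩ.isBounded hf
  exact A.cauchy_integral_of_tendsto hΩ hε huw hu hw hx

theorem BoundaryAtlas.integral_exp_value_operator (A : BoundaryAtlas Ω) (hΩ : IsC1Domain Ω)
    (hε : ε = 1 ∨ ε = -1) {M : V →L[ℝ] V}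
    (hM : ∀ (j : Fin n) (v : V), M ((e j : Cl n) • v) = (e j : Cl n) • M v) {f : Space n → V}
    (hf : SolvesDirac ε Ω f fun y => M (f y)) {x : Space n} (hx : x ∉ frontier Ω) :
    NormedSpace.exp (x 0 • M) (A.integral ε (fun y => cauchyKernel ε (y - x))
      fun y => NormedSpace.exp (-(y 0) • M) (f y)) = Ω.indicator f x := by
  rw [A.cauchy_integral hΩ hε (hf.exp_operator hΩ.isOpen hM) hx]
  by_cases hxΩ : x ∈ Ω
  · rw [indicator_of_mem hxΩ, indicator_of_mem hxΩ]
    exact congrArg (fun A : V →L[ℝ] V => A (f x)) (exp_smul_mul_exp_neg_smul (x 0) M)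
  · rw [indicator_of_notMem hxΩ, indicator_of_notMem hxΩ, map_zero]

end Operator

theorem BoundaryAtlas.integral_exp_mul (A : BoundaryAtlas Ω) (hΩ : IsC1Domain Ω)
    (hε : ε = 1 ∨ ε = -1) {lam : Cl n} {f : Space n → Cl n}
    (hf : SolvesDirac ε Ω f fun y => f y * lam) {x : Space n} (hx : x ∉ frontier Ω) :
    A.integral ε (fun y => cauchyKernel ε (y - x))
      (fun y => f y * NormedSpace.exp ((x 0 - y 0) • lam)) = Ω.indicator f x := by
  have : CompleteSpace (Cl n) := FiniteDimensional.complete ℝ (Cl n)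
  rw [A.cauchy_integral hΩ hε (hf.exp_mul hΩ.isOpen (x 0)) hx]
  by_cases hxΩ : x ∈ Ω
  · rw [indicator_of_mem hxΩ, indicator_of_mem hxΩ]
    simp
  · rw [indicator_of_notMem hxΩ, indicator_of_notMem hxΩ]

theorem BoundaryAtlas.integral_exp_real (A : BoundaryAtlas Ω) (hΩ : IsC1Domain Ω)
    (hε : ε = 1 ∨ ε = -1) {lam : ℝ} {f : Space n → Cl n}
    (hf : SolvesDirac ε Ω f fun y => lam • f y) {x : Space n} (hx : x ∉ frontier Ω) :
    A.integral ε (fun y => Real.exp ((x 0 - y 0) * lam) • cauchyKernel ε (y - x)) f =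
      Ω.indicator f x := by
  have : CompleteSpace (Cl n) := FiniteDimensional.complete ℝ (Cl n)
  have h1 := A.cauchy_integral hΩ hε (hf.exp_real hΩ.isOpen (x 0)) hx
  have h2 : A.integral ε (fun y => Real.exp ((x 0 - y 0) * lam) • cauchyKernel ε (y - x)) f =
      A.integral ε (fun y => cauchyKernel ε (y - x))
        fun y => Real.exp ((x 0 - y 0) * lam) • f y := by
    simp only [BoundaryAtlas.integral, smul_eq_mul, smul_mul_assoc, mul_smul_comm]
  rw [h2, h1]
  by_cases hxΩ : x ∈ Ω
  · rw [indicator_of_mem hxΩ, indicator_of_mem hxΩ]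
    simp
  · rw [indicator_of_notMem hxΩ, indicator_of_notMem hxΩ]

end

/-! ### Existence of oriented atlases. -/

section

variable {n : ℕ}

theorem normalForm_ne_zero_iff {v : Fin n → Space n} {w : Space n} :
    normalForm v w ≠ 0 ↔ LinearIndependent ℝ (Fin.cons w v : Fin (n + 1) → Space n) := by
  set A : Matrix (Fin (n + 1)) (Fin (n + 1)) ℝ :=
    Matrix.of fun i k : Fin (n + 1) => (Fin.cons w v : Fin (n + 1) → Space n) k i with hA
  have h1 : A.col = WithLp.linearEquiv 2 ℝ (Fin (n + 1) → ℝ) ∘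
      (Fin.cons w v : Fin (n + 1) → Space n) := rfl
  rw [normalForm_eq_det, ← isUnit_iff_ne_zero, ← hA, ← Matrix.isUnit_iff_isUnit_det,
    ← Matrix.linearIndependent_cols_iff_isUnit, h1]
  exact LinearMap.linearIndependent_iff _ (LinearEquiv.ker _)

theorem normalForm_update_neg (v : Fin n → Space n) (w : Space n) (k : Fin n) :
    normalForm (Function.update v k (-v k)) w = -normalForm v w := by
  have h1 : ∀ v : Fin n → Space n, normalForm v w = (Matrix.detRowAlternating.compLinearMap
      (WithLp.linearEquiv 2 ℝ (Fin (n + 1) → ℝ)).toLinearMap) (Fin.cons w v : Fin (n + 1) → Space n) := by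
    intro v
    rw [normalForm_eq_det, ← Matrix.det_transpose]
    rfl
  rw [h1, h1, Fin.cons_update, AlternatingMap.map_update_neg, ← Fin.cons_update,
    Function.update_eq_self]

/-- These are column operations. They apply to a boundary written as a graph in direction `w`, whose
tangent vectors differ from a fixed frame by multiples of `w`. -/
theorem normalForm_add_smul (v : Fin n → Space n) (w : Space n) (c : Fin n → ℝ) :
    normalForm (fun k => c k • w + v k) w = normalForm v w := by
  rw [normalForm_eq_det, normalForm_eq_det, ← Matrix.det_transpose, ← Matrix.det_transpose (Matrix.of _)]
  refine Matrix.det_eq_of_forall_row_eq_smul_add_const (Fin.cons 0 c) 0 rfl fun i j => ?_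
  refine Fin.cases ?_ (fun k => ?_) i
  · simp
  · simp [add_comm]

/-- A positively oriented frame adapted to the kernel of a functional. -/
theorem exists_frame (hn : 1 ≤ n) {l : Space n →L[ℝ] ℝ} (hl : l ≠ 0) :
    ∃ (w : Space n) (b : Fin n → Space n), l w = 1 ∧ (∀ k, l (b k) = 0) ∧ 0 < normalForm b w := by
  have hl' : (l : Space n →ₗ[ℝ] ℝ) ≠ 0 := fun h => hl (by ext y; exact congrArg (fun f => f y) h)
  obtain ⟨w, hw⟩ : ∃ w, l w = 1 := LinearMap.surjective hl' 1
  have hker : Module.finrank ℝ (LinearMap.ker (l : Space n →ₗ[ℝ] ℝ)) = n := by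
    have := Module.Dual.finrank_ker_add_one_of_ne_zero hl'
    simp only [finrank_euclideanSpace, Fintype.card_fin] at this
    omega
  set b : Fin n → Space n := fun k => (Module.finBasisOfFinrankEq ℝ _ hker k : Space n) with hb
  have hbl : ∀ k, l (b k) = 0 := fun k => (Module.finBasisOfFinrankEq ℝ _ hker k).2
  have hne : normalForm b w ≠ 0 := by
    rw [normalForm_ne_zero_iff, linearIndependent_finCons]
    refine ⟨(Module.finBasisOfFinrankEq ℝ _ hker).linearIndependent.map' (Submodule.subtype _)
      (Submodule.ker_subtype _), fun hmem => ?_⟩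
    have h1 : Submodule.span ℝ (range b) ≤ LinearMap.ker (l : Space n →ₗ[ℝ] ℝ) := by
      rw [Submodule.span_le]
      rintro _ ⟨k, rfl⟩
      exact hbl k
    have h2 : l w = 0 := h1 hmem
    exact one_ne_zero (hw.symm.trans h2)
  rcases hne.lt_or_gt with hneg | hpos
  -- A wrong orientation is repaired by reversing one tangent vector, which requires `n ≥ 1`.
  · refine ⟨w, Function.update b ⟨0, hn⟩ (-b ⟨0, hn⟩), hw, fun k => ?_, ?_⟩
    · by_cases hk : k = ⟨0, hn⟩
      · subst hk
        simp [hbl]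
      · simp [hk, hbl]
    · rw [normalForm_update_neg]
      linarith
  · exact ⟨w, b, hw, hbl, hpos⟩

/-- The linear coordinates of an adapted frame. -/
theorem exists_frame_coordinates {l : Space n →L[ℝ] ℝ} {w : Space n} {b : Fin n → Space n}
    (hw : l w = 1) (hb : ∀ k, l (b k) = 0) (hpos : normalForm b w ≠ 0) :
    ∃ C : Space n ≃L[ℝ] Space n, C w = EuclideanSpace.single 0 1 ∧
      (∀ k, C (b k) = EuclideanSpace.single k.succ 1) ∧ ∀ y, C y 0 = l y := by
  set B : Module.Basis (Fin (n + 1)) ℝ (Space n) :=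
    basisOfLinearIndependentOfCardEqFinrank (normalForm_ne_zero_iff.mp hpos) (by simp) with hB
  have hB0 : B 0 = w := by simp [hB]
  have hBs : ∀ k : Fin n, B k.succ = b k := fun k => by simp [hB]
  set C : Space n ≃ₗ[ℝ] Space n :=
    B.equiv (EuclideanSpace.basisFun (Fin (n + 1)) ℝ).toBasis (Equiv.refl _) with hC
  have hCB : ∀ i, C (B i) = EuclideanSpace.single i 1 := fun i => by simp [hC]
  refine ⟨C.toContinuousLinearEquiv, ?_, fun k => ?_, fun y => ?_⟩
  · rw [← hCB, hB0]; rfl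
  · rw [← hCB, hBs]; rfl
  · have h1 : (EuclideanSpace.proj (𝕜 := ℝ) (0 : Fin (n + 1))).toLinearMap ∘ₗ C.toLinearMap =
        (l : Space n →ₗ[ℝ] ℝ) := by
      refine B.ext fun i => ?_
      simp only [LinearMap.comp_apply, LinearEquiv.coe_coe, hCB]
      refine Fin.cases ?_ (fun k => ?_) i
      · simp [hB0, hw]
      · simp [hBs, hb]
    exact congrArg (fun f => f y) h1

/-- A zero of `ρ` is the limit of the points `y - t e`, where `ρ` is negative. -/
theorem IsOutward.mem_frontier {Ω N : Set (Space n)} {ρ : Space n → ℝ} {e : Space n}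
    (h : IsOutward Ω N ρ e) {y : Space n} (hy : y ∈ N) (h0 : ρ y = 0) : y ∈ frontier Ω := by
  rw [h.isOpen_domain.frontier_eq]
  refine ⟨?_, fun hyΩ => (((h.mem_iff y hy).mp hyΩ).trans_eq h0.symm).false⟩
  have h1 : Tendsto (fun t : ℝ => y - t • e) (𝓝[>] 0) (𝓝 y) := by
    have : Continuous fun t : ℝ => y - t • e := by fun_prop
    have h2 := this.tendsto 0
    simp only [zero_smul, sub_zero] at h2
    exact h2.mono_left nhdsWithin_le_nhds
  refine mem_closure_of_tendsto h1 ?_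
  filter_upwards [h1.eventually_mem (h.isOpen.mem_nhds hy), self_mem_nhdsWithin] with t ht ht0
  rw [h.mem_iff _ ht]
  have h3 := h.lt_add ht ht0 (by simpa using hy)
  rwa [sub_add_cancel, h0] at h3

/-- The inclusion of `ℝ^n` as the coordinate hyperplane. -/
noncomputable def hyperplaneL (n : ℕ) : EuclideanSpace ℝ (Fin n) →L[ℝ] Space n :=
  LinearMap.toContinuousLinearMap
    { toFun := fun u => WithLp.toLp 2 (Fin.cons 0 u : Fin (n + 1) → ℝ)
      map_add' := fun u v => by
        ext i
        refine Fin.cases ?_ (fun k => ?_) i <;> simp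
      map_smul' := fun c u => by
        ext i
        refine Fin.cases ?_ (fun k => ?_) i <;> simp }

@[simp] theorem hyperplaneL_zero (u : EuclideanSpace ℝ (Fin n)) : hyperplaneL n u 0 = 0 := rfl

@[simp] theorem tail_hyperplaneL (u : EuclideanSpace ℝ (Fin n)) : tail (hyperplaneL n u) = u := rfl

theorem hyperplaneL_tail {z : Space n} (hz : z 0 = 0) : hyperplaneL n (tail z) = z := by
  ext i
  refine Fin.cases ?_ (fun k => ?_) i
  · simp [hz]
  · rfl

/-- Local coordinates that flatten the boundary. -/
theorem exists_flattening {Ω N : Set (Space n)} {ρ : Space n → ℝ} {w p : Space n}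
    (hN : IsOutward Ω N ρ w) (hp : p ∈ N) (hρ : ContDiffAt ℝ 1 ρ p) {C : Space n ≃L[ℝ] Space n}
    (hC : ∀ y, C y 0 = fderiv ℝ ρ p y) :
    ∃ H : OpenPartialHomeomorph (Space n) (Space n), p ∈ H.target ∧ H.target ⊆ N ∧
      (∀ z ∈ H.source, ContDiffAt ℝ 1 H z) ∧
      ∀ z ∈ H.source, ρ (H z) = z 0 ∧ tail (C (H z - p)) = tail z := by
  -- In the linear coordinates `C` the first coordinate is replaced by `ρ` and the others are kept.
  -- As `ρ` and its linear part have the same derivative at `p`, the derivative of `G` there is `C`,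
  -- and the inverse function theorem applies.
  set G : Space n → Space n := fun y =>
    C (y - p) + (ρ y - fderiv ℝ ρ p (y - p)) • EuclideanSpace.single 0 1 with hG
  have hG0 : ∀ y, G y 0 = ρ y := fun y => by simp [hG, hC]
  have hGt : ∀ y, tail (G y) = tail (C (y - p)) := fun y => by
    ext k
    simp [hG]
  have hGc : ContDiffAt ℝ 1 G p := by
    have h1 : ContDiffAt ℝ 1 (fun y : Space n => y - p) p := contDiffAt_id.sub contDiffAt_const
    exact (C.contDiff.contDiffAt.comp p h1).add ((hρ.sub ((fderiv ℝ ρ p).contDiff.contDiffAt.comp p h1)).smul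
      contDiffAt_const)
  have hGd : HasFDerivAt G (C : Space n →L[ℝ] Space n) p := by
    have h1 : HasFDerivAt (fun y : Space n => y - p) (ContinuousLinearMap.id ℝ (Space n)) p :=
      (hasFDerivAt_id p).sub_const p
    have h2 := (C.toContinuousLinearMap.hasFDerivAt.comp p h1).add
      (((hρ.differentiableAt one_ne_zero).hasFDerivAt.sub
        ((fderiv ℝ ρ p).hasFDerivAt.comp p h1)).smul_const
          (EuclideanSpace.single 0 1 : Space n))
    refine h2.congr_fderiv ?_
    ext y i
    simp
  set R := hGc.toOpenPartialHomeomorph G hGd one_ne_zero with hR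
  have hRG : ∀ y, R y = G y := fun y => rfl
  have hpR : p ∈ R.source := hGc.mem_toOpenPartialHomeomorph_source hGd one_ne_zero
  have hsymm : ContDiffAt ℝ 1 R.symm (G p) := hGc.to_localInverse hGd one_ne_zero
  have hev : ∀ᶠ z in 𝓝 (G p), ContDiffAt ℝ 1 R.symm z := hsymm.eventually (by simp)
  obtain ⟨T, hT, hTo, hpT⟩ := eventually_nhds_iff.mp hev
  have hev2 : ∀ᶠ z in 𝓝 (G p), R.symm z ∈ N := by
    refine hsymm.continuousAt.eventually_mem (hN.isOpen.mem_nhds ?_)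
    rw [← hRG, R.left_inv hpR]
    exact hp
  obtain ⟨T', hT', hTo', hpT'⟩ := eventually_nhds_iff.mp hev2
  set H := R.symm.restrOpen (T ∩ T') (hTo.inter hTo') with hH
  have hHR : ∀ z, H z = R.symm z := fun z => rfl
  have hHs : ∀ z ∈ H.source, z ∈ R.target ∧ z ∈ T ∧ z ∈ T' := fun z hz => by
    simpa [hH] using hz
  refine ⟨H, ?_, fun y hy => ?_, fun z hz => ?_, fun z hz => ?_⟩
  · have h1 : G p ∈ H.source := by
      refine ⟨?_, hpT, hpT'⟩
      exact R.map_source hpR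
    have h2 := H.map_source h1
    rwa [hHR, ← hRG, R.left_inv hpR] at h2
  · have h1 := H.map_target hy
    have h2 := hT' _ (hHs _ h1).2.2
    rwa [← hHR, H.right_inv hy] at h2
  · exact hT z (hHs z hz).2.1
  · have h1 : G (H z) = z := R.right_inv (hHs z hz).1
    rw [← hG0, ← hGt, h1]
    exact ⟨rfl, rfl⟩

/-- The graph parametrization of the boundary in flattening coordinates. -/
theorem exists_boundaryPatch (hn : 1 ≤ n) {Ω : Set (Space n)} (hΩ : IsC1Domain Ω) {p : Space n}
    (hp : p ∈ frontier Ω) : ∃ (P : BoundaryPatch Ω) (W : Set (Space n)), IsOpen W ∧ p ∈ W ∧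
      P.φ '' P.dom = W ∩ frontier Ω := by
  obtain ⟨ρ, hρ, hne, hiff⟩ := hΩ.boundary p hp
  obtain ⟨w, b, hw, hb, hpos⟩ := exists_frame hn hne
  obtain ⟨C, hCw, hCb, hC⟩ := exists_frame_coordinates hw hb hpos.ne'
  obtain ⟨r, hN, hr⟩ := ((eventually_isOutward hΩ.isOpen hρ hiff
    (hw.symm ▸ zero_lt_one : 0 < fderiv ℝ ρ p w)).and self_mem_nhdsWithin).exists
  obtain ⟨H, hpH, hHN, hHc, hHz⟩ := exists_flattening hN (Metric.mem_ball_self hr) hρ hC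
  set dom : Set (EuclideanSpace ℝ (Fin n)) := hyperplaneL n ⁻¹' H.source with hdom
  have hdomo : IsOpen dom := H.open_source.preimage (hyperplaneL n).continuous
  set φ : EuclideanSpace ℝ (Fin n) → Space n := fun u => H (hyperplaneL n u) with hφ
  have hφc : ∀ u ∈ dom, ContDiffAt ℝ 1 φ u := fun u hu =>
    (hHc _ hu).comp u (hyperplaneL n).contDiff.contDiffAt
  have hφN : ∀ u ∈ dom, φ u ∈ Metric.ball p r := fun u hu => hHN (H.map_source hu)
  have hφfr : ∀ u ∈ dom, φ u ∈ frontier Ω := fun u hu =>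
    hN.mem_frontier (hφN u hu) ((hHz _ hu).1.trans (hyperplaneL_zero u))
  have himage : ∀ O ⊆ dom, φ '' O = H '' (H.source ∩ tail ⁻¹' O) ∩ frontier Ω := by
    intro O hO
    ext y
    constructor
    · rintro ⟨u, hu, rfl⟩
      exact ⟨⟨hyperplaneL n u, ⟨hO hu, by simpa using hu⟩, rfl⟩, hφfr u (hO hu)⟩
    · rintro ⟨⟨z, ⟨hz, hzO⟩, rfl⟩, hfr⟩
      refine ⟨tail z, hzO, ?_⟩
      have h1 := hN.eq_zero_of_mem_frontier (hHN (H.map_source hz)) hfr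
      rw [(hHz z hz).1] at h1
      simp only [hφ, hyperplaneL_tail h1]
  have hopen : ∀ O, IsOpen O → IsOpen (H '' (H.source ∩ tail ⁻¹' O)) := fun O hO =>
    H.isOpen_image_of_subset_source (H.open_source.inter (hO.preimage continuous_tail))
      inter_subset_left
  -- The parameters are the last `n` coordinates of `C (φ u - p)`, so in these coordinates the
  -- `k`-th tangent vector agrees with `b k` and can differ only along `w`.
  have htangent : ∀ u ∈ dom, ∃ c : Fin n → ℝ, tangent φ u = fun k => c k • w + b k := by
    intro u hu
    have hd : HasFDerivAt φ (fderiv ℝ φ u) u := ((hφc u hu).differentiableAt one_ne_zero).hasFDerivAt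
    have h1 : HasFDerivAt (fun v => tail (C (φ v - p)))
        ((tailL n ∘L (C : Space n →L[ℝ] Space n)) ∘L fderiv ℝ φ u) u :=
      (tailL n ∘L (C : Space n →L[ℝ] Space n)).hasFDerivAt.comp u (hd.sub_const p)
    have h2 : (fun v => tail (C (φ v - p))) =ᶠ[𝓝 u] id := by
      filter_upwards [hdomo.mem_nhds hu] with v hv
      exact (hHz _ hv).2
    have h3 := h1.unique ((hasFDerivAt_id u).congr_of_eventuallyEq h2)
    refine ⟨fun k => C (tangent φ u k) 0, funext fun k => C.injective ?_⟩
    have h4 : tail (C (tangent φ u k)) = EuclideanSpace.single k 1 :=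
      congrArg (fun A => A (EuclideanSpace.single k 1)) h3
    rw [map_add, map_smul, hCw, hCb]
    ext i
    refine Fin.cases ?_ (fun m => ?_) i
    · simp
    · have h5 := congrArg (fun z => z m) h4
      simpa [Pi.single_apply] using h5
  let P : BoundaryPatch Ω :=
    { dom := dom
      isOpen_dom := hdomo
      φ := φ
      contDiffOn := fun u hu => (hφc u hu).contDiffWithinAt
      injOn := fun u hu v hv huv => by
        have h1 := congrArg tail (H.injOn hu hv huv)
        simpa using h1
      image_open := fun O hO hOo => ⟨_, hopen O hOo, himage O hO⟩
      oriented := fun u hu => by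
        refine ⟨w, ?_, ?_⟩
        · have hN1 : ∀ s : ℝ, ∀ᶠ t : ℝ in 𝓝[>] 0, φ u + t • s • w ∈ Metric.ball p r := by
            intro s
            have h1 : Continuous fun t : ℝ => φ u + t • s • w := by fun_prop
            have h2 := h1.tendsto 0
            simp only [zero_smul, add_zero] at h2
            exact (h2.mono_left nhdsWithin_le_nhds).eventually_mem
              (Metric.isOpen_ball.mem_nhds (hφN u hu))
          have hfr := hφfr u hu
          rw [hΩ.isOpen.frontier_eq] at hfr
          filter_upwards [hN1 1, hN1 (-1), self_mem_nhdsWithin] with t h1 h2 ht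
          rw [one_smul] at h1
          rw [neg_one_smul, smul_neg, ← sub_eq_add_neg] at h2
          exact ⟨hN.add_notMem (hφN u hu) hfr.2 ht h1, hN.sub_mem (hφN u hu) hfr.1 ht h2⟩
        · rw [← normalForm_eq_det]
          obtain ⟨c, hc⟩ := htangent u hu
          rw [hc, normalForm_add_smul]
          exact hpos }
  refine ⟨P, H '' (H.source ∩ tail ⁻¹' dom), hopen _ hdomo, ?_, himage dom subset_rfl⟩
  refine ⟨H.symm p, ⟨H.map_target hpH, ?_⟩, H.right_inv hpH⟩
  have h1 := H.map_target hpH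
  have h2 := (hHz _ h1).1
  rw [H.right_inv hpH, hN.eq_zero_of_mem_frontier (Metric.mem_ball_self hr) hp] at h2
  rw [mem_preimage, hdom, mem_preimage, hyperplaneL_tail h2.symm]
  exact h1

theorem IsC1Domain.nonempty_boundaryAtlas (hn : 1 ≤ n) {Ω : Set (Space n)} (hΩ : IsC1Domain Ω) :
    Nonempty (BoundaryAtlas Ω) := by
  choose P W hWo hpW hPW using fun p : frontier Ω => exists_boundaryPatch hn hΩ p.2
  have hK : IsCompact (frontier Ω) :=
    hΩ.isBounded.isCompact_closure.of_isClosed_subset isClosed_frontier frontier_subset_closure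
  obtain ⟨t, ht⟩ := hK.elim_finite_subcover W hWo fun p hp => mem_iUnion.mpr ⟨⟨p, hp⟩, hpW _⟩
  set q : Fin t.card → frontier Ω := fun i => t.equivFin.symm i with hq
  obtain ⟨χ, hsupp, hsum, -, -⟩ := exists_continuous_sum_one_of_isOpen_isCompact
    (s := fun i => W (q i)) (fun i => hWo _) hK (by
      intro y hy
      obtain ⟨p, hp, hyp⟩ := mem_iUnion₂.mp (ht hy)
      exact mem_iUnion.mpr ⟨t.equivFin ⟨p, hp⟩, by simpa [hq] using hyp⟩)
  exact ⟨{
    card := t.card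
    patch := fun i => P (q i)
    χ := fun i => χ i
    continuous_χ := fun i => (χ i).continuous
    support_χ := fun i => by
      rw [hPW]
      exact inter_subset_inter_left _ (hsupp i)
    sum_χ := fun y hy => by simpa using hsum hy }⟩

end

end

end CliffordCauchy

/-! ### The theorem. -/

theorem mainTheorem3 (n : ℕ) (hn : 1 ≤ n) (ε : ℝ) (hε : ε = 1 ∨ ε = -1)
    (Ω : Set (Space n)) (hΩ : IsC1Domain Ω) :
    Nonempty (BoundaryAtlas Ω) ∧ ∀ A : BoundaryAtlas Ω,
      -- `M` a bounded operator on functions on the closure of `Ω`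
      (∀ (V : Type*) [NormedAddCommGroup V] [NormedSpace ℝ V] [CompleteSpace V] [Module (Cl n) V]
          [IsScalarTower ℝ (Cl n) V] [ContinuousConstSMul (Cl n) V]
          (M : BoundedContinuousFunction (closure Ω) V →L[ℝ]
            BoundedContinuousFunction (closure Ω) V),
          IsAdmissible ε M → ∀ f : BoundedContinuousFunction (closure Ω) V,
          SolvesDirac ε Ω (extendZero f) (extendZero (M f)) →
          (∃ F : BoundedContinuousFunction (closure Ω) V,
            (∀ x : closure Ω, (x : Space n) ∈ Ω →
              F x = A.integral ε (fun y => cauchyKernel ε (y - (x : Space n)))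
                (fun y => extendZero (NormedSpace.exp (-(y 0) • M) f) y)) ∧
            ∀ x : closure Ω, (x : Space n) ∈ Ω →
              NormedSpace.exp ((x : Space n) 0 • M) F x = f x) ∧
          ∀ x ∉ closure Ω,
            A.integral ε (fun y => cauchyKernel ε (y - x))
              (fun y => extendZero (NormedSpace.exp (-(y 0) • M) f) y) = 0) ∧
      -- `M` a bounded operator on the values that commutes with the units `e_j`
      (∀ (V : Type*) [NormedAddCommGroup V] [NormedSpace ℝ V] [CompleteSpace V] [Module (Cl n) V]
          [IsScalarTower ℝ (Cl n) V] [ContinuousConstSMul (Cl n) V] (M : V →L[ℝ] V),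
          (∀ (j : Fin n) (v : V), M (e j • v) = e j • M v) →
          ∀ f : Space n → V, SolvesDirac ε Ω f (fun y => M (f y)) →
          (∀ x ∈ Ω, NormedSpace.exp (x 0 • M)
            (A.integral ε (fun y => cauchyKernel ε (y - x))
              (fun y => NormedSpace.exp (-(y 0) • M) (f y))) = f x) ∧
          ∀ x ∉ closure Ω, NormedSpace.exp (x 0 • M)
            (A.integral ε (fun y => cauchyKernel ε (y - x))
              (fun y => NormedSpace.exp (-(y 0) • M) (f y))) = 0) ∧
      -- `M` the right multiplication by a Clifford number `lam`
      (∀ (lam : Cl n) (f : Space n → Cl n), SolvesDirac ε Ω f (fun y => f y * lam) →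
          (∀ x ∈ Ω, A.integral ε (fun y => cauchyKernel ε (y - x))
            (fun y => f y * NormedSpace.exp ((x 0 - y 0) • lam)) = f x) ∧
          ∀ x ∉ closure Ω, A.integral ε (fun y => cauchyKernel ε (y - x))
            (fun y => f y * NormedSpace.exp ((x 0 - y 0) • lam)) = 0) ∧
      -- `M` the multiplication by a real number `lam`
      (∀ (lam : ℝ) (f : Space n → Cl n), SolvesDirac ε Ω f (fun y => lam • f y) →
          (∀ x ∈ Ω, A.integral ε
            (fun y => Real.exp ((x 0 - y 0) * lam) • cauchyKernel ε (y - x)) f = f x) ∧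
          ∀ x ∉ closure Ω, A.integral ε
            (fun y => Real.exp ((x 0 - y 0) * lam) • cauchyKernel ε (y - x)) f = 0) := by
  refine ⟨hΩ.nonempty_boundaryAtlas hn, fun A => ⟨?_, ?_, ?_, ?_⟩⟩
  · intro V _ _ _ _ _ _ M hM f hf
    refine ⟨?_, fun x hx => ?_⟩
    · obtain ⟨F, hF, hFf⟩ := hM.exists_twisted hΩ.isBounded f
      refine ⟨F, fun x hx => ?_, fun x _ => hFf x⟩
      rw [A.integral_exp_function_operator hΩ hε hM hf (hΩ.notMem_frontier hx),
        Set.indicator_of_mem hx, extendZero_apply, hF]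
    · rw [A.integral_exp_function_operator hΩ hε hM hf (notMem_frontier_of_notMem_closure hx),
        Set.indicator_of_notMem fun h => hx (subset_closure h)]
  · intro V _ _ _ _ _ _ M hM f hf
    refine ⟨fun x hx => ?_, fun x hx => ?_⟩
    · rw [A.integral_exp_value_operator hΩ hε hM hf (hΩ.notMem_frontier hx),
        Set.indicator_of_mem hx]
    · rw [A.integral_exp_value_operator hΩ hε hM hf (notMem_frontier_of_notMem_closure hx),
        Set.indicator_of_notMem fun h => hx (subset_closure h)]
  · intro lam f hf
    refine ⟨fun x hx => ?_, fun x hx => ?_⟩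
    · rw [A.integral_exp_mul hΩ hε hf (hΩ.notMem_frontier hx), Set.indicator_of_mem hx]
    · rw [A.integral_exp_mul hΩ hε hf (notMem_frontier_of_notMem_closure hx),
        Set.indicator_of_notMem fun h => hx (subset_closure h)]
  · intro lam f hf
    refine ⟨fun x hx => ?_, fun x hx => ?_⟩
    · rw [A.integral_exp_real hΩ hε hf (hΩ.notMem_frontier hx), Set.indicator_of_mem hx]
    · rw [A.integral_exp_real hΩ hε hf (notMem_frontier_of_notMem_closure hx),
        Set.indicator_of_notMem fun h => hx (subset_closure h)]
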